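/- **Theorem.** Let $G=(V,E)$ be a directed graph on $n$ vertices and let $f:V\to\{B,R\}$ be a coloring of its vertices blue or red. For a rational number $p\in[0,1]$ and a vertex $v$ let $N^+(v)$ be the set of out-neighbors of $v$, let $b_v$ be the number of blue out-neighbors of $v$, and let $$\mathrm{def}_p(v)=\max\{0,\ \lceil p\,|N^+(v)|\rceil-b_v\}$$ be the $p$-deficiency of $v$. The vertex $v$ is under $p$-illusion if $\mathrm{def}_p(v)>0$, and $G$ is $p$-illusion-free under a coloring if no vertex is under $p$-illusion. In the problem $p$-DIFR one is given $G$, $f$, an integer $k\ge 0$ and a rational $p\in[0,1]$, and asks whether there is a coloring $f':V\to\{B,R\}$ under which $G$ is $p$-illusion-free with $|\{v: f(v)\ne f'(v)\}|\le k$. There is one algorithm that, given an instance $(G,f,k,p)$ of $p$-DIFR together with a tree decomposition of the underlying undirected graph of $G$, decides the instance, and there are absolute constants $C,c$ such that the following holds. If $\mathrm{def}_p(v)\le D$ for all $v\in V$ and the given tree decomposition has width at most $tw$ (for example, if $tw$ is the treewidth of the underlying undirected graph and the decomposition is optimal), then the algorithm takes at most $$C\cdot\bigl(2(D+1)\bigr)^{tw}\cdot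 N^{c}$$ steps. Here $N$ is the size of the input: $n$, plus the number of nodes of the given decomposition tree, plus the lengths of the binary expansions of $k$ and of the numerator and denominator of $p$. In particular the running time is $O\bigl((2(D+1))^{tw}\bigr)\cdot n^{O(1)}$ when the number of nodes of the decomposition tree and these binary lengths are polynomially bounded in $n$. (Steps are counted in the WHILE language on binary trees: constant, projections, pairing, test for the empty tree, sequential composition, branching, loops and recursion along a tree, each costing one step per execution.) -/

import Mathlib

/-! ## The computational model: unit-cost programs on binary trees -/

/-- Binary trees, the data on which programs compute (atoms `nil` and ordered pairs `cons`). -/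
inductive BinData : Type where
  | nil : BinData
  | cons : BinData → BinData → BinData

namespace BinData

/-- First component; the first component of `nil` is `nil`. -/
def fst : BinData → BinData
  | nil => nil
  | cons a _ => a

/-- Second component; the second component of `nil` is `nil`. -/
def snd : BinData → BinData
  | nil => nil
  | cons _ b => b

/-- Booleans as trees: `false` is `nil`, `true` is `cons nil nil`. -/
def ofBool : Bool → BinData
  | false => nil
  | true => cons nil nil

/-- Lists as right-nested pairs. -/
def ofList : List BinData → BinData
  | [] => nil
  | a :: l => cons a (ofList l)

/-- A bit string. -/
def ofBits (l : List Bool) : BinData := ofList (l.map ofBool)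

/-- A natural number in binary, least significant bit first. -/
def ofNat (k : ℕ) : BinData := ofBits k.bits

open Classical in
/-- A subset of `Fin n`, as its characteristic bit string of length `n`. -/
noncomputable def ofPred {n : ℕ} (q : Fin n → Prop) : BinData :=
  ofBits (List.ofFn fun v => decide (q v))

/-- A binary relation on `Fin n`, as its `n × n` adjacency matrix, row by row. -/
noncomputable def ofRel {n : ℕ} (r : Fin n → Fin n → Prop) : BinData :=
  ofList (List.ofFn fun u => ofPred (r u))

end BinData

/-- Programs: the WHILE language on binary trees, in which all basic operations (constant `nil`,
projections, pairing, test for `nil`) work on pointers and take constant time. A program maps one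
tree to one tree; `seq P Q` runs `P` and then `Q`, `pair P Q` runs both on the same input and pairs
the results, `cond B P Q` runs `Q` if the result of `B` is `nil` and `P` otherwise, `loop B P`
repeats `P` while the result of `B` is not `nil`, and `fold P Q` is recursion along a tree. -/
inductive Prog : Type where
  | nil : Prog
  | id : Prog
  | fst : Prog
  | snd : Prog
  | seq : Prog → Prog → Prog
  | pair : Prog → Prog → Prog
  | cond : Prog → Prog → Prog → Prog
  | loop : Prog → Prog → Prog
  | fold : Prog → Prog → Prog

/-- `Prog.Run P x y t`: on input `x` the program `P` halts with output `y` after exactly `t`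
steps. Every execution of every construct costs one step in addition to the steps of the programs
that it runs; in particular every iteration of a loop and every node visited by a recursion is
charged. The input of `fold P Q` is a pair of an environment `e` and a tree `d`; on `d = nil` it
runs `P` on `e`, and on `d = cons l r` it runs itself on `(e, l)` and `(e, r)` with results `a` and
`b`, and then `Q` on `(e, ((l, r), (a, b)))`. -/
inductive Prog.Run : Prog → BinData → BinData → ℕ → Prop where
  | nil (x : BinData) : Prog.Run Prog.nil x BinData.nil 1
  | id (x : BinData) : Prog.Run Prog.id x x 1
  | fst (x : BinData) : Prog.Run Prog.fst x x.fst 1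
  | snd (x : BinData) : Prog.Run Prog.snd x x.snd 1
  | seq {P Q : Prog} {x y z : BinData} {s t : ℕ} :
      Prog.Run P x y s → Prog.Run Q y z t → Prog.Run (Prog.seq P Q) x z (s + t + 1)
  | pair {P Q : Prog} {x y z : BinData} {s t : ℕ} :
      Prog.Run P x y s → Prog.Run Q x z t →
        Prog.Run (Prog.pair P Q) x (BinData.cons y z) (s + t + 1)
  | cond_true {B P Q : Prog} {x a b y : BinData} {s t : ℕ} :
      Prog.Run B x (BinData.cons a b) s → Prog.Run P x y t →
        Prog.Run (Prog.cond B P Q) x y (s + t + 1)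
  | cond_false {B P Q : Prog} {x y : BinData} {s t : ℕ} :
      Prog.Run B x BinData.nil s → Prog.Run Q x y t →
        Prog.Run (Prog.cond B P Q) x y (s + t + 1)
  | loop_stop {B P : Prog} {x : BinData} {s : ℕ} :
      Prog.Run B x BinData.nil s → Prog.Run (Prog.loop B P) x x (s + 1)
  | loop_step {B P : Prog} {x a b y z : BinData} {s t u : ℕ} :
      Prog.Run B x (BinData.cons a b) s → Prog.Run P x y t → Prog.Run (Prog.loop B P) y z u →
        Prog.Run (Prog.loop B P) x z (s + t + u + 1)
  | fold_nil {P Q : Prog} {x y : BinData} {s : ℕ} :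
      x.snd = BinData.nil → Prog.Run P x.fst y s → Prog.Run (Prog.fold P Q) x y (s + 1)
  | fold_cons {P Q : Prog} {x l r a b y : BinData} {s t u : ℕ} :
      x.snd = BinData.cons l r →
        Prog.Run (Prog.fold P Q) (BinData.cons x.fst l) a s →
        Prog.Run (Prog.fold P Q) (BinData.cons x.fst r) b t →
        Prog.Run Q (BinData.cons x.fst (BinData.cons (BinData.cons l r) (BinData.cons a b))) y u →
        Prog.Run (Prog.fold P Q) x y (s + t + u + 1)

/-! ## Illusion in coloured digraphs -/

/-- The two colours. -/
inductive VColor : Type where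
  | blue : VColor
  | red : VColor

section Illusion

/-- The number `|N⁺(v)|` of out-neighbours. -/
noncomputable def outDegree {V : Type*} (G : Digraph V) (v : V) : ℕ :=
  {u : V | G.Adj v u}.ncard

/-- The number `b_v` of blue out-neighbours of `v` under the colouring `f`. -/
noncomputable def blueOutDegree {V : Type*} (G : Digraph V) (f : V → VColor) (v : V) : ℕ :=
  {u : V | G.Adj v u ∧ f u = VColor.blue}.ncard

/-- The `p`-deficiency `max {0, ⌈p · |N⁺(v)|⌉ - b_v}` of `v`. -/
noncomputable def pDeficiency {V : Type*} (p : ℚ) (G : Digraph V) (f : V → VColor) (v : V) : ℤ :=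
  max 0 (⌈p * (outDegree G v : ℚ)⌉ - (blueOutDegree G f v : ℤ))

/-- `v` is under `p`-illusion. -/
def UnderPIllusion {V : Type*} (p : ℚ) (G : Digraph V) (f : V → VColor) (v : V) : Prop :=
  0 < pDeficiency p G f v

/-- `G` is `p`-illusion-free under `f`. -/
def PIllusionFree {V : Type*} (p : ℚ) (G : Digraph V) (f : V → VColor) : Prop :=
  ∀ v : V, ¬ UnderPIllusion p G f v

end Illusion

/-- An instance of `p`-DIFR on `n` vertices: a digraph, a colouring, a budget `k` and a rational
number `p ∈ [0, 1]`. -/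
structure PDifr (n : ℕ) where
  graph : Digraph (Fin n)
  color : Fin n → VColor
  k : ℕ
  p : ℚ
  p_nonneg : 0 ≤ p
  p_le_one : p ≤ 1

/-- The question of `p`-DIFR: can at most `k` vertices be recoloured so that the graph becomes
`p`-illusion-free? -/
def PDifr.IsYes {n : ℕ} (I : PDifr n) : Prop :=
  ∃ f' : Fin n → VColor, PIllusionFree I.p I.graph f' ∧ {v | I.color v ≠ f' v}.ncard ≤ I.k

/-! ## Tree decompositions -/

/-- `(T, bag)` is a tree decomposition of the undirected graph `G`: `T` is a tree, both ends of
every edge of `G` lie in a common bag, and for every vertex `v` the nodes whose bag contains `v`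
induce a connected (in particular nonempty) subgraph of `T`. -/
structure IsTreeDecomposition {V ι : Type*} (G : SimpleGraph V) (T : SimpleGraph ι)
    (bag : ι → Finset V) : Prop where
  isTree : T.IsTree
  edge_mem_bag : ∀ u v : V, G.Adj u v → ∃ i : ι, u ∈ bag i ∧ v ∈ bag i
  connected : ∀ v : V, (T.induce {i : ι | v ∈ bag i}).Connected

/-- The decomposition has width at most `w`, i.e. every bag has at most `w + 1` elements. -/
def BagWidthLE {V ι : Type*} (bag : ι → Finset V) (w : ℕ) : Prop :=
  ∀ i : ι, (bag i).card ≤ w + 1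

/-! ## Inputs -/

/-- The input tree: the adjacency matrix of the digraph, the set of red vertices, `k` in binary,
numerator and denominator of `p` in binary, the adjacency matrix of the decomposition tree and the
list of its bags. -/
noncomputable def PDifr.encode {n m : ℕ} (I : PDifr n) (T : SimpleGraph (Fin m))
    (bag : Fin m → Finset (Fin n)) : BinData :=
  BinData.cons (BinData.ofRel I.graph.Adj) <|
  BinData.cons (BinData.ofPred fun v => I.color v = VColor.red) <|
  BinData.cons (BinData.ofNat I.k) <|
  BinData.cons (BinData.cons (BinData.ofNat I.p.num.natAbs) (BinData.ofNat I.p.den)) <|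
  BinData.cons (BinData.ofRel T.Adj) <|
  BinData.ofList (List.ofFn fun i => BinData.ofPred fun v => v ∈ bag i)

/-- The size of the input: number of vertices, number of nodes of the decomposition tree, and the
binary lengths of `k` and of the numerator and denominator of `p`. -/
def PDifr.inputSize {n : ℕ} (I : PDifr n) (m : ℕ) : ℕ :=
  n + m + I.k.size + I.p.num.natAbs.size + I.p.den.size

/-! Turning blue vertices red never helps, so the question is whether some set S of at most k red
vertices gives every vertex v at least d(v) out-neighbours in S, where d(v) is its deficiency
(`PDifr.isYes_iff`). A dynamic programme that stores how much of each deficiency is already covered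
has the right number of states, but merging two branches is then a convolution, which squares the
factor D + 1. The proof replaces the decision by a weighted count in which merging is pointwise
multiplication.

If g is the number of out-neighbours of v in S, the weight `wt d g`, the product of 2^g - 2^j over j
< d, vanishes exactly when g < d. It is a polynomial of degree d in y = 2^g. Its term c_a y^a equals
c_a times a factor 2^a for every arc from v into S, so it is a product of factors local to vertices
and arcs. Expanding all weights turns the weighted number of feasible sets into the partition
function of a model with vertex and pair factors, in which a vertex has a state (flipped or not,
exponent a), hence at most 2(d(v) + 1) states (`sum_asgWeight`).

To see cardinalities, each flipped vertex contributes a further factor 2^B, where 2^B exceeds the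
sum of all the weights. These are nonnegative integers, so nothing cancels, and the total Z is
divisible by 2^(B(k+1)) exactly when no feasible set has at most k elements (`dvd_sum_iff`,
`zsum_dvd_iff`). It therefore suffices to know Z modulo 2^M for a polynomially large M, and the
negative coefficients c_a cause no trouble in that ring.

Z is evaluated on the given decomposition by removing leaves of the tree one at a time: the table of
a leaf is summed out into a message that multiplies the table of its neighbour
(`Remaining.partition_leaf`, `Remaining.partition_last`). A table has at most (2(D+1))^(tw+1)
entries; as deficiencies are also at most n, one of these factors is at most 2(n+1) and joins the
polynomial part (`Par.keyCount_le`). Messages are kept in search trees, so every table entry costs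
polynomial time.

Programs are not written out in full. `Cp c W f` says that some program computes f with cost W times
a polynomial, and it is shown to be closed under the constructions used. The two halves, `cp_answer`
for the running time and `PDifr.raw_answer_iff` for correctness, meet in `mainTheorem3`. -/

/-! ## Encodings and computability with time bounds -/

/-- Types whose elements are represented by binary trees. -/
class Enc (α : Type) where
  enc : α → BinData

instance : Enc BinData := ⟨fun x => x⟩
instance : Enc Bool := ⟨BinData.ofBool⟩
/-- Natural numbers are represented in unary. -/
instance : Enc ℕ := ⟨fun n => BinData.ofList (List.replicate n BinData.nil)⟩
instance {α : Type} [Enc α] : Enc (List α) := ⟨fun l => BinData.ofList (l.map Enc.enc)⟩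
instance {α β : Type} [Enc α] [Enc β] : Enc (α × β) := ⟨fun x => BinData.cons (Enc.enc x.1) (Enc.enc x.2)⟩

open Enc

/-- A family of inputs, with the size of each input. -/
structure Ctx (I : Type) where
  s : I → ℕ
  inp : I → BinData

variable {I J α β γ : Type} [Enc α] [Enc β] [Enc γ]

/-- `f` is computed from the inputs of `c` within `(W + 1) * (s + 2) ^ e` steps. -/
def Cp (c : Ctx I) (W : I → ℕ) (f : I → α) : Prop :=
  ∃ (P : Prog) (e : ℕ), ∀ i, ∃ t, t ≤ (W i + 1) * (c.s i + 2) ^ e ∧ Prog.Run P (c.inp i) (enc (f i)) t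

/-- `h` is polynomially bounded. -/
def PB (c : Ctx I) (h : I → ℕ) : Prop := ∃ e, ∀ i, h i ≤ (c.s i + 2) ^ e

namespace PB

variable {c : Ctx I} {g h : I → ℕ}

theorem mono (hg : PB c g) (hh : ∀ i, h i ≤ g i) : PB c h :=
  hg.imp fun _ he i => (hh i).trans (he i)

theorem const (n : ℕ) : PB c (fun _ => n) := by
  refine ⟨n, fun i => (Nat.lt_two_pow_self).le.trans (Nat.pow_le_pow_left (by omega) _)⟩

theorem add (hg : PB c g) (hh : PB c h) : PB c (fun i => g i + h i) := by
  obtain ⟨a, ha⟩ := hg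
  obtain ⟨b, hb⟩ := hh
  refine ⟨a + b + 1, fun i => ?_⟩
  have h1 : 1 ≤ c.s i + 2 := by omega
  calc g i + h i ≤ (c.s i + 2) ^ (a + b) + (c.s i + 2) ^ (a + b) :=
        add_le_add ((ha i).trans (Nat.pow_le_pow_right h1 (by omega)))
          ((hb i).trans (Nat.pow_le_pow_right h1 (by omega)))
    _ ≤ (c.s i + 2) ^ (a + b + 1) := by rw [pow_succ, ← mul_two]; gcongr; omega

theorem mul (hg : PB c g) (hh : PB c h) : PB c (fun i => g i * h i) := by
  obtain ⟨a, ha⟩ := hg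
  obtain ⟨b, hb⟩ := hh
  exact ⟨a + b, fun i => by rw [pow_add]; exact Nat.mul_le_mul (ha i) (hb i)⟩

theorem size : PB c c.s := ⟨1, fun i => by simp⟩

end PB

/-- The family of inputs `c`, extended by values `b` and `a`. -/
structure ExtIdx (I α β : Type) (R : I → β → α → Prop) where
  i : I
  b : β
  a : α
  h : R i b a

/-- A loop body is a program on the original input together with the accumulator and the current
element. The relation `R` carries the loop invariant, so size bounds inside the body may use it. The
size stays that of the original input, which keeps nested bounds polynomial in one quantity. -/
def Ctx.ext (c : Ctx I) (R : I → β → α → Prop) : Ctx (ExtIdx I α β R) where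
  s j := c.s j.i
  inp j := BinData.cons (c.inp j.i) (BinData.cons (enc j.b) (enc j.a))

/-- The family of inputs `c`, extended by a value `a`. -/
structure VarIdx (I α : Type) (R : I → α → Prop) where
  i : I
  a : α
  h : R i a

def Ctx.var (c : Ctx I) (R : I → α → Prop) : Ctx (VarIdx I α R) where
  s j := c.s j.i
  inp j := BinData.cons (c.inp j.i) (enc j.a)

theorem PB.ext {c : Ctx I} {h : I → ℕ} (hh : PB c h) {R : I → β → α → Prop} :
    PB (c.ext R) (fun j => h j.i) := hh.imp fun _ he j => he j.i

theorem PB.var {c : Ctx I} {h : I → ℕ} (hh : PB c h) {R : I → α → Prop} :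
    PB (c.var R) (fun j => h j.i) := hh.imp fun _ he j => he j.i

namespace Cp

variable {c : Ctx I} {W : I → ℕ}

theorem congr {f : I → α} {g : I → β} (hf : Cp c W f) (h : ∀ i, enc (f i) = enc (g i)) :
    Cp c W g := by
  obtain ⟨P, e, hP⟩ := hf
  exact ⟨P, e, fun i => by rw [← h]; exact hP i⟩

theorem of_eq {f g : I → α} (hf : Cp c W f) (h : ∀ i, f i = g i) : Cp c W g :=
  hf.congr fun i => by rw [h]

theorem mono {W' : I → ℕ} {f : I → α} (hf : Cp c W f) (h : ∀ i, W i ≤ W' i) : Cp c W' f := by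
  obtain ⟨P, e, hP⟩ := hf
  refine ⟨P, e, fun i => ?_⟩
  obtain ⟨t, ht, hr⟩ := hP i
  exact ⟨t, ht.trans (Nat.mul_le_mul_right _ (by have := h i; omega)), hr⟩

theorem up {f : I → α} (hf : Cp c (fun _ => 0) f) : Cp c W f := hf.mono fun _ => Nat.zero_le _

/-- Since the base is at least 2, two additional exponents absorb a factor 4, which pays for both
summands and the constant overhead. The factor W + 1 enters only once, so combining programs never
raises its power. -/
theorem bound {W b p : ℕ} {e₁ e₂ t₁ t₂ : ℕ} (hb : 2 ≤ b) (h₁ : t₁ ≤ (W + 1) * b ^ e₁)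
    (h₂ : t₂ ≤ (W + 1) * b ^ e₂) (hp : p ≤ 2) : t₁ + t₂ + p ≤ (W + 1) * b ^ (e₁ + e₂ + 2) := by
  have g₁ : b ^ e₁ ≤ b ^ (e₁ + e₂) := Nat.pow_le_pow_right (by omega) (by omega)
  have g₂ : b ^ e₂ ≤ b ^ (e₁ + e₂) := Nat.pow_le_pow_right (by omega) (by omega)
  have g₃ : 1 ≤ b ^ (e₁ + e₂) := Nat.one_le_pow _ _ (by omega)
  have g₄ : 4 ≤ b ^ 2 := by nlinarith
  calc t₁ + t₂ + p ≤ (W + 1) * b ^ (e₁ + e₂) + (W + 1) * b ^ (e₁ + e₂) + 2 * ((W + 1) * b ^ (e₁ + e₂)) := by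
        have := Nat.mul_le_mul_left (W + 1) g₁
        have := Nat.mul_le_mul_left (W + 1) g₂
        have : 1 ≤ (W + 1) * b ^ (e₁ + e₂) := Nat.mul_pos (by omega) g₃
        omega
    _ = (W + 1) * b ^ (e₁ + e₂) * 4 := by ring
    _ ≤ (W + 1) * b ^ (e₁ + e₂) * b ^ 2 := Nat.mul_le_mul_left _ g₄
    _ = _ := by ring

theorem one_le {W b e : ℕ} (hb : 2 ≤ b) : 1 ≤ (W + 1) * b ^ e :=
  Nat.mul_pos (by omega) (Nat.one_le_pow _ _ (by omega))

theorem inp : Cp c W (fun i => c.inp i) := ⟨Prog.id, 0, fun i => ⟨1, by simp, .id _⟩⟩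

theorem nilData : Cp c W (fun _ => BinData.nil) := ⟨Prog.nil, 0, fun i => ⟨1, by simp, .nil _⟩⟩

/-- Computing from a computed value. -/
theorem reindex {c' : Ctx J} {W' : J → ℕ} {f : I → α} (φ : J → I) (hf : Cp c W f)
    (hin : Cp c' W' (fun j => c.inp (φ j))) (hs : ∀ j, c.s (φ j) ≤ c'.s j)
    (hW : ∀ j, W (φ j) ≤ W' j) : Cp c' W' (fun j => f (φ j)) := by
  obtain ⟨P, e, hP⟩ := hf
  obtain ⟨Q, e', hQ⟩ := hin
  refine ⟨.seq Q P, e' + e + 2, fun j => ?_⟩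
  obtain ⟨t, ht, hr⟩ := hP (φ j)
  obtain ⟨u, hu, hq⟩ := hQ j
  refine ⟨u + t + 1, bound (by omega) hu (ht.trans ?_) (by omega), .seq hq hr⟩
  exact Nat.mul_le_mul (by have := hW j; omega) (Nat.pow_le_pow_left (by have := hs j; omega) _)

theorem fstData {f : I → BinData} (hf : Cp c W f) : Cp c W (fun i => (f i).fst) := by
  obtain ⟨P, e, hP⟩ := hf
  refine ⟨.seq P .fst, e + 0 + 2, fun i => ?_⟩
  obtain ⟨t, ht, hr⟩ := hP i
  exact ⟨t + 1 + 1, bound (p := 1) (by omega) ht (one_le (e := 0) (by omega)) (by omega), .seq hr (.fst _)⟩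

theorem sndData {f : I → BinData} (hf : Cp c W f) : Cp c W (fun i => (f i).snd) := by
  obtain ⟨P, e, hP⟩ := hf
  refine ⟨.seq P .snd, e + 0 + 2, fun i => ?_⟩
  obtain ⟨t, ht, hr⟩ := hP i
  exact ⟨t + 1 + 1, bound (p := 1) (by omega) ht (one_le (e := 0) (by omega)) (by omega), .seq hr (.snd _)⟩

theorem data {f : I → α} (hf : Cp c W f) : Cp c W (fun i => enc (f i)) := hf

theorem pair {f : I → α} {g : I → β} (hf : Cp c W f) (hg : Cp c W g) :
    Cp c W (fun i => (f i, g i)) := by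
  obtain ⟨P, e, hP⟩ := hf
  obtain ⟨Q, e', hQ⟩ := hg
  refine ⟨.pair P Q, e + e' + 2, fun i => ?_⟩
  obtain ⟨t, ht, hr⟩ := hP i
  obtain ⟨u, hu, hq⟩ := hQ i
  exact ⟨t + u + 1, bound (by omega) ht hu (by omega), .pair hr hq⟩

theorem consData {f g : I → BinData} (hf : Cp c W f) (hg : Cp c W g) :
    Cp c W (fun i => BinData.cons (f i) (g i)) := (hf.pair hg).congr fun _ => rfl

theorem fst {f : I → α × β} (hf : Cp c W f) : Cp c W (fun i => (f i).1) :=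
  hf.data.fstData.congr fun _ => rfl

theorem snd {f : I → α × β} (hf : Cp c W f) : Cp c W (fun i => (f i).2) :=
  hf.data.sndData.congr fun _ => rfl

theorem nil : Cp c W (fun _ => ([] : List α)) := nilData.congr fun _ => rfl

theorem cons {f : I → α} {g : I → List α} (hf : Cp c W f) (hg : Cp c W g) :
    Cp c W (fun i => f i :: g i) := (hf.pair hg).congr fun _ => rfl

theorem tail {f : I → List α} (hf : Cp c W f) : Cp c W (fun i => (f i).tail) :=
  hf.data.sndData.congr fun i => by cases f i <;> rfl

theorem bfalse : Cp c W (fun _ => false) := nilData.congr fun _ => rfl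

theorem btrue : Cp c W (fun _ => true) := (nilData.consData nilData).congr fun _ => rfl

theorem zero : Cp c W (fun _ => 0) := nilData.congr fun _ => rfl

theorem succ {f : I → ℕ} (hf : Cp c W f) : Cp c W (fun i => f i + 1) :=
  (nilData.consData hf.data).congr fun _ => rfl

theorem natConst (n : ℕ) : Cp c W (fun _ => n) := by
  induction n with
  | zero => exact zero
  | succ n ih => exact ih.succ

theorem pred {f : I → ℕ} (hf : Cp c W f) : Cp c W (fun i => f i - 1) :=
  hf.data.sndData.congr fun i => by cases f i <;> rfl

theorem ite {p : I → Prop} [∀ i, Decidable (p i)] {f g : I → α}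
    (hp : Cp c W (fun i => decide (p i))) (hf : Cp c W f) (hg : Cp c W g) :
    Cp c W (fun i => if p i then f i else g i) := by
  obtain ⟨P, e, hP⟩ := hf
  obtain ⟨Q, e', hQ⟩ := hg
  obtain ⟨R, d, hR⟩ := hp
  refine ⟨.cond R P Q, d + (e + e' + 2) + 2, fun i => ?_⟩
  obtain ⟨t, ht, hr⟩ := hP i
  obtain ⟨u, hu, hq⟩ := hQ i
  obtain ⟨v, hv, hs⟩ := hR i
  have key := bound (p := 0) (by omega) ht hu (by omega)
  by_cases h : p i
  · simp only [if_pos h]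
    simp only [decide_eq_true h] at hs
    exact ⟨v + t + 1, bound (by omega) hv (by omega) (by omega), .cond_true hs hr⟩
  · simp only [if_neg h]
    simp only [decide_eq_false h] at hs
    exact ⟨v + u + 1, bound (by omega) hv (by omega) (by omega), .cond_false hs hq⟩

theorem bite {b : I → Bool} {f g : I → α}
    (hb : Cp c W b) (hf : Cp c W f) (hg : Cp c W g) :
    Cp c W (fun i => if b i then f i else g i) :=
  ite (p := fun i => b i = true) (hb.congr fun i => by simp) hf hg

theorem band {a b : I → Bool} (ha : Cp c W a) (hb : Cp c W b) : Cp c W (fun i => a i && b i) :=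
  (bite ha hb bfalse).of_eq fun i => by cases a i <;> rfl

theorem bor {a b : I → Bool} (ha : Cp c W a) (hb : Cp c W b) : Cp c W (fun i => a i || b i) :=
  (bite ha btrue hb).of_eq fun i => by cases a i <;> rfl

theorem bnot {a : I → Bool} (ha : Cp c W a) : Cp c W (fun i => !a i) :=
  (bite ha bfalse btrue).of_eq fun i => by cases a i <;> rfl

theorem bxor {a b : I → Bool} (ha : Cp c W a) (hb : Cp c W b) :
    Cp c W (fun i => Bool.xor (a i) (b i)) :=
  (bite ha hb.bnot hb).of_eq fun i => by cases a i <;> cases b i <;> rfl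

/-- Is the tree a pair? -/
def _root_.BinData.isCons : BinData → Bool
  | .nil => false
  | .cons _ _ => true

theorem isCons {f : I → BinData} (hf : Cp c W f) : Cp c W (fun i => (f i).isCons) := by
  obtain ⟨P, e, hP⟩ := hf
  refine ⟨.cond P (.pair .nil .nil) .nil, e + (0 + 0 + 2) + 2, fun i => ?_⟩
  obtain ⟨t, ht, hr⟩ := hP i
  have h3 : 1 + 1 + 1 ≤ (W i + 1) * (c.s i + 2) ^ (0 + 0 + 2) :=
    bound (p := 1) (t₁ := 1) (t₂ := 1) (W := W i) (e₁ := 0) (e₂ := 0) (by omega) (one_le (by omega)) (one_le (by omega)) (by omega)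
  have key := bound (p := 1) (by omega) ht h3 (by omega)
  cases h : f i with
  | nil =>
    rw [h] at hr
    refine ⟨t + 1 + 1, le_trans (by show t + 1 + 1 ≤ t + (1 + 1 + 1) + 1; omega) key, ?_⟩
    simp only [h]
    exact .cond_false hr (.nil _)
  | cons a b =>
    rw [h] at hr
    refine ⟨t + (1 + 1 + 1) + 1, key, ?_⟩
    simp only [h]
    exact .cond_true hr (.pair (.nil _) (.nil _))

theorem head {f : I → List α} {d : I → α} (hf : Cp c W f) (hd : Cp c W d) :
    Cp c W (fun i => (f i).headD (d i)) :=
  (bite hf.data.isCons hf.data.fstData hd.data).congr fun i => by cases f i <;> rfl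

theorem isZero {f : I → ℕ} (hf : Cp c W f) : Cp c W (fun i => decide (f i = 0)) :=
  hf.data.isCons.bnot.congr fun i => by cases f i <;> rfl

theorem ext {f : I → γ} (hf : Cp c W f) {R : I → β → α → Prop} :
    Cp (c.ext R) (fun j => W j.i) (fun j => f j.i) :=
  hf.reindex (fun j : ExtIdx I α β R => j.i) (inp.fstData.congr fun _ => rfl) (fun _ => le_rfl)
    (fun _ => le_rfl)

theorem var {f : I → γ} (hf : Cp c W f) {R : I → α → Prop} :
    Cp (c.var R) (fun j => W j.i) (fun j => f j.i) :=
  hf.reindex (fun j : VarIdx I α R => j.i) (inp.fstData.congr fun _ => rfl) (fun _ => le_rfl)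
    (fun _ => le_rfl)

theorem ext_b {R : I → β → α → Prop} {W : ExtIdx I α β R → ℕ} : Cp (c.ext R) W (fun j => j.b) :=
  inp.sndData.fstData.congr fun _ => rfl

theorem ext_a {R : I → β → α → Prop} {W : ExtIdx I α β R → ℕ} : Cp (c.ext R) W (fun j => j.a) :=
  inp.sndData.sndData.congr fun _ => rfl

theorem var_a {R : I → α → Prop} {W : VarIdx I α R → ℕ} : Cp (c.var R) W (fun j => j.a) :=
  inp.sndData.congr fun _ => rfl

/-- Running time of a loop along a list. -/
theorem run_loop {x : BinData} {P : Prog} {f : β → α → β} {Inv : List α → β → Prop} {K : ℕ}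
    (hInv : ∀ a l b, Inv (a :: l) b → Inv l (f b a))
    (hP : ∀ a l b, Inv (a :: l) b → ∃ t ≤ K,
      Prog.Run P (.cons x (.cons (enc b) (enc a))) (enc (f b a)) t) (l : List α) :
    ∀ b : β, Inv l b → ∃ t ≤ l.length * (K + 25) + 4, Prog.Run
      (.loop (.seq .snd .snd) (.pair .fst (.pair
        (.seq (.pair .fst (.pair (.seq .snd .fst) (.seq (.seq .snd .snd) .fst))) P)
        (.seq (.seq .snd .snd) .snd))))
      (.cons x (.cons (enc b) (enc l))) (.cons x (.cons (enc (l.foldl f b)) (enc ([] : List α)))) t := by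
  induction l with
  | nil =>
    intro b _
    exact ⟨1 + 1 + 1 + 1, by simp, Prog.Run.loop_stop (.seq (.snd _) (.snd _))⟩
  | cons a l ih =>
    intro b hb
    obtain ⟨t, ht, hr⟩ := hP a l b hb
    obtain ⟨u, hu, hq⟩ := ih (f b a) (hInv a l b hb)
    have h₂ : Prog.Run (.seq .snd .snd) (.cons x (.cons (enc b) (enc (a :: l)))) (enc (a :: l))
        (1 + 1 + 1) :=
      .seq (.snd (.cons x (.cons (enc b) (enc (a :: l))))) (.snd (.cons (enc b) (enc (a :: l))))
    have h₃ := Prog.Run.seq h₂ (.snd (enc (a :: l)))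
    have h₄ := Prog.Run.seq h₂ (.fst (enc (a :: l)))
    have h₅ := Prog.Run.seq (.snd (.cons x (.cons (enc b) (enc (a :: l)))))
      (.fst (.cons (enc b) (enc (a :: l))))
    have h₆ := Prog.Run.fst (.cons x (.cons (enc b) (enc (a :: l))))
    have h₇ := Prog.Run.loop_step (B := .seq .snd .snd) (a := enc a) (b := enc l) h₂
      (.pair h₆ (.pair (.seq (.pair h₆ (.pair h₅ h₄)) hr) h₃)) hq
    refine ⟨_, ?_, h₇⟩
    -- Besides the body, one iteration spends 24 steps on the loop test and on moving data.
    simp only [List.length_cons, Nat.add_mul]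
    omega

/-- Loops along a list; the invariant may depend on the remaining list. -/
theorem foldlR {l : I → List α} {b₀ : I → β} {f : I → β → α → β} (Inv : I → List α → β → Prop)
    (W' : I → ℕ) (hl : Cp c W l) (hb : Cp c W b₀)
    (hlen : ∃ e, ∀ i, (W' i + 1) * (l i).length ≤ (W i + 1) * (c.s i + 2) ^ e)
    (h0 : ∀ i, Inv i (l i) (b₀ i)) (hInv : ∀ i a l b, Inv i (a :: l) b → Inv i l (f i b a))
    (hbody : Cp (c.ext fun i b a => ∃ l, Inv i (a :: l) b) (fun j => W' j.i)
      (fun j => f j.i j.b j.a)) :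
    Cp c W (fun i => (l i).foldl (f i) (b₀ i)) := by
  obtain ⟨P, e₁, hP⟩ := inp.consData (hb.data.consData hl.data)
  obtain ⟨Q, e₂, hQ⟩ := hbody
  obtain ⟨e₃, hlen⟩ := hlen
  refine ⟨.seq P (.seq (.loop (.seq .snd .snd) (.pair .fst (.pair
        (.seq (.pair .fst (.pair (.seq .snd .fst) (.seq (.seq .snd .snd) .fst))) Q)
        (.seq (.seq .snd .snd) .snd)))) (.seq .snd .fst)), e₁ + (e₂ + e₃ + 8) + 2, fun i => ?_⟩
  obtain ⟨t, ht, hr⟩ := hP i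
  obtain ⟨u, hu, hq⟩ := run_loop (x := c.inp i) (P := Q) (f := f i) (Inv := Inv i)
    (K := (W' i + 1) * (c.s i + 2) ^ e₂) (hInv i)
    (fun a l b hb => hQ ⟨i, b, a, l, hb⟩) (l i) (b₀ i) (h0 i)
  refine ⟨t + (u + (1 + 1 + 1) + 1) + 1, ?_, .seq hr (.seq hq (.seq (.snd _) (.fst _)))⟩
  refine bound (by omega) ht ?_ (by omega)
  have hb2 : 2 ≤ c.s i + 2 := by omega
  replace hlen := hlen i
  generalize c.s i + 2 = b at *
  have h1 : 1 ≤ b ^ e₂ := Nat.one_le_pow _ _ (by omega)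
  have h2 : (l i).length * ((W' i + 1) * b ^ e₂ + 25) ≤ 26 * ((W i + 1) * b ^ (e₂ + e₃)) := by
    calc (l i).length * ((W' i + 1) * b ^ e₂ + 25)
        ≤ (l i).length * ((W' i + 1) * b ^ e₂ + 25 * ((W' i + 1) * b ^ e₂)) := by
          have : 1 ≤ (W' i + 1) * b ^ e₂ := Nat.mul_pos (by omega) h1
          gcongr; omega
      _ = 26 * (((W' i + 1) * (l i).length) * b ^ e₂) := by ring
      _ ≤ 26 * (((W i + 1) * b ^ e₃) * b ^ e₂) :=
          Nat.mul_le_mul_left _ (Nat.mul_le_mul_right _ hlen)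
      _ = _ := by ring
  have h3 : 1 ≤ (W i + 1) * b ^ (e₂ + e₃) := one_le hb2
  have h4 : 2 ^ 8 ≤ b ^ 8 := Nat.pow_le_pow_left hb2 8
  calc u + (1 + 1 + 1) + 1 ≤ 34 * ((W i + 1) * b ^ (e₂ + e₃)) := by omega
    _ ≤ b ^ 8 * ((W i + 1) * b ^ (e₂ + e₃)) := by gcongr; omega
    _ = _ := by ring

/-- Only the product of the list length and the cost factor `W'` of the body must fit into the
budget. The two extremes are used below: short lists with expensive bodies (`foldl`) and
table-length lists with polynomial bodies (`foldlL`). -/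
theorem foldlW {l : I → List α} {b₀ : I → β} {f : I → β → α → β} (Inv : I → β → Prop)
    (W' : I → ℕ) (hl : Cp c W l) (hb : Cp c W b₀)
    (hlen : ∃ e, ∀ i, (W' i + 1) * (l i).length ≤ (W i + 1) * (c.s i + 2) ^ e)
    (h0 : ∀ i, Inv i (b₀ i)) (hInv : ∀ i b, ∀ a ∈ l i, Inv i b → Inv i (f i b a))
    (hbody : Cp (c.ext fun i b a => a ∈ l i ∧ Inv i b) (fun j => W' j.i) (fun j => f j.i j.b j.a)) :
    Cp c W (fun i => (l i).foldl (f i) (b₀ i)) := by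
  refine foldlR (fun i l' b => l' ⊆ l i ∧ Inv i b) W' hl hb hlen (fun i => ⟨fun _ h => h, h0 i⟩)
    (fun i a l' b h => ⟨fun x hx => h.1 (List.mem_cons_of_mem _ hx),
      hInv i b a (h.1 List.mem_cons_self) h.2⟩) ?_
  have h : ∀ j : ExtIdx I α β fun i b a => ∃ l', (a :: l') ⊆ l i ∧ Inv i b, j.a ∈ l j.i ∧ Inv j.i j.b := by
    rintro ⟨i, b, a, l', h, h'⟩
    exact ⟨h List.mem_cons_self, h'⟩
  exact hbody.reindex (c' := c.ext _) (W' := fun j => W' j.i)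
    (fun j : ExtIdx I α β fun i b a => ∃ l', (a :: l') ⊆ l i ∧ Inv i b => ⟨j.i, j.b, j.a, h j⟩) inp
    (fun _ => le_rfl) (fun _ => le_rfl)

theorem foldl {l : I → List α} {b₀ : I → β} {f : I → β → α → β} (Inv : I → β → Prop)
    (hl : Cp c W l) (hb : Cp c W b₀) (hlen : PB c fun i => (l i).length)
    (h0 : ∀ i, Inv i (b₀ i)) (hInv : ∀ i b, ∀ a ∈ l i, Inv i b → Inv i (f i b a))
    (hbody : Cp (c.ext fun i b a => a ∈ l i ∧ Inv i b) (fun j => W j.i) (fun j => f j.i j.b j.a)) :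
    Cp c W (fun i => (l i).foldl (f i) (b₀ i)) := by
  refine foldlW Inv W hl hb ?_ h0 hInv hbody
  obtain ⟨e, he⟩ := hlen
  exact ⟨e, fun i => Nat.mul_le_mul_left _ (he i)⟩

end Cp

/-! ## Lists and unary numbers -/

/-- `h` is bounded by `W` times a polynomial. -/
def PW (c : Ctx I) (W : I → ℕ) (h : I → ℕ) : Prop := ∃ e, ∀ i, h i ≤ (W i + 1) * (c.s i + 2) ^ e

theorem PB.pw {c : Ctx I} {W h : I → ℕ} (hh : PB c h) : PW c W h :=
  hh.imp fun _ he i => (he i).trans (Nat.le_mul_of_pos_left _ (by omega))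

theorem PW.mono {c : Ctx I} {W g h : I → ℕ} (hg : PW c W g) (hh : ∀ i, h i ≤ g i) : PW c W h :=
  hg.imp fun _ he i => (hh i).trans (he i)

theorem PW.mul {c : Ctx I} {W g h : I → ℕ} (hg : PW c W g) (hh : PB c h) :
    PW c W (fun i => g i * h i) := by
  obtain ⟨a, ha⟩ := hg
  obtain ⟨b, hb⟩ := hh
  exact ⟨a + b, fun i => by
    rw [pow_add, ← mul_assoc]
    exact Nat.mul_le_mul (ha i) (hb i)⟩

namespace Cp

variable {c : Ctx I} {W : I → ℕ}

theorem toExt {R : I → α → Prop} {R' : I → β → α → Prop} {W' : I → ℕ} {f : VarIdx I α R → γ}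
    (hf : Cp (c.var R) (fun j => W' j.i) f) (h : ∀ i b a, R' i b a → R i a) :
    Cp (c.ext R') (fun j => W' j.i) (fun j => f ⟨j.i, j.a, h _ _ _ j.h⟩) :=
  hf.reindex (c' := c.ext R') (W' := fun j => W' j.i)
    (fun j : ExtIdx I α β R' => ⟨j.i, j.a, h _ _ _ j.h⟩)
    (inp.fstData.consData ext_a.data) (fun _ => le_rfl) (fun _ => le_rfl)

/-- Loops along a long list, whose body takes polynomial time. -/
theorem foldlL {l : I → List α} {b₀ : I → β} {f : I → β → α → β} (Inv : I → β → Prop)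
    (hl : Cp c W l) (hb : Cp c W b₀) (hlen : PW c W fun i => (l i).length)
    (h0 : ∀ i, Inv i (b₀ i)) (hInv : ∀ i b, ∀ a ∈ l i, Inv i b → Inv i (f i b a))
    (hbody : Cp (c.ext fun i b a => a ∈ l i ∧ Inv i b) (fun _ => 0) (fun j => f j.i j.b j.a)) :
    Cp c W (fun i => (l i).foldl (f i) (b₀ i)) :=
  foldlW Inv (fun _ => 0) hl hb (hlen.imp fun _ h i => by simpa using h i) h0 hInv hbody

theorem reverse {l : I → List α} (hl : Cp c W l) (hlen : PW c W fun i => (l i).length) :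
    Cp c W (fun i => (l i).reverse) := by
  refine (foldlL (b₀ := fun _ => ([] : List α)) (f := fun _ b a => a :: b) (fun _ _ => True)
    hl nil hlen (fun _ => trivial) (fun _ _ _ _ _ => trivial) (ext_a.cons ext_b)).of_eq fun i => ?_
  simp

theorem mapL {l : I → List α} {g : I → α → β} (hl : Cp c W l) (hlen : PW c W fun i => (l i).length)
    (hg : Cp (c.var fun i a => a ∈ l i) (fun _ => 0) (fun j => g j.i j.a)) :
    Cp c W (fun i => (l i).map (g i)) := by
  refine (reverse (l := fun i => (l i).foldl (fun b a => g i a :: b) []) (foldlL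
    (f := fun i b a => g i a :: b) (fun _ _ => True) hl nil hlen (fun _ => trivial)
    (fun _ _ _ _ _ => trivial)
    ((toExt (W' := fun _ => 0) hg (fun _ _ _ h => h.1)).cons ext_b)) ?_).of_eq fun i => ?_
  · exact hlen.mono fun i => by simp
  · simp

theorem map {l : I → List α} {g : I → α → β} (hl : Cp c W l) (hlen : PB c fun i => (l i).length)
    (hg : Cp (c.var fun i a => a ∈ l i) (fun j => W j.i) (fun j => g j.i j.a)) :
    Cp c W (fun i => (l i).map (g i)) := by
  refine (reverse (l := fun i => (l i).foldl (fun b a => g i a :: b) []) (foldl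
    (f := fun i b a => g i a :: b) (fun _ _ => True) hl nil hlen (fun _ => trivial)
    (fun _ _ _ _ _ => trivial)
    ((toExt hg (fun _ _ _ h => h.1)).cons ext_b)) ?_).of_eq fun i => ?_
  · exact hlen.pw.mono fun i => by simp
  · simp

theorem flatMapL {l : I → List α} {g : I → α → List β} (hl : Cp c W l)
    (hlen : PW c W fun i => (l i).length) (N : I → ℕ) (hN : PB c N)
    (hgN : ∀ i, ∀ a ∈ l i, (g i a).length ≤ N i)
    (hg : Cp (c.var fun i a => a ∈ l i) (fun _ => 0) (fun j => g j.i j.a)) :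
    Cp c W (fun i => (l i).flatMap (g i)) := by
  have key : ∀ (g : α → List β) (l : List α) (acc : List β),
      l.foldl (fun b a => (g a).foldl (fun b x => x :: b) b) acc = (l.flatMap g).reverse ++ acc := by
    intro g l
    induction l with
    | nil => simp
    | cons a l ih => intro acc; rw [List.foldl_cons, ih]; simp
  refine (reverse (l := fun i => (l i).foldl (fun b a => (g i a).foldl (fun b x => x :: b) b) [])
    (foldlL (f := fun i b a => (g i a).foldl (fun b x => x :: b) b) (fun _ _ => True) hl nil hlen
    (fun _ => trivial) (fun _ _ _ _ _ => trivial) ?_) ?_).of_eq fun i => ?_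
  · refine foldl (f := fun _ b x => x :: b) (fun _ _ => True)
      (toExt (W' := fun _ => 0) hg (fun _ _ _ h => h.1)) ext_b ?_
      (fun _ => trivial) (fun _ _ _ _ _ => trivial) (ext_a.cons ext_b)
    exact hN.ext.mono fun j => hgN _ _ j.h.1
  · refine (hlen.mul hN).mono fun i => ?_
    simp only [key, List.append_nil, List.length_reverse, List.length_flatMap]
    calc ((l i).map fun a => (g i a).length).sum ≤ ((l i).map fun a => (g i a).length).length • N i :=
          List.sum_le_card_nsmul _ _ (by simpa using hgN i)
      _ = _ := by simp
  · rw [key, List.append_nil, List.reverse_reverse]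

theorem unary {f : I → ℕ} (hf : Cp c W f) : Cp c W (fun i => List.replicate (f i) BinData.nil) :=
  hf.congr fun i => by simp [enc]

theorem natAdd {f g : I → ℕ} (hf : Cp c W f) (hg : Cp c W g) (h : PB c g) :
    Cp c W (fun i => f i + g i) := by
  refine (foldl (f := fun _ b _ => b + 1) (fun _ _ => True) hg.unary hf (by simpa using h)
    (fun _ => trivial) (fun _ _ _ _ _ => trivial) ext_b.succ).of_eq fun i => ?_
  generalize f i = b
  induction g i generalizing b with
  | zero => rfl
  | succ n ih => simp [List.replicate_succ, ih]; omega

theorem natSub {f g : I → ℕ} (hf : Cp c W f) (hg : Cp c W g) (h : PB c g) :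
    Cp c W (fun i => f i - g i) := by
  refine (foldl (f := fun _ b _ => b - 1) (fun _ _ => True) hg.unary hf (by simpa using h)
    (fun _ => trivial) (fun _ _ _ _ _ => trivial) ext_b.pred).of_eq fun i => ?_
  generalize f i = b
  induction g i generalizing b with
  | zero => rfl
  | succ n ih => simp [List.replicate_succ, ih]; omega

theorem natMul {f g : I → ℕ} (hf : Cp c W f) (hg : Cp c W g) (hf' : PB c f) (hg' : PB c g) :
    Cp c W (fun i => f i * g i) := by
  have key : ∀ (a n b : ℕ), (List.replicate n BinData.nil).foldl (fun b _ => b + a) b = b + a * n := by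
    intro a n
    induction n with
    | zero => simp
    | succ n ih => intro b; simp [List.replicate_succ, ih]; ring
  refine (foldl (f := fun i b _ => b + f i) (fun _ _ => True) hg.unary zero (by simpa using hg')
    (fun _ => trivial) (fun _ _ _ _ _ => trivial) (natAdd ext_b hf.ext hf'.ext)).of_eq fun i => ?_
  simp [key]

theorem natLe {f g : I → ℕ} (hf : Cp c W f) (hg : Cp c W g) (h : PB c g) :
    Cp c W (fun i => decide (f i ≤ g i)) :=
  (natSub hf hg h).isZero.of_eq fun i => by simp [Nat.sub_eq_zero_iff_le]

theorem natEq {f g : I → ℕ} (hf : Cp c W f) (hg : Cp c W g) (hf' : PB c f) (hg' : PB c g) :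
    Cp c W (fun i => decide (f i = g i)) :=
  (band (natLe hf hg hg') (natLe hg hf hf')).of_eq fun i => by
    rw [← Bool.decide_and]; exact decide_eq_decide.2 (by omega)

theorem length {l : I → List α} (hl : Cp c W l) (h : PB c fun i => (l i).length) :
    Cp c W (fun i => (l i).length) := by
  refine (foldl (f := fun _ b _ => b + 1) (fun _ _ => True) hl zero h
    (fun _ => trivial) (fun _ _ _ _ _ => trivial) ext_b.succ).of_eq fun i => ?_
  simp

theorem append {f g : I → List α} (hf : Cp c W f) (hg : Cp c W g) (h : PB c fun i => (f i).length) :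
    Cp c W (fun i => f i ++ g i) := by
  refine (foldl (f := fun _ b a => a :: b) (fun _ _ => True) (hf.reverse h.pw) hg (by simpa using h)
    (fun _ => trivial) (fun _ _ _ _ _ => trivial) (ext_a.cons ext_b)).of_eq fun i => ?_
  simp

theorem range {n : I → ℕ} (hn : Cp c W n) (h : PB c n) : Cp c W (fun i => List.range (n i)) := by
  have key : ∀ n, (List.replicate n BinData.nil).foldl (fun (b : List ℕ × ℕ) _ => (b.2 :: b.1, b.2 + 1)) ([], 0)
      = ((List.range n).reverse, n) := by
    intro n
    induction n with
    | zero => rfl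
    | succ n ih => rw [List.replicate_succ', List.foldl_append, ih]; simp [List.range_succ]
  refine (reverse (l := fun i => ((List.replicate (n i) BinData.nil).foldl
    (fun (b : List ℕ × ℕ) _ => (b.2 :: b.1, b.2 + 1)) ([], 0)).1) (foldl
    (f := fun _ (b : List ℕ × ℕ) _ => (b.2 :: b.1, b.2 + 1)) (fun _ _ => True) hn.unary (nil.pair zero)
    (by simpa using h) (fun _ => trivial) (fun _ _ _ _ _ => trivial)
    ((ext_b.snd.cons ext_b.fst).pair ext_b.snd.succ)).fst ?_).of_eq fun i => ?_
  · exact h.pw.mono fun i => by simp [key]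
  · simp [key]

/-- The family of inputs `c`, extended by a number below `n`. -/
abbrev _root_.Ctx.lt (c : Ctx I) (n : I → ℕ) : Ctx (VarIdx I ℕ fun i a => a < n i) :=
  c.var fun i a => a < n i

theorem ltMem {n : I → ℕ} {W' : I → ℕ} {f : VarIdx I ℕ (fun i a => a < n i) → γ}
    (hf : Cp (c.lt n) (fun j => W' j.i) f) {R : I → ℕ → Prop} (h : ∀ i a, R i a → a ∈ List.range (n i)) :
    Cp (c.var R) (fun j => W' j.i) (fun j => f ⟨j.i, j.a, List.mem_range.1 (h _ _ j.h)⟩) :=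
  hf.reindex (c' := c.var R) (W' := fun j => W' j.i)
    (fun j : VarIdx I ℕ R => ⟨j.i, j.a, List.mem_range.1 (h _ _ j.h)⟩) inp (fun _ => le_rfl)
    (fun _ => le_rfl)

theorem tabulate {n : I → ℕ} {g : I → ℕ → β} (hn : Cp c W n) (h : PB c n)
    (hg : Cp (c.lt n) (fun j => W j.i) (fun j => g j.i j.a)) :
    Cp c W (fun i => (List.range (n i)).map (g i)) :=
  map (range hn h) (by simpa using h) (ltMem hg fun _ _ h => h)

theorem foldRange {n : I → ℕ} {b₀ : I → β} {f : I → β → ℕ → β} (Inv : I → β → Prop)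
    (hn : Cp c W n) (hb : Cp c W b₀) (h : PB c n)
    (h0 : ∀ i, Inv i (b₀ i)) (hInv : ∀ i b, ∀ a < n i, Inv i b → Inv i (f i b a))
    (hbody : Cp (c.ext fun i b a => a < n i ∧ Inv i b) (fun j => W j.i) (fun j => f j.i j.b j.a)) :
    Cp c W (fun i => (List.range (n i)).foldl (f i) (b₀ i)) := by
  refine foldl Inv (range hn h) hb (by simpa using h) h0
    (fun i b a ha => hInv i b a (List.mem_range.1 ha)) ?_
  exact hbody.reindex (c' := c.ext _) (W' := fun j => W j.i)
    (fun j : ExtIdx I ℕ β fun i b a => a ∈ List.range (n i) ∧ Inv i b => ⟨j.i, j.b, j.a, List.mem_range.1 j.h.1, j.h.2⟩) inp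
    (fun _ => le_rfl) (fun _ => le_rfl)

theorem range'_eq_cons {n v a : ℕ} {l : List ℕ} (h : a :: l = List.range' v (n - v)) :
    a = v ∧ v < n ∧ l = List.range' (v + 1) (n - (v + 1)) := by
  obtain ⟨k, hk⟩ : ∃ k, n - v = k + 1 := Nat.exists_eq_succ_of_ne_zero fun h0 => by
    rw [h0] at h; cases h
  rw [hk, List.range'_succ] at h
  injection h with h1 h2
  refine ⟨h1, by omega, ?_⟩
  rw [h2]
  congr 1
  omega

/-- Loops along `range n`, with an invariant that depends on the position. -/
theorem foldRangeI {n : I → ℕ} {b₀ : I → β} {f : I → β → ℕ → β} (Inv : I → ℕ → β → Prop)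
    (hn : Cp c W n) (hb : Cp c W b₀) (h : PB c n)
    (h0 : ∀ i, Inv i 0 (b₀ i)) (hInv : ∀ i b, ∀ a < n i, Inv i a b → Inv i (a + 1) (f i b a))
    (hbody : Cp (c.ext fun i b a => a < n i ∧ Inv i a b) (fun j => W j.i)
      (fun j => f j.i j.b j.a)) :
    Cp c W (fun i => (List.range (n i)).foldl (f i) (b₀ i)) := by
  have key : ∀ i a l b, (∃ v, a :: l = List.range' v (n i - v) ∧ Inv i v b) →
      a < n i ∧ Inv i a b ∧ l = List.range' (a + 1) (n i - (a + 1)) := by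
    rintro i a l b ⟨v, hv, hI⟩
    obtain ⟨rfl, hlt, hl⟩ := range'_eq_cons hv
    exact ⟨hlt, hI, hl⟩
  refine foldlR (fun i l b => ∃ v, l = List.range' v (n i - v) ∧ Inv i v b) W (range hn h) hb ?_
    (fun i => ⟨0, by simp [List.range_eq_range'], h0 i⟩) ?_ ?_
  · obtain ⟨e, he⟩ := h
    exact ⟨e, fun i => by rw [List.length_range]; exact Nat.mul_le_mul_left _ (he i)⟩
  · intro i a l b hl
    obtain ⟨hlt, hI, hl'⟩ := key i a l b hl
    exact ⟨a + 1, hl', hInv i b a hlt hI⟩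
  · exact hbody.reindex (c' := c.ext _) (W' := fun j => W j.i)
      (fun j : ExtIdx I ℕ β fun i b a => ∃ l v, a :: l = List.range' v (n i - v) ∧ Inv i v b =>
        ⟨j.i, j.b, j.a, (key _ _ _ _ j.h.choose_spec).1, (key _ _ _ _ j.h.choose_spec).2.1⟩) inp
      (fun _ => le_rfl) (fun _ => le_rfl)

theorem sumRange {n : I → ℕ} {g : I → ℕ → ℕ} (hn : Cp c W n) (h : PB c n)
    (hg : Cp (c.lt n) (fun j => W j.i) (fun j => g j.i j.a))
    (hg' : PB (c.lt n) (fun j => g j.i j.a)) :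
    Cp c W (fun i => ∑ v ∈ Finset.range (n i), g i v) := by
  have key : ∀ (g : ℕ → ℕ) n, (List.range n).foldl (fun b v => b + g v) 0 = ∑ v ∈ Finset.range n, g v := by
    intro g n
    induction n with
    | zero => rfl
    | succ n ih => rw [List.range_succ, List.foldl_append, ih, Finset.sum_range_succ]; rfl
  refine (foldRange (f := fun i b v => b + g i v) (fun _ _ => True) hn zero h
    (fun _ => trivial) (fun _ _ _ _ _ => trivial) (natAdd ext_b (toExt hg fun _ _ _ h => h.1) ?_)).of_eq
    fun i => key _ _
  obtain ⟨e, he⟩ := hg'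
  exact ⟨e, fun j => he ⟨j.i, j.a, j.h.1⟩⟩

theorem getD {l : I → List α} {k : I → ℕ} {d : I → α} (hl : Cp c W l) (hk : Cp c W k)
    (hd : Cp c W d) (h : PB c k) : Cp c W (fun i => (l i).getD (k i) (d i)) := by
  refine ((foldl (f := fun _ b _ => b.tail) (fun _ _ => True) hk.unary hl (by simpa using h)
    (fun _ => trivial) (fun _ _ _ _ _ => trivial) ext_b.tail).head hd).of_eq fun i => ?_
  generalize l i = b
  induction k i generalizing b with
  | zero => cases b <;> rfl
  | succ n ih => rw [List.replicate_succ, List.foldl_cons, ih]; cases b <;> simp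

theorem replicate {n : I → ℕ} {a : I → α} (hn : Cp c W n) (ha : Cp c W a) (h : PB c n) :
    Cp c W (fun i => List.replicate (n i) (a i)) :=
  (tabulate (g := fun i _ => a i) hn h ha.var).of_eq fun i => by simp

end Cp

/-! ## Binary arithmetic modulo a power of two -/

/-- The bit string represented by a tree. -/
def BinData.bits : BinData → List Bool
  | .nil => []
  | .cons a b => a.isCons :: b.bits

@[simp] theorem BinData.bits_enc (l : List Bool) : (enc l : BinData).bits = l := by
  induction l with
  | nil => rfl
  | cons b l ih =>
    change (enc b : BinData).isCons :: (enc l : BinData).bits = b :: l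
    have : (enc b : BinData).isCons = b := by cases b <;> rfl
    exact congrArg₂ _ this ih

/-- The value of a bit string. -/
def bv : List Bool → ℕ
  | [] => 0
  | b :: l => b.toNat + 2 * bv l

/-- Addition with carry; the result has the length of the first argument. -/
def addc : Bool → List Bool → List Bool → List Bool
  | _, [], _ => []
  | c, a :: x, y => Bool.xor (Bool.xor a (y.headD false)) c ::
      addc (a && y.headD false || (a && c || y.headD false && c)) x y.tail

theorem length_addc (c : Bool) (x y : List Bool) : (addc c x y).length = x.length := by
  induction x generalizing c y with
  | nil => rfl
  | cons a x ih => simp [addc, ih]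

theorem bv_headD_tail (y : List Bool) : bv y = (y.headD false).toNat + 2 * bv y.tail := by
  cases y <;> simp [bv]

theorem modEq_of_eq {n a b : ℕ} (h : a = b) : a ≡ b [MOD n] := h ▸ rfl

theorem bv_addc (c : Bool) (x y : List Bool) :
    bv (addc c x y) ≡ bv x + bv y + c.toNat [MOD 2 ^ x.length] := by
  induction x generalizing c y with
  | nil => simp [Nat.modEq_one]
  | cons a x ih =>
    have h := (ih (a && y.headD false || (a && c || y.headD false && c)) y.tail).mul_left' 2
    rw [addc, List.length_cons, pow_succ', bv_headD_tail y, bv, bv]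
    generalize y.headD false = b at *
    refine (h.add_left (Bool.xor (Bool.xor a b) c).toNat).trans (modEq_of_eq ?_)
    cases a <;> cases b <;> cases c <;> simp <;> ring

/-- Addition modulo `2 ^ x.length`. -/
def badd (x y : List Bool) : List Bool := addc false x y

/-- The bit string of length `w` of zero. -/
def bzeros (w : ℕ) : List Bool := List.replicate w false

/-- Reduction to bit length `w`. -/
def bnorm (w : ℕ) (y : List Bool) : List Bool := badd (bzeros w) y

/-- Multiplication modulo `2 ^ x.length`. -/
def bmul (x y : List Bool) : List Bool :=
  (y.foldl (fun (b : List Bool × List Bool) a => (if a then badd b.1 b.2 else b.1, false :: b.2))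
    (bzeros x.length, x)).1

/-- The `c`-fold sum of `y` modulo `2 ^ w`. -/
def bsmul (w c : ℕ) (y : List Bool) : List Bool := (List.range c).foldl (fun b _ => badd b y) (bzeros w)

/-- Comparison of two bit strings of equal length; `r` is the answer in case of equality. -/
def ltb : Bool → List Bool → List Bool → Bool
  | r, [], _ => r
  | r, a :: x, y => ltb (if a then r && y.headD false else r || y.headD false) x y.tail

@[simp] theorem length_bzeros (w : ℕ) : (bzeros w).length = w := by simp [bzeros]

@[simp] theorem bv_bzeros (w : ℕ) : bv (bzeros w) = 0 := by
  induction w with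
  | zero => rfl
  | succ w ih => simpa [bzeros, List.replicate_succ, bv] using ih

@[simp] theorem length_badd (x y : List Bool) : (badd x y).length = x.length := length_addc _ _ _

theorem bv_badd (x y : List Bool) : bv (badd x y) ≡ bv x + bv y [MOD 2 ^ x.length] :=
  bv_addc false x y

@[simp] theorem length_bnorm (w : ℕ) (y : List Bool) : (bnorm w y).length = w := by simp [bnorm]

theorem bv_bnorm (w : ℕ) (y : List Bool) : bv (bnorm w y) ≡ bv y [MOD 2 ^ w] := by
  have := bv_badd (bzeros w) y
  rwa [length_bzeros, bv_bzeros, zero_add] at this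

/-- Schoolbook multiplication: accumulator plus shifted multiplicand times the unread part of the
multiplier is invariant modulo 2^w. -/
theorem mul_aux (w : ℕ) : ∀ y : List Bool, ∀ b : List Bool × List Bool,
    b.1.length = w →
    let r := y.foldl (fun (b : List Bool × List Bool) a =>
      (if a then badd b.1 b.2 else b.1, false :: b.2)) b
    r.1.length = w ∧ bv r.1 ≡ bv b.1 + bv b.2 * bv y [MOD 2 ^ w] := by
  intro y
  induction y with
  | nil => intro b hb; simpa [bv] using ⟨hb, Nat.ModEq.refl _⟩
  | cons a y ih =>
    intro b hb
    obtain ⟨h1, h2⟩ := ih (if a then badd b.1 b.2 else b.1, false :: b.2) (by cases a <;> simpa using hb)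
    refine ⟨h1, h2.trans ?_⟩
    cases a
    · simp only [bv, Bool.toNat_false, zero_add]
      exact modEq_of_eq (by simp; ring)
    · simp only [bv, Bool.toNat_false, zero_add, if_true, Bool.toNat_true]
      have := (hb ▸ bv_badd b.1 b.2).add_right (2 * bv b.2 * bv y)
      exact this.trans (modEq_of_eq (by ring))

@[simp] theorem length_bmul (x y : List Bool) : (bmul x y).length = x.length :=
  (mul_aux x.length y (bzeros x.length, x) (by simp)).1

theorem bv_bmul (x y : List Bool) : bv (bmul x y) ≡ bv x * bv y [MOD 2 ^ x.length] := by
  have := (mul_aux x.length y (bzeros x.length, x) (by simp)).2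
  rwa [bv_bzeros, zero_add] at this

theorem bsmul_succ (w c : ℕ) (y : List Bool) : bsmul w (c + 1) y = badd (bsmul w c y) y := by
  simp [bsmul, List.range_succ]

@[simp] theorem length_bsmul (w c : ℕ) (y : List Bool) : (bsmul w c y).length = w := by
  induction c with
  | zero => simp [bsmul]
  | succ c ih => simp [bsmul_succ, ih]

theorem bv_bsmul (w c : ℕ) (y : List Bool) : bv (bsmul w c y) ≡ c * bv y [MOD 2 ^ w] := by
  induction c with
  | zero => simp [bsmul]; rfl
  | succ c ih =>
    rw [bsmul_succ]
    have := bv_badd (bsmul w c y) y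
    rw [length_bsmul] at this
    exact this.trans ((ih.add_right _).trans (modEq_of_eq (by ring)))

/-- Bits are read from the least significant one; `r` is the verdict of the bits read so far, and
any later position in which the strings differ overrides it. -/
theorem ltb_iff (r : Bool) (x y : List Bool) (h : x.length = y.length) :
    ltb r x y = true ↔ bv x < bv y + r.toNat := by
  induction x generalizing r y with
  | nil =>
    obtain rfl := List.length_eq_zero_iff.1 h.symm
    cases r <;> simp [ltb, bv]
  | cons a x ih =>
    obtain _ | ⟨b, y⟩ := y
    · simp at h
    · rw [ltb, ih _ _ (by simpa using h)]
      cases a <;> cases b <;> cases r <;> simp [bv] <;> omega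

theorem bv_lt (x : List Bool) : bv x < 2 ^ x.length := by
  induction x with
  | nil => simp [bv]
  | cons a x ih => rw [bv, List.length_cons, pow_succ']; cases a <;> simp <;> omega

theorem bv_replicate_append (e : ℕ) (l : List Bool) : bv (List.replicate e false ++ l) = 2 ^ e * bv l := by
  induction e with
  | zero => simp
  | succ e ih => simp [List.replicate_succ, bv, ih, pow_succ']; ring

theorem bv_bits (n : ℕ) : bv n.bits = n := by
  induction n using Nat.binaryRec' with
  | zero => simp [bv]
  | bit b n h ih => rw [Nat.bits_append_bit _ _ h, bv, ih, Nat.bit_val]; ring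

namespace Cp

variable {c : Ctx I} {W : I → ℕ}

theorem baddD {x : I → List Bool} {y : I → BinData} (hx : Cp c W x) (hy : Cp c W y)
    (h : PB c fun i => (x i).length) : Cp c W (fun i => badd (x i) (y i).bits) := by
  let st : Bool × BinData × List Bool → Bool → Bool × BinData × List Bool := fun b a =>
    (a && b.2.1.fst.isCons || (a && b.1 || b.2.1.fst.isCons && b.1), b.2.1.snd,
      Bool.xor (Bool.xor a b.2.1.fst.isCons) b.1 :: b.2.2)
  have key : ∀ (x : List Bool) (b : Bool × BinData × List Bool),
      (x.foldl st b).2.2 = (addc b.1 x b.2.1.bits).reverse ++ b.2.2 := by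
    intro x
    induction x with
    | nil => intro b; rfl
    | cons a x ih =>
      intro b
      have h1 : b.2.1.fst.isCons = b.2.1.bits.headD false := by cases b.2.1 <;> rfl
      have h2 : b.2.1.snd.bits = b.2.1.bits.tail := by cases b.2.1 <;> rfl
      rw [List.foldl_cons, ih, addc, ← h1, ← h2, List.reverse_cons, List.append_assoc]
      rfl
  refine (reverse (l := fun i => ((x i).foldl st (false, y i, [])).2.2) (foldl (f := fun _ => st)
    (fun _ _ => True) hx (bfalse.pair (hy.pair nil)) h (fun _ => trivial)
    (fun _ _ _ _ _ => trivial) ?_).snd.snd ?_).of_eq fun i => ?_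
  · have hh := (ext_b (c := c) (R := fun i (b : Bool × BinData × List Bool) (a : Bool) => a ∈ x i ∧ True)
      (W := fun j => W j.i)).snd.fst.fstData.isCons
    exact ((ext_a.band hh).bor ((ext_a.band ext_b.fst).bor (hh.band ext_b.fst))).pair
      (ext_b.snd.fst.sndData.pair (((ext_a.bxor hh).bxor ext_b.fst).cons ext_b.snd.snd))
  · exact h.pw.mono fun i => by simp [key, length_addc]
  · simp [key, badd]

theorem badd {x y : I → List Bool} (hx : Cp c W x) (hy : Cp c W y)
    (h : PB c fun i => (x i).length) : Cp c W (fun i => badd (x i) (y i)) :=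
  (baddD hx hy.data h).of_eq fun i => by rw [BinData.bits_enc]

theorem bzeros {w : I → ℕ} (hw : Cp c W w) (h : PB c w) : Cp c W (fun i => bzeros (w i)) :=
  replicate hw bfalse h

theorem bnormD {w : I → ℕ} {y : I → BinData} (hw : Cp c W w) (hy : Cp c W y) (h : PB c w) :
    Cp c W (fun i => bnorm (w i) (y i).bits) := baddD (bzeros hw h) hy (by simpa using h)

theorem bnorm {w : I → ℕ} {y : I → List Bool} (hw : Cp c W w) (hy : Cp c W y) (h : PB c w) :
    Cp c W (fun i => bnorm (w i) (y i)) := badd (bzeros hw h) hy (by simpa using h)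

theorem bmul {x y : I → List Bool} (hx : Cp c W x) (hy : Cp c W y)
    (h : PB c fun i => (x i).length) (h' : PB c fun i => (y i).length) :
    Cp c W (fun i => bmul (x i) (y i)) := by
  refine (foldl (f := fun i (b : List Bool × List Bool) a =>
    (if a then _root_.badd b.1 b.2 else b.1, false :: b.2)) (fun i b => b.1.length = (x i).length) hy
    ((bzeros (hx.length h) h).pair hx) h' (fun i => by simp) (fun i b a _ hb => by cases a <;> simpa using hb)
    ((bite ext_a (badd ext_b.fst ext_b.snd ?_) ext_b.fst).pair (bfalse.cons ext_b.snd))).fst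
  exact h.ext.mono fun j => j.h.2.le

theorem bsmul {w k : I → ℕ} {y : I → List Bool} (hw : Cp c W w) (hk : Cp c W k) (hy : Cp c W y)
    (h : PB c w) (h' : PB c k) : Cp c W (fun i => bsmul (w i) (k i) (y i)) := by
  refine foldRange (f := fun i b _ => _root_.badd b (y i)) (fun i b => b.length = w i) hk (bzeros hw h) h'
    (fun i => by simp) (fun i b a _ hb => by simpa using hb) (badd ext_b hy.ext ?_)
  exact h.ext.mono fun j => j.h.2.le

theorem ltb {x y : I → List Bool} (hx : Cp c W x) (hy : Cp c W y)
    (h : PB c fun i => (x i).length) : Cp c W (fun i => ltb false (x i) (y i)) := by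
  let st : Bool × List Bool → Bool → Bool × List Bool := fun b a =>
    (if a then b.1 && b.2.headD false else b.1 || b.2.headD false, b.2.tail)
  have key : ∀ (x : List Bool) (b : Bool × List Bool), (x.foldl st b).1 = _root_.ltb b.1 x b.2 := by
    intro x
    induction x with
    | nil => intro b; rfl
    | cons a x ih => intro b; simp only [List.foldl_cons, ih]; rfl
  refine (foldl (f := fun _ => st) (fun _ _ => True) hx (bfalse.pair hy) h (fun _ => trivial)
    (fun _ _ _ _ _ => trivial) ?_).fst.of_eq fun i => key _ _
  exact (bite ext_a (ext_b.fst.band (ext_b.snd.head bfalse))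
    (ext_b.fst.bor (ext_b.snd.head bfalse))).pair ext_b.snd.tail

end Cp

/-! ## Search trees -/

/-- The subtree at the end of the path `p`. -/
def lk (d : BinData) (p : List Bool) : BinData := p.foldl (fun d b => if b then d.snd else d.fst) d

/-- Replacing the subtree at the end of the path `p`. -/
def upd : BinData → List Bool → BinData → BinData
  | _, [], v => v
  | d, b :: p, v => if b then .cons d.fst (upd d.snd p v) else .cons (upd d.fst p v) d.snd

theorem lk_upd_self (d : BinData) (p : List Bool) (v : BinData) : lk (upd d p v) p = v := by
  induction p generalizing d with
  | nil => rfl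
  | cons b p ih => cases b <;> exact ih _

theorem lk_upd_of_not_prefix (d : BinData) (p q : List Bool) (v : BinData) (h : ¬ p <+: q)
    (h' : ¬ q <+: p) : lk (upd d p v) q = lk d q := by
  induction p generalizing d q with
  | nil => simp at h
  | cons b p ih =>
    obtain _ | ⟨a, q⟩ := q
    · simp at h'
    · rw [List.cons_prefix_cons] at h h'
      cases b <;> cases a <;> simp [lk, upd, BinData.fst, BinData.snd]
      · exact ih d.fst q (by simpa using h) (by simpa using h')
      · exact ih d.snd q (by simpa using h) (by simpa using h')

namespace Cp

variable {c : Ctx I} {W : I → ℕ}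

theorem lk {d : I → BinData} {p : I → List Bool} (hd : Cp c W d) (hp : Cp c W p)
    (h : PB c fun i => (p i).length) : Cp c W (fun i => lk (d i) (p i)) :=
  foldl (f := fun _ (d : BinData) (b : Bool) => if b then d.snd else d.fst) (fun _ _ => True) hp hd h
    (fun _ => trivial) (fun _ _ _ _ _ => trivial) (bite ext_a ext_b.sndData ext_b.fstData)

theorem upd {d v : I → BinData} {p : I → List Bool} (hd : Cp c W d) (hp : Cp c W p) (hv : Cp c W v)
    (h : PB c fun i => (p i).length) : Cp c W (fun i => upd (d i) (p i) (v i)) := by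
  -- A zipper: the first loop descends along the path and stacks the siblings, the second rebuilds
  -- the tree around the new value.
  let st : BinData × List (Bool × BinData) → Bool → BinData × List (Bool × BinData) := fun b a =>
    (if a then b.1.snd else b.1.fst, (a, if a then b.1.fst else b.1.snd) :: b.2)
  let g : BinData → Bool × BinData → BinData := fun v x => if x.1 then .cons x.2 v else .cons v x.2
  have key : ∀ (p : List Bool) (b : BinData × List (Bool × BinData)) (v : BinData),
      (p.foldl st b).2.foldl g v = b.2.foldl g (_root_.upd b.1 p v) := by
    intro p
    induction p with
    | nil => intro b v; rfl
    | cons a p ih => intro b v; simp only [List.foldl_cons, ih]; cases a <;> rfl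
  have len : ∀ (p : List Bool) (b : BinData × List (Bool × BinData)),
      (p.foldl st b).2.length = p.length + b.2.length := by
    intro p
    induction p with
    | nil => simp
    | cons a p ih => intro b; simp only [List.foldl_cons, ih, List.length_cons, st]; omega
  refine (foldl (l := fun i => ((p i).foldl st (d i, [])).2) (f := fun _ => g) (fun _ _ => True)
    (foldl (f := fun _ => st) (fun _ _ => True) hp (hd.pair nil) h (fun _ => trivial)
    (fun _ _ _ _ _ => trivial) ?_).snd hv (by simpa [len] using h) (fun _ => trivial)
    (fun _ _ _ _ _ => trivial) ?_).of_eq fun i => key _ _ _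
  · exact (bite ext_a ext_b.fst.sndData ext_b.fst.fstData).pair ((ext_a.pair
      (bite ext_a ext_b.fst.fstData ext_b.fst.sndData)).cons ext_b.snd)
  · exact bite ext_a.fst (ext_a.snd.consData ext_b) (ext_b.consData ext_a.snd)

end Cp

/-! ## Flipping red vertices -/

section Flip

variable {n : ℕ}

/-- The number of out-neighbours of `v` in `S`. -/
def gain (adj : Fin n → Fin n → Bool) (S : Finset (Fin n)) (v : Fin n) : ℕ :=
  (S.filter fun u => adj v u = true).card

open Classical in
theorem blueOutDegree_eq (G : Digraph (Fin n)) (f : Fin n → VColor) (v : Fin n) :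
    blueOutDegree G f v = (Finset.univ.filter fun u => G.Adj v u ∧ f u = VColor.blue).card := by
  rw [blueOutDegree, Set.ncard_eq_toFinset_card']
  congr 1
  ext u
  simp

theorem VColor.ne_red_iff (c : VColor) : c ≠ VColor.red ↔ c = VColor.blue := by
  cases c <;> simp

open Classical in
/-- It suffices to recolour red vertices. -/
theorem PDifr.isYes_iff (I : PDifr n) : I.IsYes ↔ ∃ S : Finset (Fin n),
    (∀ u ∈ S, I.color u = VColor.red) ∧ S.card ≤ I.k ∧
    ∀ v, (pDeficiency I.p I.graph I.color v).toNat ≤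
      gain (fun v u => decide (I.graph.Adj v u)) S v := by
  constructor
  · rintro ⟨f', hf, hk⟩
    refine ⟨Finset.univ.filter fun u => I.color u = VColor.red ∧ f' u = VColor.blue,
      fun u hu => (Finset.mem_filter.1 hu).2.1, ?_, ?_⟩
    · refine le_trans ?_ hk
      rw [Set.ncard_eq_toFinset_card']
      refine Finset.card_le_card fun u hu => ?_
      simp only [Finset.mem_filter, Finset.mem_univ, true_and] at hu
      simp [hu.1, hu.2]
    · intro v
      have h := hf v
      simp only [UnderPIllusion, pDeficiency, lt_max_iff, lt_irrefl, false_or, not_lt] at h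
      have hsub : blueOutDegree I.graph f' v ≤ blueOutDegree I.graph I.color v +
          gain (fun v u => decide (I.graph.Adj v u))
            (Finset.univ.filter fun u => I.color u = VColor.red ∧ f' u = VColor.blue) v := by
        rw [blueOutDegree_eq, blueOutDegree_eq, gain]
        refine le_trans (Finset.card_le_card fun u hu => ?_) (Finset.card_union_le _ _)
        simp only [Finset.mem_filter, Finset.mem_univ, true_and, Finset.mem_union,
          decide_eq_true_eq] at hu ⊢
        by_cases hc : I.color u = VColor.red
        · exact Or.inr ⟨⟨hc, hu.2⟩, hu.1⟩
        · exact Or.inl ⟨hu.1, (VColor.ne_red_iff _).1 hc⟩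
      rw [pDeficiency]
      omega
  · rintro ⟨S, hS, hk, hd⟩
    refine ⟨fun u => if u ∈ S then VColor.blue else I.color u, ?_, ?_⟩
    · intro v
      simp only [UnderPIllusion, pDeficiency, lt_max_iff, lt_irrefl, false_or, not_lt]
      have h := hd v
      rw [pDeficiency] at h
      have hsub : blueOutDegree I.graph I.color v + gain (fun v u => decide (I.graph.Adj v u)) S v ≤
          blueOutDegree I.graph (fun u => if u ∈ S then VColor.blue else I.color u) v := by
        rw [blueOutDegree_eq, blueOutDegree_eq, gain, ← Finset.card_union_of_disjoint]
        · refine Finset.card_le_card fun u hu => ?_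
          simp only [Finset.mem_filter, Finset.mem_univ, true_and, Finset.mem_union,
            decide_eq_true_eq] at hu ⊢
          rcases hu with hu | hu
          · exact ⟨hu.1, by simp [hu.2]⟩
          · exact ⟨hu.2, by simp [hu.1]⟩
        · rw [Finset.disjoint_left]
          intro u hu hu'
          simp only [Finset.mem_filter, Finset.mem_univ, true_and] at hu hu'
          have := hS u hu'.1
          rw [hu.2] at this
          cases this
      omega
    · refine le_trans ?_ hk
      rw [Set.ncard_eq_toFinset_card']
      refine Finset.card_le_card fun u hu => ?_
      simp only [Set.mem_toFinset, Set.mem_ofPred_eq] at hu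
      by_contra h
      simp [h] at hu

end Flip

/-! ## Weighted counting -/

section Counting

/-- A weight that is positive exactly if `d ≤ g` and is a sum of `d + 1` exponentials in `g`. -/
def wt (d g : ℕ) : ℕ := ∏ j ∈ Finset.range d, (2 ^ g - 2 ^ j)

theorem wt_eq_zero_iff (d g : ℕ) : wt d g = 0 ↔ g < d := by
  rw [wt, Finset.prod_eq_zero_iff]
  constructor
  · rintro ⟨j, hj, h⟩
    have := (Nat.pow_le_pow_iff_right (a := 2) (by omega)).1 (Nat.sub_eq_zero_iff_le.1 h)
    exact this.trans_lt (Finset.mem_range.1 hj)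
  · intro h
    exact ⟨g, Finset.mem_range.2 h, Nat.sub_self _⟩

theorem wt_le (d g : ℕ) : wt d g ≤ 2 ^ (g * d) := by
  rw [wt, pow_mul]
  refine (Finset.prod_le_pow_card _ _ (2 ^ g) fun j _ => Nat.sub_le _ _).trans (by simp)

/-- Truncated subtraction is harmless: for g < d the factor j = g is zero in both products, and for
g ≥ d no factor is truncated. -/
theorem wt_cast {R : Type*} [CommRing R] (d g : ℕ) :
    ((wt d g : ℕ) : R) = ∏ j ∈ Finset.range d, ((2 : R) ^ g - 2 ^ j) := by
  by_cases h : g < d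
  · rw [(wt_eq_zero_iff d g).2 h, Finset.prod_eq_zero (Finset.mem_range.2 h) (sub_self _), Nat.cast_zero]
  · rw [wt, Nat.cast_prod]
    refine Finset.prod_congr rfl fun j hj => ?_
    rw [Nat.cast_sub (Nat.pow_le_pow_right (by omega) (by have := Finset.mem_range.1 hj; omega))]
    simp

variable {n : ℕ} (adj : Fin n → Fin n → Bool) (red : Fin n → Bool) (d : Fin n → ℕ) (B : ℕ)

/-- The weighted number of feasible sets. -/
def zsum : ℕ := ∑ S ∈ (Finset.univ.filter fun v => red v = true).powerset,
  2 ^ (B * S.card) * ∏ v, wt (d v) (gain adj S v)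

/-- The sum is read in base 2^B: the weights with c = j add up to the digit at position j, and
digits cannot overflow because the total weight is below 2^B. Divisibility says that the digits 0,
…, k are zero, and a zero sum of natural numbers has zero terms. -/
theorem dvd_sum_iff {ι : Type*} (P : Finset ι) (w c : ι → ℕ) (B k : ℕ) (h : ∑ S ∈ P, w S < 2 ^ B) :
    2 ^ (B * (k + 1)) ∣ ∑ S ∈ P, 2 ^ (B * c S) * w S ↔ ∀ S ∈ P, c S ≤ k → w S = 0 := by
  constructor
  · intro hd
    have key : ∀ j ≤ k, ∀ S ∈ P, c S = j → w S = 0 := by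
      intro j
      induction j using Nat.strong_induction_on with
      | _ j ih =>
        intro hj
        have h1 : ∑ S ∈ P, 2 ^ (B * c S) * w S = 2 ^ (B * j) * ∑ S ∈ P.filter (fun S => c S = j), w S +
            ∑ S ∈ P.filter (fun S => ¬ c S = j), 2 ^ (B * c S) * w S := by
          rw [← Finset.sum_filter_add_sum_filter_not P (fun S => c S = j), Finset.mul_sum]
          congr 1
          exact Finset.sum_congr rfl fun S hS => by rw [(Finset.mem_filter.1 hS).2]
        -- Classes below j vanish by induction, classes above j contain the power as a factor.
        have h2 : 2 ^ (B * (j + 1)) ∣ ∑ S ∈ P.filter (fun S => ¬ c S = j), 2 ^ (B * c S) * w S := by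
          refine Finset.dvd_sum fun S hS => ?_
          obtain ⟨hS, hj'⟩ := Finset.mem_filter.1 hS
          rcases Nat.lt_or_gt_of_ne hj' with hlt | hgt
          · simp [ih _ hlt (by omega) S hS rfl]
          · exact Dvd.dvd.mul_right (pow_dvd_pow _ (Nat.mul_le_mul_left _ hgt)) _
        have h3 : 2 ^ (B * (j + 1)) ∣ 2 ^ (B * j) * ∑ S ∈ P.filter (fun S => c S = j), w S := by
          refine (Nat.dvd_add_left h2).1 (h1 ▸ ?_)
          exact (pow_dvd_pow _ (Nat.mul_le_mul_left _ (by omega))).trans hd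
        rw [mul_add, mul_one, pow_add] at h3
        have h4 := Nat.dvd_of_mul_dvd_mul_left (by positivity) h3
        have h5 : ∑ S ∈ P.filter (fun S => c S = j), w S = 0 :=
          Nat.eq_zero_of_dvd_of_lt h4 (lt_of_le_of_lt
            (Finset.sum_le_sum_of_subset (Finset.filter_subset _ _)) h)
        intro S hS hc
        exact Finset.sum_eq_zero_iff.1 h5 S (Finset.mem_filter.2 ⟨hS, hc⟩)
    exact fun S hS hc => key _ hc S hS rfl
  · intro hw
    refine Finset.dvd_sum fun S hS => ?_
    by_cases hc : c S ≤ k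
    · simp [hw S hS hc]
    · exact Dvd.dvd.mul_right (pow_dvd_pow _ (Nat.mul_le_mul_left _ (by omega))) _

theorem gain_le (S : Finset (Fin n)) (v : Fin n) : gain adj S v ≤ n :=
  (Finset.card_filter_le _ _).trans (by simpa using Finset.card_le_univ S)

theorem zsum_dvd_iff (hd : ∀ v, d v ≤ n) (hB : n + n * (n * n) < B) (k : ℕ) :
    2 ^ (B * (k + 1)) ∣ zsum adj red d B ↔
      ¬ ∃ S : Finset (Fin n), (∀ u ∈ S, red u = true) ∧ S.card ≤ k ∧ ∀ v, d v ≤ gain adj S v := by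
  rw [zsum, dvd_sum_iff]
  · push Not
    refine forall_congr' fun S => ?_
    simp only [Finset.mem_powerset, Finset.subset_iff, Finset.mem_filter, Finset.mem_univ, true_and,
      Finset.prod_eq_zero_iff, wt_eq_zero_iff]
  -- At most 2^n sets, each with n factors of size at most 2^(n·n).
  · calc _ ≤ ∑ S ∈ (Finset.univ.filter fun v => red v = true).powerset, 2 ^ (n * (n * n)) := by
          refine Finset.sum_le_sum fun S _ => ?_
          refine (Finset.prod_le_pow_card _ _ (2 ^ (n * n)) fun v _ => ?_).trans ?_
          · exact (wt_le _ _).trans (Nat.pow_le_pow_right (by omega)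
              (Nat.mul_le_mul (gain_le adj S v) (hd v)))
          · rw [← pow_mul]
            exact Nat.pow_le_pow_right (by omega) (by simp [mul_comm])
      _ = 2 ^ (Finset.univ.filter fun v => red v = true).card * 2 ^ (n * (n * n)) := by simp
      _ ≤ 2 ^ n * 2 ^ (n * (n * n)) := by
          gcongr
          · omega
          · exact (Finset.card_le_univ _).trans (by simp)
      _ < 2 ^ B := by
          rw [← pow_add]
          exact Nat.pow_lt_pow_right (by omega) hB

/-- The states of a vertex. -/
def dom (v : Fin n) : Finset (Bool × ℕ) :=
  (if red v then {false, true} else {false}) ×ˢ Finset.range (d v + 1)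

/-- The weight of an assignment of states to the vertices. -/
def asgWeight {R : Type*} [CommRing R] (co : Fin n → ℕ → R) (x : Fin n → Bool × ℕ) : R :=
  (∏ v, co v (x v).2 * (if (x v).1 then 2 ^ B else 1)) *
    ∏ v, ∏ u, if adj v u && (x u).1 then 2 ^ (x v).2 else 1

/-- For fixed flips, the exponents of different vertices are independent: the sum over them is a
product over v of the polynomial with coefficients `co v` evaluated at 2^g, which is the weight of
v. The flip patterns are the subsets of the red vertices. -/
theorem sum_asgWeight {R : Type*} [CommRing R] (co : Fin n → ℕ → R)
    (hco : ∀ v (y : R), ∑ a ∈ Finset.range (d v + 1), co v a * y ^ a =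
      ∏ j ∈ Finset.range (d v), (y - 2 ^ j)) :
    ∑ x ∈ Fintype.piFinset (dom red d), asgWeight adj B co x = (zsum adj red d B : R) := by
  classical
  let fl (v : Fin n) : Finset Bool := if red v then {false, true} else {false}
  have h1 : ∑ x ∈ Fintype.piFinset (dom red d), asgWeight adj B co x =
      ∑ s ∈ Fintype.piFinset fl, ∑ a ∈ Fintype.piFinset fun v => Finset.range (d v + 1),
        asgWeight adj B co fun v => (s v, a v) := by
    rw [← Finset.sum_product']
    refine Finset.sum_bij' (fun x _ => (fun v => (x v).1, fun v => (x v).2))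
      (fun y _ => fun v => (y.1 v, y.2 v)) ?_ ?_ ?_ ?_ ?_
    · intro x hx
      simp only [Fintype.mem_piFinset, dom, Finset.mem_product] at hx ⊢
      exact ⟨fun v => (hx v).1, fun v => (hx v).2⟩
    · intro y hy
      simp only [Fintype.mem_piFinset, dom, Finset.mem_product] at hy ⊢
      exact fun v => ⟨hy.1 v, hy.2 v⟩
    · intro x _; rfl
    · intro y _; rfl
    · intro x _; rfl
  have h2 : ∀ s : Fin n → Bool, ∑ a ∈ Fintype.piFinset fun v => Finset.range (d v + 1),
      asgWeight adj B co (fun v => (s v, a v)) =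
      ((2 ^ (B * (Finset.univ.filter fun v => s v = true).card) *
        ∏ v, wt (d v) (gain adj (Finset.univ.filter fun v => s v = true) v) : ℕ) : R) := by
    intro s
    have h3 : ∀ a : Fin n → ℕ, asgWeight adj B co (fun v => (s v, a v)) =
        (2 : R) ^ (B * (Finset.univ.filter fun v => s v = true).card) *
        ∏ v, co v (a v) * (2 ^ gain adj (Finset.univ.filter fun v => s v = true) v) ^ a v := by
      intro a
      rw [asgWeight, Finset.prod_mul_distrib, Finset.prod_mul_distrib]
      have h4 : (∏ v, if s v = true then (2 : R) ^ B else 1) =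
          2 ^ (B * (Finset.univ.filter fun v => s v = true).card) := by
        rw [← Finset.prod_filter, Finset.prod_const, pow_mul]
      have h5 : ∀ v, (∏ u, if (adj v u && s u) = true then (2 : R) ^ a v else 1) =
          (2 ^ gain adj (Finset.univ.filter fun v => s v = true) v) ^ a v := by
        intro v
        rw [← Finset.prod_filter, Finset.prod_const, gain, ← pow_mul, ← pow_mul, mul_comm,
          Finset.filter_filter]
        congr 3
        ext u
        simp [and_comm]
      simp only [h4, h5]
      ring
    simp only [h3]
    rw [← Finset.mul_sum, ← Finset.prod_univ_sum (fun v => Finset.range (d v + 1)) (fun v a => co v a *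
      ((2 : R) ^ gain adj (Finset.univ.filter fun v => s v = true) v) ^ a)]
    push_cast
    congr 1
    exact Finset.prod_congr rfl fun v _ => by rw [hco, wt_cast]
  rw [h1, zsum, Nat.cast_sum]
  simp only [h2]
  refine Finset.sum_bij' (fun s _ => Finset.univ.filter fun v => s v = true)
    (fun S _ => fun v => decide (v ∈ S)) ?_ ?_ ?_ ?_ ?_
  · intro s hs
    simp only [Fintype.mem_piFinset, fl] at hs
    simp only [Finset.mem_powerset, Finset.subset_iff, Finset.mem_filter, Finset.mem_univ, true_and]
    intro v hv
    have := hs v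
    by_contra hr
    simp [hr, hv] at this
  · intro S hS
    simp only [Finset.mem_powerset, Finset.subset_iff, Finset.mem_filter, Finset.mem_univ,
      true_and] at hS
    simp only [Fintype.mem_piFinset, fl]
    intro v
    by_cases hv : v ∈ S
    · simp [hv, hS hv]
    · by_cases hr : red v = true <;> simp [hv, hr]
  · intro s _; ext v; simp
  · intro S _; ext v; simp
  · intro s _; rfl

end Counting

/-- Divisibility by a power of two only concerns the low bits, so the final test needs no division.
-/
theorem exists_bit_iff (l : List Bool) (N : ℕ) :
    (∃ i < N, l.getD i false = true) ↔ ¬ 2 ^ N ∣ bv l := by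
  induction N generalizing l with
  | zero => simp
  | succ N ih =>
    obtain _ | ⟨b, l⟩ := l
    · simp [bv]
    · have h : (∃ i < N + 1, (b :: l).getD i false = true) ↔
          b = true ∨ ∃ i < N, l.getD i false = true := by
        constructor
        · rintro ⟨_ | i, hi, h⟩
          · exact Or.inl (by simpa using h)
          · exact Or.inr ⟨i, by omega, by simpa using h⟩
        · rintro (h | ⟨i, hi, h⟩)
          · exact ⟨0, by omega, by simpa using h⟩
          · exact ⟨i + 1, by omega, by simpa using h⟩
      rw [h, ih, bv, pow_succ']
      cases b
      · simp [Nat.mul_dvd_mul_iff_left]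
      · simp only [Bool.toNat_true, true_or, true_iff]
        intro hd
        have := (Dvd.intro _ rfl).trans hd
        omega

/-! ## Leaf elimination along a tree -/

section Cut

variable {ι : Type*}

/-- The nodes of `C` cannot be split into two parts without an edge between them. -/
def Cut (T : SimpleGraph ι) (C : Set ι) : Prop :=
  ∀ X ⊆ C, X.Nonempty → (C \ X).Nonempty → ∃ a ∈ X, ∃ b ∈ C \ X, T.Adj a b

theorem SimpleGraph.Connected.cut {T : SimpleGraph ι} {C : Set ι} (h : (T.induce C).Connected) :
    Cut T C := by
  rintro X hX ⟨x, hx⟩ ⟨y, hy⟩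
  by_contra! hno
  have key : ∀ a b : C, (T.induce C).Walk a b → a.1 ∈ X → b.1 ∈ X := by
    intro a b w
    induction w with
    | nil => exact id
    | cons hadj _ ih =>
      intro ha
      refine ih ?_
      by_contra hb
      exact hno _ ha _ ⟨Subtype.coe_prop _, hb⟩ hadj
  obtain ⟨w⟩ := h.preconnected ⟨x, hX hx⟩ ⟨y, hy.1⟩
  exact hy.2 (key _ _ w hx)

/-- Given a split of what remains, put i on a side that contains all its neighbours in C; an edge of
C across the enlarged split then avoids i. Such a side exists because i has at most one neighbour.
-/
theorem Cut.diff_leaf {T : SimpleGraph ι} {C : Set ι} {i : ι} (h : Cut T C)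
    (hi : ∀ j ∈ C, ∀ j' ∈ C, T.Adj i j → T.Adj i j' → j = j') : Cut T (C \ {i}) := by
  by_cases hiC : i ∈ C
  swap
  · rwa [Set.sdiff_singleton_eq_self hiC]
  have main : ∀ X ⊆ C \ {i}, X.Nonempty → ((C \ {i}) \ X).Nonempty →
      (∀ j ∈ (C \ {i}) \ X, ¬ T.Adj i j) → ∃ a ∈ X, ∃ b ∈ (C \ {i}) \ X, T.Adj a b := by
    intro X hX hne hne' hj
    obtain ⟨a, ha, b, hb, hab⟩ := h (insert i X)
      (Set.insert_subset hiC (hX.trans Set.sdiff_subset)) (Set.insert_nonempty _ _)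
      (hne'.mono fun y hy => ⟨hy.1.1, fun h => h.elim hy.1.2 hy.2⟩)
    have hb' : b ∈ (C \ {i}) \ X := ⟨⟨hb.1, fun h => hb.2 (Or.inl h)⟩, fun h => hb.2 (Or.inr h)⟩
    rcases ha with rfl | ha
    · exact absurd hab (hj b hb')
    · exact ⟨a, ha, b, hb', hab⟩
  intro X hX hne hne'
  by_cases hj : ∀ j ∈ (C \ {i}) \ X, ¬ T.Adj i j
  · exact main X hX hne hne' hj
  · push Not at hj
    obtain ⟨j, hj, hij⟩ := hj
    have hX' : (C \ {i}) \ ((C \ {i}) \ X) = X := Set.sdiff_sdiff_cancel_left hX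
    obtain ⟨a, ha, b, hb, hab⟩ := main ((C \ {i}) \ X) Set.sdiff_subset hne' (by rwa [hX']) (by
      rw [hX']
      intro j' hj' hij'
      exact hj.2 (hi j hj.1.1 j' (hX hj').1 hij hij' ▸ hj'))
    exact ⟨b, by rwa [hX'] at hb, a, ha, hab.symm⟩

theorem Cut.exists_adj {T : SimpleGraph ι} {C : Set ι} {i l : ι} (h : Cut T C) (hi : i ∈ C)
    (hl : l ∈ C) (hil : i ≠ l) : ∃ j ∈ C, T.Adj i j := by
  obtain ⟨a, rfl, b, hb, hab⟩ := h {i} (by simpa using hi) (by simp) ⟨l, hl, fun h => hil h.symm⟩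
  exact ⟨b, hb.1, hab⟩

/-- A node of A farthest from some root r works: a neighbour in A is no farther from r, so it
precedes i on the unique path from r to i. -/
theorem SimpleGraph.IsTree.exists_leaf {T : SimpleGraph ι} (hT : T.IsTree) (A : Finset ι)
    (hA : A.Nonempty) : ∃ i ∈ A, ∀ j ∈ A, ∀ j' ∈ A, T.Adj i j → T.Adj i j' → j = j' := by
  classical
  obtain ⟨r, hr⟩ := hA
  obtain ⟨i, hi, hmax⟩ := A.exists_max_image (fun i => T.dist r i) ⟨r, hr⟩
  refine ⟨i, hi, ?_⟩
  obtain ⟨p, hp⟩ := hT.connected.exists_isPath r i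
  have key : ∀ j ∈ A, T.Adj i j → j = p.penultimate := by
    intro j hj hij
    obtain ⟨q, hq, hlen⟩ := hT.connected.exists_path_of_dist r j
    -- Otherwise a proper initial part of a shortest path to j would reach i, making j farther from
    -- r than i.
    have hiq : i ∉ q.support := by
      intro h
      have h1 : T.dist r i ≤ (q.takeUntil i h).length := SimpleGraph.dist_le _
      have h2 : (q.takeUntil i h).length < q.length := q.length_takeUntil_lt_length h hij.ne
      have h3 := hmax j hj
      omega
    have h1 := (hT.isAcyclic.subsingleton_path r i).elim ⟨p, hp⟩
      ⟨q.concat hij.symm, hq.concat hiq hij.symm⟩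
    have h2 : p = q.concat hij.symm := congrArg Subtype.val h1
    rw [h2]
    simp
  intro j hj j' hj' h h'
  rw [key j hj h, key j' hj' h']

end Cut

set_option linter.unusedSectionVars false

/-! ### Partition functions of pairwise models and the messages of leaves -/

section Elimination

variable {V Q R ι : Type*} [Fintype V] [DecidableEq V] [DecidableEq Q] [CommRing R] [DecidableEq ι]
variable (D : V → Finset Q) (q₀ : Q)

/-- The assignments of states to the elements of `s`. -/
def asg (s : Finset V) : Finset (V → Q) := Fintype.piFinset fun v => if v ∈ s then D v else {q₀}

/-- The restriction of an assignment to `s`. -/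
def mask (s : Finset V) (x : V → Q) : V → Q := fun v => if v ∈ s then x v else q₀

variable {D q₀}

theorem mem_asg {s : Finset V} {x : V → Q} :
    x ∈ asg D q₀ s ↔ ∀ v, if v ∈ s then x v ∈ D v else x v = q₀ := by
  simp only [asg, Fintype.mem_piFinset]
  refine forall_congr' fun v => ?_
  by_cases h : v ∈ s <;> simp [h]

theorem mask_mask (s t : Finset V) (x : V → Q) : mask q₀ s (mask q₀ t x) = mask q₀ (s ∩ t) x := by
  funext v
  by_cases h : v ∈ s <;> by_cases h' : v ∈ t <;> simp [mask, h, h']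

theorem mask_mem {s t : Finset V} {x : V → Q} (hx : x ∈ asg D q₀ s) (h : t ⊆ s) :
    mask q₀ t x ∈ asg D q₀ t := by
  rw [mem_asg] at hx ⊢
  intro v
  have := hx v
  by_cases hv : v ∈ t
  · simpa [mask, hv, h hv] using this
  · simp [mask, hv]

/-- An assignment on s ∪ b is a pair of assignments on s and on b that agree on s ∩ b. With `q₀`
outside the domains, agreement says that each one, masked to the other's domain, gives the same
function. -/
theorem sum_asg_union (s b : Finset V) (f g : (V → Q) → R) :
    ∑ x ∈ asg D q₀ (s ∪ b), f (mask q₀ s x) * g (mask q₀ b x) =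
      ∑ y ∈ asg D q₀ s, f y * ∑ z ∈ asg D q₀ b with mask q₀ s z = mask q₀ b y, g z := by
  simp only [Finset.mul_sum]
  rw [← Finset.sum_finset_product' ((asg D q₀ s ×ˢ asg D q₀ b).filter
    fun p => mask q₀ s p.2 = mask q₀ b p.1) _ _ (by
      intro p
      simp only [Finset.mem_filter, Finset.mem_product]
      tauto)]
  refine Finset.sum_bij' (fun x _ => (mask q₀ s x, mask q₀ b x))
    (fun p _ => fun v => if v ∈ s then p.1 v else p.2 v) ?_ ?_ ?_ ?_ ?_
  · intro x hx
    simp only [Finset.mem_filter, Finset.mem_product]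
    exact ⟨⟨mask_mem hx Finset.subset_union_left, mask_mem hx Finset.subset_union_right⟩, by
      rw [mask_mask, mask_mask, Finset.inter_comm]⟩
  · rintro ⟨y, z⟩ hp
    simp only [Finset.mem_filter, Finset.mem_product, mem_asg] at hp ⊢
    intro v
    have h1 := hp.1.1 v
    have h2 := hp.1.2 v
    by_cases hs : v ∈ s <;> by_cases hb : v ∈ b <;> simp_all
  · intro x hx
    funext v
    have := mem_asg.1 hx v
    by_cases hs : v ∈ s <;> by_cases hb : v ∈ b <;> simp_all [mask]
  · rintro ⟨y, z⟩ hp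
    simp only [Finset.mem_filter, Finset.mem_product, mem_asg] at hp
    refine Prod.ext ?_ ?_
    · funext v
      have h1 := hp.1.1 v
      by_cases hs : v ∈ s <;> simp_all [mask]
    · funext v
      have h2 := hp.1.2 v
      have h3 := congrFun hp.2 v
      by_cases hs : v ∈ s <;> by_cases hb : v ∈ b <;> simp_all [mask]
  · intro x _; rfl

variable (φ : V → Q → R) (ψ : V → V → Q → Q → R)

/-- The product of the factors within `L`. -/
def locals (L : Finset V) (x : V → Q) : R :=
  (∏ v, if v ∈ L then φ v (x v) else 1) *
    ∏ v, ∏ u, if v ∈ L ∧ u ∈ L then ψ v u (x v) (x u) else 1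

/-- The product of the factors within `b` that are not within `b'`. -/
def leafWeight (b b' : Finset V) (x : V → Q) : R :=
  (∏ v, if v ∈ b ∧ v ∉ b' then φ v (x v) else 1) *
    ∏ v, ∏ u, if (v ∈ b ∧ u ∈ b) ∧ ¬ (v ∈ b' ∧ u ∈ b') then ψ v u (x v) (x u) else 1

variable {φ ψ}

theorem locals_mask {L s : Finset V} (h : L ⊆ s) (x : V → Q) :
    locals φ ψ L (mask q₀ s x) = locals φ ψ L x := by
  rw [locals, locals]
  congr 1
  · refine Finset.prod_congr rfl fun v _ => ?_
    by_cases hv : v ∈ L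
    · simp [hv, mask, h hv]
    · simp [hv]
  · refine Finset.prod_congr rfl fun v _ => Finset.prod_congr rfl fun u _ => ?_
    by_cases hv : v ∈ L ∧ u ∈ L
    · simp [hv, mask, h hv.1, h hv.2]
    · simp [hv]

theorem leafWeight_mask {b b' s : Finset V} (h : b ⊆ s) (x : V → Q) :
    leafWeight φ ψ b b' (mask q₀ s x) = leafWeight φ ψ b b' x := by
  rw [leafWeight, leafWeight]
  congr 1
  · refine Finset.prod_congr rfl fun v _ => ?_
    by_cases hv : v ∈ b
    · simp [hv, mask, h hv]
    · simp [hv]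
  · refine Finset.prod_congr rfl fun v _ => Finset.prod_congr rfl fun u _ => ?_
    by_cases hv : v ∈ b ∧ u ∈ b
    · simp [hv, mask, h hv.1, h hv.2]
    · simp [hv]

/-- Inside b, membership in s and in b' coincide, so factors within b are split without repetition
between s and the leaf. Pairs with one end only in b and the other only in s carry the factor 1 by
`hψ`. -/
theorem locals_union {s b b' : Finset V} (hb' : b' ⊆ s) (hsb : s ∩ b ⊆ b')
    (hψ : ∀ v ∈ b, v ∉ b' → ∀ u ∈ s, u ∉ b → (∀ p q, ψ v u p q = 1) ∧ ∀ p q, ψ u v p q = 1)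
    (x : V → Q) :
    locals φ ψ (s ∪ b) x = locals φ ψ s x * leafWeight φ ψ b b' x := by
  rw [locals, locals, leafWeight, mul_mul_mul_comm]
  have hs : ∀ v, v ∈ b → (v ∈ s ↔ v ∈ b') := fun v hv =>
    ⟨fun h => hsb (Finset.mem_inter.2 ⟨h, hv⟩), fun h => hb' h⟩
  congr 1
  · rw [← Finset.prod_mul_distrib]
    refine Finset.prod_congr rfl fun v _ => ?_
    by_cases hv : v ∈ b
    · by_cases hv' : v ∈ b' <;> simp [hv, hv', hs v hv]
    · simp [hv]
  · rw [← Finset.prod_mul_distrib]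
    refine Finset.prod_congr rfl fun v _ => ?_
    rw [← Finset.prod_mul_distrib]
    refine Finset.prod_congr rfl fun u _ => ?_
    by_cases hv : v ∈ b <;> by_cases hu : u ∈ b
    · by_cases hv' : v ∈ b' <;> by_cases hu' : u ∈ b' <;> simp [hv, hu, hv', hu', hs v hv, hs u hu]
    · by_cases hv' : v ∈ b'
      · simp [hv, hu]
        simp [hs v hv, hv']
      · by_cases hus : u ∈ s
        · simp [hv, hu, hus, hs v hv, hv', (hψ v hv hv' u hus hu).1]
        · simp [hv, hu, hus]
    · by_cases hu' : u ∈ b'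
      · simp [hv, hu]
        simp [hs u hu, hu']
      · by_cases hvs : v ∈ s
        · simp [hv, hu, hvs, hs u hu, hu', (hψ u hu hu' v hvs hv).2]
        · simp [hv, hu, hvs]
    · simp [hv, hu]

/-- The invariants of leaf elimination: `A` is the set of remaining nodes. -/
structure Remaining (T : SimpleGraph ι) (bag : ι → Finset V) (ψ : V → V → Q → Q → R)
    (A : Finset ι) : Prop where
  cut : Cut T A
  cutBag : ∀ v, Cut T {l | l ∈ A ∧ v ∈ bag l}
  factor : ∀ v ∈ A.biUnion bag, ∀ u ∈ A.biUnion bag, (∃ p q, ψ v u p q ≠ 1) →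
    ∃ l ∈ A, v ∈ bag l ∧ u ∈ bag l

variable {T : SimpleGraph ι} {bag : ι → Finset V} {A : Finset ι} {i : ι}

/-- The remaining nodes whose bags contain v cannot be split, so i has a neighbour among them. For a
leaf this means that whatever it shares with the rest lies in the bag of its only neighbour. -/
theorem Remaining.mem_of_mem (h : Remaining T bag ψ A) (hi : i ∈ A) {v : V}
    (hv : v ∈ bag i) (hv' : v ∈ (A.erase i).biUnion bag) : ∃ j ∈ A, T.Adj i j ∧ v ∈ bag j := by
  obtain ⟨l, hl, hvl⟩ := Finset.mem_biUnion.1 hv'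
  obtain ⟨hli, hlA⟩ := Finset.mem_erase.1 hl
  obtain ⟨j, hj, hij⟩ := (h.cutBag v).exists_adj (i := i) (l := l) ⟨hi, hv⟩ ⟨hlA, hvl⟩ hli.symm
  exact ⟨j, hj.1, hij, hj.2⟩

theorem Remaining.erase (h : Remaining T bag ψ A) (hi : i ∈ A)
    (hleaf : ∀ j ∈ A, ∀ j' ∈ A, T.Adj i j → T.Adj i j' → j = j') :
    Remaining T bag ψ (A.erase i) where
  cut := by
    rw [Finset.coe_erase]
    exact h.cut.diff_leaf hleaf
  cutBag v := by
    have := (h.cutBag v).diff_leaf (i := i) fun j hj j' hj' => hleaf j hj.1 j' hj'.1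
    convert this using 1
    ext l
    simp only [Finset.mem_erase, Set.mem_ofPred_eq, Set.mem_sdiff, Set.mem_singleton_iff]
    tauto
  factor v hv u hu hne := by
    obtain ⟨l, hl, hvl, hul⟩ := h.factor v
      (Finset.biUnion_subset_biUnion_of_subset_left _ (Finset.erase_subset _ _) hv) u
      (Finset.biUnion_subset_biUnion_of_subset_left _ (Finset.erase_subset _ _) hu) hne
    -- If the pair was covered by the bag of the leaf, both vertices also occur elsewhere, hence
    -- both lie in the bag of the unique neighbour.
    by_cases hli : l = i
    · subst hli
      obtain ⟨j, hj, hij, hvj⟩ := h.mem_of_mem hl hvl hv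
      obtain ⟨j', hj', hij', huj⟩ := h.mem_of_mem hl hul hu
      obtain rfl := hleaf j hj j' hj' hij hij'
      exact ⟨j, Finset.mem_erase.2 ⟨hij.ne', hj⟩, hvj, huj⟩
    · exact ⟨l, Finset.mem_erase.2 ⟨hli, hl⟩, hvl, hul⟩

variable (D q₀ φ ψ) in
/-- The partition function of the remaining factors. -/
def partition (bag : ι → Finset V) (A : Finset ι) (F : ι → (V → Q) → R) : R :=
  ∑ x ∈ asg D q₀ (A.biUnion bag), (∏ l ∈ A, F l (mask q₀ (bag l) x)) * locals φ ψ (A.biUnion bag) x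

variable (D q₀ φ ψ) in
/-- The message of a leaf with bag `b` and table `f` to a node with bag `b'`. -/
def message (b b' : Finset V) (f : (V → Q) → R) (y : V → Q) : R :=
  ∑ z ∈ asg D q₀ b with mask q₀ b' z = y, f z * leafWeight φ ψ b b' z

/-- Distributivity: the vertices private to bag i are summed out first. Leaving `b'` general covers
both a leaf, with the bag of its neighbour, and the last node, with the empty set. -/
theorem Remaining.partition_eq (h : Remaining T bag ψ A) (hi : i ∈ A) {b' : Finset V}
    (hb' : b' ⊆ (A.erase i).biUnion bag)
    (hib' : ∀ v ∈ bag i, v ∈ (A.erase i).biUnion bag → v ∈ b') (F : ι → (V → Q) → R) :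
    partition D q₀ φ ψ bag A F = ∑ y ∈ asg D q₀ ((A.erase i).biUnion bag),
      ((∏ l ∈ A.erase i, F l (mask q₀ (bag l) y)) * locals φ ψ ((A.erase i).biUnion bag) y) *
        message D q₀ φ ψ (bag i) b' (F i) (mask q₀ (bag i) y) := by
  set s := (A.erase i).biUnion bag with hs
  have hA : A.biUnion bag = s ∪ bag i := by
    rw [← Finset.insert_erase hi, Finset.biUnion_insert, Finset.union_comm]
  rw [partition, hA]
  have h1 : ∀ x : V → Q, (∏ l ∈ A, F l (mask q₀ (bag l) x)) * locals φ ψ (s ∪ bag i) x =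
      ((∏ l ∈ A.erase i, F l (mask q₀ (bag l) (mask q₀ s x))) * locals φ ψ s (mask q₀ s x)) *
      (F i (mask q₀ (bag i) x) * leafWeight φ ψ (bag i) b' (mask q₀ (bag i) x)) := by
    intro x
    rw [locals_mask subset_rfl, leafWeight_mask subset_rfl, ← Finset.mul_prod_erase A _ hi,
      locals_union hb' (fun v hv => hib' v (Finset.mem_inter.1 hv).2 (Finset.mem_inter.1 hv).1)]
    · have : ∀ l ∈ A.erase i, F l (mask q₀ (bag l) (mask q₀ s x)) = F l (mask q₀ (bag l) x) := by
        intro l hl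
        rw [mask_mask, Finset.inter_eq_left.2 (Finset.subset_biUnion_of_mem bag hl)]
      rw [Finset.prod_congr rfl this]
      ring
    · intro v hv hv' u hu hub
      have hvs : v ∉ s := fun h => hv' (hib' v hv h)
      have hvA : v ∈ A.biUnion bag := Finset.mem_biUnion.2 ⟨i, hi, hv⟩
      have huA : u ∈ A.biUnion bag := by rw [hA]; exact Finset.mem_union_left _ hu
      have key : ∀ l ∈ A, v ∈ bag l → u ∉ bag l := by
        intro l hl hvl
        by_cases hli : l = i
        · rwa [hli]
        · exact absurd (Finset.mem_biUnion.2 ⟨l, Finset.mem_erase.2 ⟨hli, hl⟩, hvl⟩) hvs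
      constructor <;> intro p q <;> by_contra hne
      · obtain ⟨l, hl, hvl, hul⟩ := h.factor v hvA u huA ⟨p, q, hne⟩
        exact key l hl hvl hul
      · obtain ⟨l, hl, hul, hvl⟩ := h.factor u huA v hvA ⟨p, q, hne⟩
        exact key l hl hvl hul
  rw [Finset.sum_congr rfl fun x _ => h1 x, sum_asg_union s (bag i)
    (fun y => (∏ l ∈ A.erase i, F l (mask q₀ (bag l) y)) * locals φ ψ s y)
    (fun z => F i z * leafWeight φ ψ (bag i) b' z)]
  refine Finset.sum_congr rfl fun y _ => ?_
  rw [message]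
  congr 1
  refine Finset.sum_congr (Finset.filter_congr fun z hz => ?_) fun _ _ => rfl
  have : mask q₀ s z = mask q₀ b' z := by
    funext v
    have hv := mem_asg.1 hz v
    by_cases hvs : v ∈ s
    · by_cases hvi : v ∈ bag i
      · simp [mask, hvs, hib' v hvi hvs]
      · rw [if_neg hvi] at hv
        simp [mask, hv]
    · have : v ∉ b' := fun h => hvs (hb' h)
      simp [mask, hvs, this]
  rw [this]

/-- Elimination of a leaf. -/
theorem Remaining.partition_leaf (h : Remaining T bag ψ A) (hi : i ∈ A) {j : ι} (hj : j ∈ A)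
    (hij : T.Adj i j) (hleaf : ∀ j' ∈ A, T.Adj i j' → j' = j) (F F' : ι → (V → Q) → R)
    (hF : ∀ l ∈ A, l ≠ i → l ≠ j → ∀ y ∈ asg D q₀ (bag l), F' l y = F l y)
    (hF' : ∀ y ∈ asg D q₀ (bag j), F' j y = F j y *
      message D q₀ φ ψ (bag i) (bag j) (F i) (mask q₀ (bag i) y)) :
    partition D q₀ φ ψ bag (A.erase i) F' = partition D q₀ φ ψ bag A F := by
  have hjA : j ∈ A.erase i := Finset.mem_erase.2 ⟨hij.ne', hj⟩
  rw [h.partition_eq hi (Finset.subset_biUnion_of_mem bag hjA) (fun v hv hv' => by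
    obtain ⟨j', hj', hij', hvj⟩ := h.mem_of_mem hi hv hv'
    exact hleaf j' hj' hij' ▸ hvj), partition]
  refine Finset.sum_congr rfl fun y hy => ?_
  have hm : ∀ l ∈ A.erase i, mask q₀ (bag l) y ∈ asg D q₀ (bag l) := fun l hl =>
    mask_mem hy (Finset.subset_biUnion_of_mem bag hl)
  rw [← Finset.mul_prod_erase _ _ hjA, ← Finset.mul_prod_erase _ _ hjA, hF' _ (hm j hjA)]
  have h1 : ∀ l ∈ (A.erase i).erase j, F' l (mask q₀ (bag l) y) = F l (mask q₀ (bag l) y) := by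
    intro l hl
    obtain ⟨hlj, hl⟩ := Finset.mem_erase.1 hl
    exact hF l (Finset.mem_erase.1 hl).2 (Finset.mem_erase.1 hl).1 hlj _ (hm l hl)
  rw [Finset.prod_congr rfl h1]
  have h2 : message D q₀ φ ψ (bag i) (bag j) (F i) (mask q₀ (bag i) (mask q₀ (bag j) y)) =
      message D q₀ φ ψ (bag i) (bag j) (F i) (mask q₀ (bag i) y) := by
    rw [mask_mask]
    -- A vertex of bag i outside bag j occurs in no other remaining bag, so y has the default state
    -- there.
    have : mask q₀ (bag i ∩ bag j) y = mask q₀ (bag i) y := by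
      funext v
      by_cases hvi : v ∈ bag i
      · by_cases hvj : v ∈ bag j
        · simp [mask, hvi, hvj]
        · have hvs : v ∉ (A.erase i).biUnion bag := by
            intro hvs
            obtain ⟨j', hj', hij', hvj'⟩ := h.mem_of_mem hi hvi hvs
            exact hvj (hleaf j' hj' hij' ▸ hvj')
          have := mem_asg.1 hy v
          rw [if_neg hvs] at this
          simp [mask, this]
      · simp [mask, hvi]
    rw [this]
  rw [h2]
  ring

/-- Elimination of the last node. -/
theorem Remaining.partition_last (h : Remaining T bag ψ A) (hi : i ∈ A)
    (hleaf : ∀ j ∈ A, ¬ T.Adj i j) (F : ι → (V → Q) → R) :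
    A = {i} ∧ message D q₀ φ ψ (bag i) ∅ (F i) (fun _ => q₀) = partition D q₀ φ ψ bag A F := by
  have hA : A = {i} := by
    refine Finset.eq_singleton_iff_unique_mem.2 ⟨hi, fun l hl => ?_⟩
    by_contra hli
    obtain ⟨j, hj, hij⟩ := h.cut.exists_adj (i := i) (l := l) hi hl (Ne.symm hli)
    exact hleaf j hj hij
  refine ⟨hA, ?_⟩
  have he : A.erase i = ∅ := by simp [hA]
  rw [h.partition_eq hi (b' := ∅) (by simp) (by simp [he])]
  simp only [he, Finset.biUnion_empty, Finset.prod_empty, one_mul]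
  have h1 : asg D q₀ (∅ : Finset V) = {fun _ => q₀} := by
    ext x
    simp [mem_asg, funext_iff]
  have h2 : mask q₀ (bag i) (fun _ => q₀) = fun _ => q₀ := by funext v; simp [mask]
  rw [h1, Finset.sum_singleton, h2]
  simp [locals]

theorem Remaining.of_isTree [Fintype ι] (hT : T.IsTree)
    (hbag : ∀ v, (T.induce {l | v ∈ bag l}).Connected)
    (hψ : ∀ v u, (∃ p q, ψ v u p q ≠ 1) → ∃ l, v ∈ bag l ∧ u ∈ bag l) :
    Remaining T bag ψ Finset.univ where
  cut := by
    refine SimpleGraph.Connected.cut ?_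
    rw [Finset.coe_univ]
    exact (SimpleGraph.induceUnivIso T).connected_iff.2 hT.connected
  cutBag v := by simpa using (hbag v).cut
  factor v _ u _ h := by simpa using hψ v u h

end Elimination

/-! ## The algorithm -/

/-- A state of every vertex. -/
abbrev Key := List (Bool × ℕ)

/-- A weight for each key. -/
abbrev Table := List (Key × List Bool)

/-- The instance after preprocessing: number of vertices and of nodes, bit length of numbers, weight of a flipped
vertex, adjacency matrix, red vertices, deficiencies, coefficients of the weights, decomposition tree, bags. -/
structure Par where
  n : ℕ
  m : ℕ
  M : ℕ
  B : ℕ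
  A : List (List Bool)
  red : List Bool
  d : List ℕ
  cf : List (List (List Bool))
  T : List (List Bool)
  bags : List (List Bool)

/-- Entry of a bit string. -/
def bit (l : List Bool) (v : ℕ) : Bool := l.getD v false

/-- Entry of a bit matrix. -/
def bit₂ (A : List (List Bool)) (v u : ℕ) : Bool := bit (A.getD v []) u

/-- State of a vertex. -/
def Key.at (x : Key) (v : ℕ) : Bool × ℕ := x.getD v (false, 0)

/-- The bit string of length `w` of one. -/
def bone (w : ℕ) : List Bool := bnorm w [true]

/-- The bit string of `2 ^ e`. -/
def pow2 (e : ℕ) : List Bool := List.replicate e false ++ [true]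

/-- The path of a key in a search tree. -/
def Key.path (x : Key) : List Bool := x.flatMap fun q => q.1 :: (List.replicate q.2 true ++ [false])

namespace Par

variable (p : Par)

/-- The exponent of two in the weight of a leaf with bag `b` and neighbouring bag `b'`. -/
def wExp (b b' : List Bool) (x : Key) : ℕ := ∑ v ∈ Finset.range p.n,
  ((if bit b v && !bit b' v && (x.at v).1 then p.B else 0) +
    ∑ u ∈ Finset.range p.n, if bit₂ p.A v u && (x.at u).1 && (bit b v && bit b u) &&
      !(bit b' v && bit b' u) then (x.at v).2 else 0)

/-- The product of the coefficients in the weight of a leaf. -/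
def wCo (b b' : List Bool) (x : Key) : List Bool := (List.range p.n).foldl (fun acc v =>
  if bit b v && !bit b' v then bmul acc ((p.cf.getD v []).getD (x.at v).2 []) else acc) (bone p.M)

/-- The weight of a leaf. -/
def weight (b b' : List Bool) (x : Key) : List Bool := bmul (p.wCo b b' x) (pow2 (p.wExp b b' x))

/-- The restriction of a key. -/
def restrict (b : List Bool) (x : Key) : Key :=
  (List.range p.n).map fun v => if bit b v then x.at v else (false, 0)

/-- The states of a vertex. -/
def digits (v : ℕ) : List (Bool × ℕ) := (List.range (p.d.getD v 0 + 1)).flatMap fun a =>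
  if bit p.red v then [(false, a), (true, a)] else [(false, a)]

/-- The states of a vertex, if it lies in the bag `b`. -/
def choices (b : List Bool) (v : ℕ) : List (Bool × ℕ) := if bit b v then p.digits v else [(false, 0)]

/-- The keys for a bag, for the vertices below `k`. -/
def keysBelow (b : List Bool) (k : ℕ) : List Key := (List.range k).foldl (fun ks v =>
  ks.flatMap fun x => (p.choices b v).map fun q => x ++ [q]) [[]]

/-- The initial table of a bag. -/
def table₀ (b : List Bool) : Table := (p.keysBelow b p.n).map fun x => (x, bone p.M)

/-- The message of a leaf, as a search tree. -/
def msgOf (b b' : List Bool) (tab : Table) : BinData := tab.foldl (fun tr e =>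
  upd tr (p.restrict b' e.1).path
    (enc (badd (bmul e.2 (p.weight b b' e.1)) (lk tr (p.restrict b' e.1).path).bits))) .nil

/-- Multiplication of a table by a message from a leaf with bag `b`. -/
def updTable (b : List Bool) (msg : BinData) (tab : Table) : Table := tab.map fun e =>
  (e.1, bmul e.2 (bnorm p.M (lk msg (p.restrict b e.1).path).bits))

/-- The number of remaining neighbours. -/
def nbrs (alive : List Bool) (i : ℕ) : ℕ :=
  ∑ j ∈ Finset.range p.m, if bit alive j && bit₂ p.T i j then 1 else 0

/-- The last remaining neighbour. -/
def nbr (alive : List Bool) (i : ℕ) : ℕ := (List.range p.m).foldl (fun acc j =>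
  if bit alive j && bit₂ p.T i j then j else acc) p.m

/-- A remaining leaf. -/
def leaf (alive : List Bool) : ℕ := (List.range p.m).foldl (fun acc i =>
  if bit alive i && decide (p.nbrs alive i ≤ 1) then i else acc) p.m

/-- Remaining nodes, tables, last message. -/
abbrev State := List Bool × List Table × BinData

/-- Elimination of the node `i` with neighbour `j`. -/
def elim (st : State) (i j : ℕ) (msg : BinData) : State :=
  ((List.range p.m).map fun l => if l = i then false else bit st.1 l,
    (List.range p.m).map fun l => if l = j then p.updTable (p.bags.getD i []) msg (st.2.1.getD l [])
      else st.2.1.getD l [], msg)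

/-- The message of the next leaf `i` to its neighbour `j`. -/
def nextMsg (st : State) (i j : ℕ) : BinData :=
  p.msgOf (p.bags.getD i []) (p.bags.getD j []) (st.2.1.getD i [])

/-- Elimination of a leaf. -/
def step (st : State) : State :=
  p.elim st (p.leaf st.1) (p.nbr st.1 (p.leaf st.1))
    (p.nextMsg st (p.leaf st.1) (p.nbr st.1 (p.leaf st.1)))

/-- The initial state. -/
def state₀ : State :=
  (List.replicate p.m true, (List.range p.m).map fun i => p.table₀ (p.bags.getD i []), .nil)

/-- The partition function modulo `2 ^ M`. -/
def total : List Bool :=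
  bnorm p.M (lk ((List.range p.m).foldl (fun st _ => p.step st) p.state₀).2.2
    (p.restrict [] []).path).bits

end Par

/-- The input. -/
abbrev Raw := List (List Bool) × List Bool × List Bool × (List Bool × List Bool) ×
  List (List Bool) × List (List Bool)

namespace Raw

variable (r : Raw)

def n : ℕ := r.1.length
-- One number bounds n and all binary lengths. The fourth power `B` exceeds n + n³, the exponent
-- needed to bound the total weight, and `M` leaves room for the digits 0, …, X in base 2^B.
def X : ℕ := r.1.length + r.2.2.1.length + r.2.2.2.1.1.length + r.2.2.2.1.2.length + 1
def B : ℕ := r.X * r.X * (r.X * r.X)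
def M : ℕ := r.B * (r.X + 1)
def deg (v : ℕ) : ℕ := ∑ u ∈ Finset.range r.n, if bit₂ r.1 v u then 1 else 0
def blue (v : ℕ) : ℕ := ∑ u ∈ Finset.range r.n, if bit₂ r.1 v u && !bit r.2.1 u then 1 else 0
/-- The required number of blue out-neighbours. -/
def need (v : ℕ) : ℕ := ∑ k ∈ Finset.range (r.deg v),
  if ltb false (bsmul r.M k r.2.2.2.1.2) (bsmul r.M (r.deg v) r.2.2.2.1.1) then 1 else 0
def defic (v : ℕ) : ℕ := r.need v - r.blue v
/-- The bit string of `-2 ^ j`. -/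
def negPow (w j : ℕ) : List Bool := bmul (List.replicate w true) (pow2 j)
/-- Multiplication of a polynomial by `X - 2 ^ j`. -/
def coStep (w n j : ℕ) (c : List (List Bool)) : List (List Bool) := (List.range (n + 1)).map fun i =>
  badd (bmul (negPow w j) (c.getD i [])) (if i = 0 then [] else c.getD (i - 1) [])
/-- The coefficients of `∏ (X - 2 ^ j)`. -/
def coeffs (w n d : ℕ) : List (List Bool) := (List.range d).foldl (fun c j => coStep w n j c)
  ((List.range (n + 1)).map fun i => if i = 0 then bone w else [])

def par : Par where
  n := r.n
  m := r.2.2.2.2.2.length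
  M := r.M
  B := r.B
  A := r.1
  red := r.2.1
  d := (List.range r.n).map r.defic
  cf := (List.range r.n).map fun v => coeffs r.M r.n (r.defic v)
  T := r.2.2.2.2.1
  bags := r.2.2.2.2.2

/-- The smaller one of `X` and the budget. -/
def budget : ℕ := ∑ k ∈ Finset.range r.X,
  if ltb false (bsmul r.M k [true]) (bnorm r.M r.2.2.1) then 1 else 0

/-- The answer. -/
def answer : Bool :=
  decide (0 < ∑ i ∈ Finset.range (r.B * (r.budget + 1)), if bit r.par.total i then 1 else 0)

end Raw

/-! ## Running time -/

theorem sum_ite_le (n : ℕ) (q : ℕ → Bool) : (∑ v ∈ Finset.range n, if q v then 1 else 0) ≤ n := by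
  rw [← Finset.sum_filter, Finset.sum_const, smul_eq_mul, mul_one]
  exact (Finset.card_filter_le _ _).trans (by simp)

/-- A preprocessed instance, computable from the input in polynomial time. -/
structure ParCp (c : Ctx I) (p : I → Par) : Prop where
  n : Cp c (fun _ => 0) fun i => (p i).n
  m : Cp c (fun _ => 0) fun i => (p i).m
  M : Cp c (fun _ => 0) fun i => (p i).M
  B : Cp c (fun _ => 0) fun i => (p i).B
  A : Cp c (fun _ => 0) fun i => (p i).A
  red : Cp c (fun _ => 0) fun i => (p i).red
  d : Cp c (fun _ => 0) fun i => (p i).d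
  cf : Cp c (fun _ => 0) fun i => (p i).cf
  T : Cp c (fun _ => 0) fun i => (p i).T
  bags : Cp c (fun _ => 0) fun i => (p i).bags
  hn : PB c fun i => (p i).n
  hm : PB c fun i => (p i).m
  hM : PB c fun i => (p i).M
  hB : PB c fun i => (p i).B
  hd : ∀ i v, (p i).d.getD v 0 ≤ (p i).n
  hcf : ∀ i v a, (((p i).cf.getD v []).getD a []).length ≤ (p i).M

theorem ParCp.ext {c : Ctx I} {p : I → Par} (h : ParCp c p) {R : I → β → α → Prop} :
    ParCp (c.ext R) fun j => p j.i :=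
  ⟨h.n.ext, h.m.ext, h.M.ext, h.B.ext, h.A.ext, h.red.ext, h.d.ext, h.cf.ext, h.T.ext, h.bags.ext,
    h.hn.ext, h.hm.ext, h.hM.ext, h.hB.ext, fun j => h.hd j.i, fun j => h.hcf j.i⟩

theorem ParCp.var {c : Ctx I} {p : I → Par} (h : ParCp c p) {R : I → α → Prop} :
    ParCp (c.var R) fun j => p j.i :=
  ⟨h.n.var, h.m.var, h.M.var, h.B.var, h.A.var, h.red.var, h.d.var, h.cf.var, h.T.var, h.bags.var,
    h.hn.var, h.hm.var, h.hM.var, h.hB.var, fun j => h.hd j.i, fun j => h.hcf j.i⟩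

theorem PB.lt_a {c : Ctx I} {n : I → ℕ} (h : PB c n) : PB (c.lt n) fun j => j.a :=
  h.var.mono fun j => j.h.le

theorem PB.sum {c : Ctx I} {n : I → ℕ} {g : I → ℕ → ℕ} (h : PB c n)
    (hg : PB (c.lt n) fun j => g j.i j.a) : PB c fun i => ∑ v ∈ Finset.range (n i), g i v := by
  obtain ⟨e, he⟩ := hg
  refine (h.mul (⟨e, fun i => le_rfl⟩ : PB c fun i => (c.s i + 2) ^ e)).mono fun i => ?_
  refine (Finset.sum_le_card_nsmul _ (g i) ((c.s i + 2) ^ e)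
    fun v hv => he ⟨i, v, Finset.mem_range.1 hv⟩).trans ?_
  rw [Finset.card_range, smul_eq_mul]

theorem PB.ite {c : Ctx I} {f g : I → ℕ} (hf : PB c f) (hg : PB c g) (q : I → Bool) :
    PB c fun i => if q i then f i else g i :=
  (hf.add hg).mono fun i => by split <;> omega

namespace Cp

variable {c : Ctx I} {W : I → ℕ} {p : I → Par}

theorem bit {l : I → List Bool} {v : I → ℕ} (hl : Cp c W l) (hv : Cp c W v) (h : PB c v) :
    Cp c W fun i => bit (l i) (v i) := getD hl hv bfalse h

theorem bit₂ {A : I → List (List Bool)} {v u : I → ℕ} (hA : Cp c W A) (hv : Cp c W v) (hu : Cp c W u)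
    (h : PB c v) (h' : PB c u) : Cp c W fun i => bit₂ (A i) (v i) (u i) :=
  bit (getD hA hv nil h) hu h'

theorem keyAt {x : I → Key} {v : I → ℕ} (hx : Cp c W x) (hv : Cp c W v) (h : PB c v) :
    Cp c W fun i => (x i).at (v i) := getD hx hv (bfalse.pair zero) h

theorem bone {w : I → ℕ} (hw : Cp c W w) (h : PB c w) : Cp c W fun i => bone (w i) :=
  bnorm hw (btrue.cons nil) h

theorem pow2 {e : I → ℕ} (he : Cp c W e) (h : PB c e) : Cp c W fun i => pow2 (e i) :=
  append (replicate he bfalse h) (btrue.cons nil) (by simpa using h)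

theorem keyPath {x : I → Key} (hx : Cp c W x) {N : I → ℕ} (hN : PB c N)
    (h : ∀ i, (x i).length ≤ N i) (h' : ∀ i, ∀ q ∈ x i, q.2 ≤ N i) : Cp c W fun i => (x i).path := by
  refine flatMapL (g := fun _ q => q.1 :: (List.replicate q.2 true ++ [false])) hx (hN.mono h).pw
    (fun i => N i + 2) (hN.add (PB.const 2)) (fun i q hq => by simpa using h' i q hq)
    (var_a.fst.cons (append (replicate var_a.snd btrue ?_) (bfalse.cons nil) ?_))
  · exact hN.var.mono fun j => h' _ _ j.h
  · simpa using hN.var.mono fun j => h' _ _ j.h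

end Cp

theorem Key.length_path_le {x : Key} {N : ℕ} (h : x.length ≤ N) (h' : ∀ q ∈ x, q.2 ≤ N) :
    x.path.length ≤ N * (N + 2) := by
  rw [Key.path, List.length_flatMap]
  refine (List.sum_le_card_nsmul _ (N + 2) ?_).trans ?_
  · intro k hk
    obtain ⟨q, hq, rfl⟩ := List.mem_map.1 hk
    simpa using h' q hq
  · rw [List.length_map, smul_eq_mul]
    exact Nat.mul_le_mul_right _ h

theorem Key.at_le {x : Key} {N : ℕ} (h' : ∀ q ∈ x, q.2 ≤ N) (v : ℕ) : (x.at v).2 ≤ N := by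
  rw [Key.at, List.getD_eq_getElem?_getD]
  cases hx : x[v]? with
  | none => simp
  | some q => exact h' q (List.mem_of_getElem? hx)

namespace Par

variable {p : Par}

@[simp] theorem length_restrict (b : List Bool) (x : Key) : (p.restrict b x).length = p.n := by
  simp [restrict]

theorem restrict_le (b : List Bool) {x : Key} {N : ℕ} (h' : ∀ q ∈ x, q.2 ≤ N) :
    ∀ q ∈ p.restrict b x, q.2 ≤ N := by
  intro q hq
  simp only [restrict, List.mem_map] at hq
  obtain ⟨v, _, rfl⟩ := hq
  split
  · exact Key.at_le h' v
  · simp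

@[simp] theorem length_wCo (b b' : List Bool) (x : Key) : (p.wCo b b' x).length = p.M := by
  rw [wCo]
  generalize hl : List.range p.n = l
  clear hl
  have : ∀ acc : List Bool, acc.length = p.M → (l.foldl (fun acc v => if bit b v && !bit b' v then
      bmul acc ((p.cf.getD v []).getD (x.at v).2 []) else acc) acc).length = p.M := by
    induction l with
    | nil => exact fun acc h => h
    | cons a l ih =>
      intro acc h
      refine ih _ ?_
      dsimp only
      split <;> simpa using h
  exact this _ (by simp [bone])

@[simp] theorem length_weight (b b' : List Bool) (x : Key) : (p.weight b b' x).length = p.M := by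
  simp [weight]

end Par

namespace Cp

variable {c : Ctx I} {W : I → ℕ} {p : I → Par}

theorem wExp (hp : ParCp c p) {b b' : I → List Bool} {x : I → Key} (hb : Cp c W b) (hb' : Cp c W b')
    (hx : Cp c W x) (hx' : ∀ i, ∀ q ∈ x i, q.2 ≤ (p i).n) :
    Cp c W (fun i => (p i).wExp (b i) (b' i) (x i)) ∧ PB c fun i => (p i).wExp (b i) (b' i) (x i) := by
  have h1 : PB (c.lt fun i => (p i).n) fun j => ∑ u ∈ Finset.range (p j.i).n,
      if _root_.bit₂ (p j.i).A j.a u && ((x j.i).at u).1 && (_root_.bit (b j.i) j.a && _root_.bit (b j.i) u) &&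
      !(_root_.bit (b' j.i) j.a && _root_.bit (b' j.i) u) then ((x j.i).at j.a).2 else 0 :=
    PB.sum (g := fun (j : VarIdx I ℕ _) u => if _root_.bit₂ (p j.i).A j.a u && ((x j.i).at u).1 &&
      (_root_.bit (b j.i) j.a && _root_.bit (b j.i) u) &&
      !(_root_.bit (b' j.i) j.a && _root_.bit (b' j.i) u) then ((x j.i).at j.a).2 else 0) hp.hn.var
      (PB.ite (hp.hn.var.var.mono fun j => Key.at_le (hx' _) _) (PB.const 0) _)
  have h2 := (PB.ite hp.hB.var (PB.const 0) fun j : VarIdx I ℕ fun i a => a < (p i).n =>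
    _root_.bit (b j.i) j.a && !_root_.bit (b' j.i) j.a && ((x j.i).at j.a).1).add h1
  refine ⟨sumRange hp.n.up hp.hn (natAdd ?_ ?_ h1) h2, PB.sum hp.hn h2⟩
  · have ha := hp.hn.lt_a
    exact bite (((bit hb.var var_a ha).band (bit hb'.var var_a ha).bnot).band
      (keyAt hx.var var_a ha).fst) hp.B.up.var zero
  · have ha := (hp.hn.lt_a).var (R := fun (j : VarIdx I ℕ fun i a => a < (p i).n) u => u < (p j.i).n)
    have hu := hp.hn.var (R := fun i a => a < (p i).n).lt_a
    have hv := (var_a (c := c) (R := fun i a => a < (p i).n) (W := fun j => W j.i)).var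
      (R := fun j u => u < (p j.i).n)
    refine sumRange hp.n.up.var hp.hn.var (bite ?_ (keyAt hx.var.var hv ha).snd zero)
      (PB.ite (hp.hn.var.var.mono fun j => Key.at_le (hx' _) _) (PB.const 0) _)
    exact (((bit₂ hp.A.up.var.var hv var_a ha hu).band (keyAt hx.var.var var_a hu).fst).band
      ((bit hb.var.var hv ha).band (bit hb.var.var var_a hu))).band
      ((bit hb'.var.var hv ha).band (bit hb'.var.var var_a hu)).bnot

theorem wCo (hp : ParCp c p) {b b' : I → List Bool} {x : I → Key} (hb : Cp c W b) (hb' : Cp c W b')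
    (hx : Cp c W x) (hx' : ∀ i, ∀ q ∈ x i, q.2 ≤ (p i).n) :
    Cp c W (fun i => (p i).wCo (b i) (b' i) (x i)) := by
  refine foldRange (fun i acc => acc.length = (p i).M) hp.n.up (bone hp.M.up hp.hM) hp.hn
    (fun i => by simp [_root_.bone]) (fun i acc a _ h => by split <;> simpa using h) ?_
  have ha : PB (c.ext fun i (acc : List Bool) a => a < (p i).n ∧ acc.length = (p i).M) fun j => j.a :=
    hp.hn.ext.mono fun j => j.h.1.le
  refine bite ((bit hb.ext ext_a ha).band (bit hb'.ext ext_a ha).bnot) (bmul ext_b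
    (getD (getD hp.cf.up.ext ext_a nil ha) (keyAt hx.ext ext_a ha).snd nil ?_) ?_ ?_) ext_b
  · exact hp.hn.ext.mono fun j => Key.at_le (hx' _) _
  · exact hp.hM.ext.mono fun j => j.h.2.le
  · exact hp.hM.ext.mono fun j => hp.hcf _ _ _

theorem weight (hp : ParCp c p) {b b' : I → List Bool} {x : I → Key} (hb : Cp c W b) (hb' : Cp c W b')
    (hx : Cp c W x) (hx' : ∀ i, ∀ q ∈ x i, q.2 ≤ (p i).n) :
    Cp c W (fun i => (p i).weight (b i) (b' i) (x i)) := by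
  obtain ⟨h1, h2⟩ := wExp hp hb hb' hx hx'
  exact bmul (wCo hp hb hb' hx hx') (pow2 h1 h2) (by simpa using hp.hM)
    (by simpa [_root_.pow2] using h2.add (PB.const 1))

theorem restrict (hp : ParCp c p) {b : I → List Bool} {x : I → Key} (hb : Cp c W b) (hx : Cp c W x) :
    Cp c W (fun i => (p i).restrict (b i) (x i)) :=
  tabulate hp.n.up hp.hn (bite (bit hb.var var_a hp.hn.lt_a) (keyAt hx.var var_a hp.hn.lt_a)
    (bfalse.pair zero))

theorem restrictPath (hp : ParCp c p) {b : I → List Bool} {x : I → Key} (hb : Cp c W b) (hx : Cp c W x)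
    (hx' : ∀ i, ∀ q ∈ x i, q.2 ≤ (p i).n) :
    Cp c W (fun i => ((p i).restrict (b i) (x i)).path) ∧
      PB c fun i => ((p i).restrict (b i) (x i)).path.length :=
  ⟨keyPath (restrict hp hb hx) hp.hn (fun i => by simp) fun i => Par.restrict_le _ (hx' i),
    (hp.hn.mul (hp.hn.add (PB.const 2))).mono fun i =>
      Key.length_path_le (by simp) (Par.restrict_le _ (hx' i))⟩

end Cp

/-! ### Number of keys and sizes of tables -/

namespace Par

variable (p : Par)

theorem digits_le {v : ℕ} {N : ℕ} (h : p.d.getD v 0 ≤ N) : ∀ q ∈ p.digits v, q.2 ≤ N := by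
  intro q hq
  simp only [digits, List.mem_flatMap, List.mem_range] at hq
  obtain ⟨a, ha, hq⟩ := hq
  have : q.2 = a := by
    split at hq <;> simp at hq
    · rcases hq with rfl | rfl <;> rfl
    · rw [hq]
  omega

theorem choices_le (b : List Bool) {v : ℕ} {N : ℕ} (h : p.d.getD v 0 ≤ N) :
    ∀ q ∈ p.choices b v, q.2 ≤ N := by
  intro q hq
  rw [choices] at hq
  split at hq
  · exact p.digits_le h q hq
  · simp at hq
    simp [hq]

theorem length_digits (v : ℕ) :
    (p.digits v).length = (if bit p.red v then 2 else 1) * (p.d.getD v 0 + 1) := by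
  have : ∀ a : ℕ, (if bit p.red v = true then [(false, a), (true, a)] else [(false, a)]).length =
      if bit p.red v then 2 else 1 := by intro a; split <;> rfl
  rw [digits, List.length_flatMap]
  simp only [this, List.map_const', List.sum_replicate, List.length_range, smul_eq_mul]
  ring

theorem length_choices_le (b : List Bool) (v : ℕ) :
    (p.choices b v).length ≤ 2 * (p.d.getD v 0 + 1) := by
  rw [choices]
  split
  · rw [length_digits]
    gcongr
    split <;> omega
  · simp; omega

theorem length_choices_pos (b : List Bool) (v : ℕ) : 1 ≤ (p.choices b v).length := by
  rw [choices]
  split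
  · rw [length_digits]
    split <;> omega
  · simp

theorem keysBelow_succ (b : List Bool) (k : ℕ) : p.keysBelow b (k + 1) =
    (p.keysBelow b k).flatMap fun x => (p.choices b k).map fun q => x ++ [q] := by
  simp [keysBelow, List.range_succ]

theorem length_keysBelow (b : List Bool) (k : ℕ) :
    (p.keysBelow b k).length = ∏ v ∈ Finset.range k, (p.choices b v).length := by
  induction k with
  | zero => simp [keysBelow]
  | succ k ih => simp [keysBelow_succ, List.length_flatMap, Finset.prod_range_succ, ih]

/-- Every vertex has at least one choice, so extending keys never shortens the list; the
intermediate lists of the enumeration are bounded by the final one. -/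
theorem length_keysBelow_mono (b : List Bool) {k l : ℕ} (h : k ≤ l) :
    (p.keysBelow b k).length ≤ (p.keysBelow b l).length := by
  rw [length_keysBelow, length_keysBelow]
  exact Finset.prod_le_prod_of_subset_of_one_le' (Finset.range_mono h)
    fun v _ _ => p.length_choices_pos b v

/-- The number of keys of a bag. -/
def keyCount (b : List Bool) : ℕ := (p.keysBelow b p.n).length

/-- Bounds on the entries of a table. -/
def TableOK (K : ℕ) (tab : Table) : Prop :=
  tab.length ≤ K ∧ ∀ e ∈ tab, e.1.length ≤ p.n ∧ (∀ q ∈ e.1, q.2 ≤ p.n) ∧ e.2.length ≤ p.M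

theorem keysBelow_ok (hd : ∀ v, p.d.getD v 0 ≤ p.n) (b : List Bool) (k : ℕ) :
    ∀ x ∈ p.keysBelow b k, x.length = k ∧ ∀ q ∈ x, q.2 ≤ p.n := by
  induction k with
  | zero => simp [keysBelow]
  | succ k ih =>
    intro x hx
    simp only [keysBelow_succ, List.mem_flatMap, List.mem_map] at hx
    obtain ⟨y, hy, q, hq, rfl⟩ := hx
    refine ⟨by simp [(ih y hy).1], fun q' hq' => ?_⟩
    rcases List.mem_append.1 hq' with h | h
    · exact (ih y hy).2 q' h
    · rw [List.mem_singleton.1 h]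
      exact p.choices_le b (hd k) q hq

theorem table₀_ok (hd : ∀ v, p.d.getD v 0 ≤ p.n) {b : List Bool} {K : ℕ} (hK : p.keyCount b ≤ K) :
    p.TableOK K (p.table₀ b) := by
  refine ⟨by simpa [table₀, keyCount] using hK, fun e he => ?_⟩
  simp only [table₀, List.mem_map] at he
  obtain ⟨x, hx, rfl⟩ := he
  have := p.keysBelow_ok hd b _ x hx
  exact ⟨this.1.le, this.2, by simp [bone]⟩

theorem updTable_ok {K : ℕ} (b : List Bool) (msg : BinData) {tab : Table} (h : p.TableOK K tab) :
    p.TableOK K (p.updTable b msg tab) := by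
  refine ⟨by simpa [updTable] using h.1, fun e he => ?_⟩
  simp only [updTable, List.mem_map] at he
  obtain ⟨e, he, rfl⟩ := he
  have := h.2 e he
  exact ⟨this.1, this.2.1, by simpa using this.2.2⟩

theorem getD_map_range {δ : Type*} (f : ℕ → δ) (m l : ℕ) (d : δ) :
    ((List.range m).map f).getD l d = if l < m then f l else d := by
  split <;> rename_i h
  · rw [List.getD_eq_getElem _ _ (by simpa using h)]
    simp
  · rw [List.getD_eq_default _ _ (by simpa using h)]

/-- Bounds on all tables. -/
def StateOK (K : ℕ) (st : State) : Prop := ∀ l, p.TableOK K (st.2.1.getD l [])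

theorem state₀_ok (hd : ∀ v, p.d.getD v 0 ≤ p.n) {K : ℕ}
    (hK : ∀ l, p.keyCount (p.bags.getD l []) ≤ K) : p.StateOK K p.state₀ := by
  intro l
  simp only [state₀, getD_map_range]
  split
  · exact p.table₀_ok hd (hK l)
  · simp [TableOK]

theorem elim_ok {K : ℕ} {st : State} (h : p.StateOK K st) (i j : ℕ) (msg : BinData) :
    p.StateOK K (p.elim st i j msg) := by
  intro l
  simp only [elim, getD_map_range]
  split
  · split
    · exact p.updTable_ok _ _ (h l)
    · exact h l
  · simp [TableOK]

end Par

/-! ### Cost of enumerating keys, of messages and of elimination steps -/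

namespace Cp

variable {c : Ctx I} {W : I → ℕ} {p : I → Par}

theorem digits (hp : ParCp c p) {v : I → ℕ} (hv : Cp c (fun _ => 0) v) (hv' : PB c v) :
    Cp c (fun _ => 0) fun i => (p i).digits (v i) := by
  have h1 : PB c fun i => (p i).d.getD (v i) 0 + 1 := (hp.hn.mono fun i => hp.hd i _).add (PB.const 1)
  refine flatMapL (g := fun i a => if _root_.bit (p i).red (v i) then [(false, a), (true, a)]
    else [(false, a)]) (range (getD hp.d hv zero hv').succ h1) (by simpa using h1.pw) (fun _ => 2)
    (PB.const 2) ?_ ?_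
  · intro i a _
    split <;> simp
  · exact bite (bit hp.red.var hv.var hv'.var) ((bfalse.pair var_a).cons ((btrue.pair var_a).cons nil))
      ((bfalse.pair var_a).cons nil)

theorem choices (hp : ParCp c p) {b : I → List Bool} {v : I → ℕ} (hb : Cp c (fun _ => 0) b)
    (hv : Cp c (fun _ => 0) v) (hv' : PB c v) :
    Cp c (fun _ => 0) fun i => (p i).choices (b i) (v i) :=
  bite (bit hb hv hv') (digits hp hv hv') ((bfalse.pair zero).cons nil)

end Cp

theorem PW.ext {c : Ctx I} {W h : I → ℕ} (hh : PW c W h) {R : I → β → α → Prop} :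
    PW (c.ext R) (fun j => W j.i) (fun j => h j.i) := hh.imp fun _ he j => he j.i

theorem PW.var {c : Ctx I} {W h : I → ℕ} (hh : PW c W h) {R : I → α → Prop} :
    PW (c.var R) (fun j => W j.i) (fun j => h j.i) := hh.imp fun _ he j => he j.i

theorem PB.choices {c : Ctx I} {p : I → Par} (hp : ParCp c p) (b : I → List Bool) (v : I → ℕ) :
    PB c fun i => ((p i).choices (b i) (v i)).length :=
  ((PB.const 2).mul (hp.hn.add (PB.const 1))).mono fun i =>
    ((p i).length_choices_le _ _).trans (by have := hp.hd i (v i); gcongr)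

namespace Cp

variable {c : Ctx I} {W : I → ℕ} {p : I → Par}

/-- The cost of each round depends on the length of the current list. The invariant identifies that
list with the keys below the current vertex, so it is at most the final count. -/
theorem keys (hp : ParCp c p) {b : I → List Bool} (hb : Cp c (fun _ => 0) b)
    (hK : PW c W fun i => (p i).keyCount (b i)) :
    Cp c W fun i => (p i).keysBelow (b i) (p i).n := by
  refine foldRangeI (fun i v ks => ks = (p i).keysBelow (b i) v) hp.n.up (nil.cons nil) hp.hn
    (fun i => rfl) (fun i ks v _ h => by rw [h, Par.keysBelow_succ]) ?_
  refine flatMapL (g := fun j x => ((p j.i).choices (b j.i) j.a).map fun q => x ++ [q]) ext_b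
    (hK.ext.mono fun j => ?_) (fun j => 2 * ((p j.i).n + 1))
    ((PB.const 2).mul (hp.hn.ext.add (PB.const 1))) ?_ ?_
  · rw [j.h.2]
    exact (p j.i).length_keysBelow_mono _ j.h.1.le
  · intro j x _
    rw [List.length_map]
    exact ((p j.i).length_choices_le _ _).trans (by have := hp.hd j.i j.a; gcongr)
  · have hn := hp.hn.ext (R := fun i (ks : List Key) a => a < (p i).n ∧ ks = (p i).keysBelow (b i) a)
    have hx := var_a (c := c.ext fun i (ks : List Key) a => a < (p i).n ∧ ks = (p i).keysBelow (b i) a)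
      (R := fun j x => x ∈ j.b) (W := fun _ => 0)
    have hv := ext_a (c := c) (R := fun i (ks : List Key) a => a < (p i).n ∧
      ks = (p i).keysBelow (b i) a) (W := fun _ => 0)
    refine mapL (g := fun j q => j.a ++ [q])
      (choices hp.ext.var hb.ext.var hv.var (PB.var (hn.mono fun j => j.h.1.le)))
      (PB.choices hp.ext.var _ _).pw (append hx.var (var_a.cons nil) ?_)
    refine hp.hn.ext.var.var.mono fun j => ?_
    have h := j.i.h
    rw [j.i.i.h.2] at h
    rw [((p j.i.i.i).keysBelow_ok (hp.hd _) _ _ _ h).1]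
    exact j.i.i.h.1.le

theorem table₀ (hp : ParCp c p) {b : I → List Bool} (hb : Cp c (fun _ => 0) b)
    (hK : PW c W fun i => (p i).keyCount (b i)) : Cp c W fun i => (p i).table₀ (b i) :=
  mapL (keys hp hb hK) hK (var_a.pair (bone hp.M.var hp.hM.var))

/-- One pass over the table. Paths of keys have polynomial length, so look-up and update in the
search tree cost polynomial time per entry, however large the tree is. -/
theorem msgOf (hp : ParCp c p) {b b' : I → List Bool} {tab : I → Table} (hb : Cp c (fun _ => 0) b)
    (hb' : Cp c (fun _ => 0) b') (ht : Cp c W tab) (K : I → ℕ) (hK : PW c W K)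
    (hok : ∀ i, (p i).TableOK (K i) (tab i)) :
    Cp c W fun i => (p i).msgOf (b i) (b' i) (tab i) := by
  refine foldlL (fun _ _ => True) ht nilData (hK.mono fun i => (hok i).1) (fun _ => trivial)
    (fun _ _ _ _ _ => trivial) ?_
  obtain ⟨h1, h2⟩ := restrictPath hp.ext hb'.ext (ext_a.fst (c := c.ext fun i (_ : BinData) a =>
    a ∈ tab i ∧ True)) fun j => ((hok j.i).2 j.a j.h.1).2.1
  refine upd ext_b h1 (baddD (bmul ext_a.snd (weight hp.ext hb.ext hb'.ext ext_a.fst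
    fun j => ((hok j.i).2 j.a j.h.1).2.1) ?_ ?_) (lk ext_b h1 h2) ?_) h2
  · exact hp.hM.ext.mono fun j => ((hok j.i).2 j.a j.h.1).2.2
  · simpa using hp.hM.ext
  · simpa using hp.hM.ext.mono fun j => ((hok j.i).2 j.a j.h.1).2.2

theorem updTable (hp : ParCp c p) {b : I → List Bool} {msg : I → BinData} {tab : I → Table}
    (hb : Cp c (fun _ => 0) b) (hm : Cp c (fun _ => 0) msg) (ht : Cp c W tab) (K : I → ℕ)
    (hK : PW c W K) (hok : ∀ i, (p i).TableOK (K i) (tab i)) :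
    Cp c W fun i => (p i).updTable (b i) (msg i) (tab i) := by
  refine mapL ht (hK.mono fun i => (hok i).1) ?_
  obtain ⟨h1, h2⟩ := restrictPath hp.var hb.var (var_a.fst (c := c.var fun i a => a ∈ tab i))
    fun j => ((hok j.i).2 j.a j.h).2.1
  refine var_a.fst.pair (bmul var_a.snd (bnormD hp.M.var (lk hm.var h1 h2) hp.hM.var) ?_ ?_)
  · exact hp.hM.var.mono fun j => ((hok j.i).2 j.a j.h).2.2
  · simpa using hp.hM.var

end Cp

theorem foldl_select_le (q : ℕ → Bool) (m : ℕ) (l : List ℕ) (hl : ∀ i ∈ l, i < m) (a : ℕ)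
    (ha : a ≤ m) : l.foldl (fun acc i => if q i then i else acc) a ≤ m := by
  induction l generalizing a with
  | nil => exact ha
  | cons b l ih =>
    refine ih (fun i hi => hl i (List.mem_cons_of_mem _ hi)) _ ?_
    dsimp only
    split
    · exact (hl b List.mem_cons_self).le
    · exact ha

theorem Par.nbr_le (p : Par) (alive : List Bool) (i : ℕ) : p.nbr alive i ≤ p.m :=
  foldl_select_le _ _ _ (fun _ h => List.mem_range.1 h) _ le_rfl

theorem Par.leaf_le (p : Par) (alive : List Bool) : p.leaf alive ≤ p.m :=
  foldl_select_le _ _ _ (fun _ h => List.mem_range.1 h) _ le_rfl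

namespace Cp

variable {c : Ctx I} {W : I → ℕ} {p : I → Par}

theorem nbrs (hp : ParCp c p) {al : I → List Bool} {v : I → ℕ} (ha : Cp c W al) (hv : Cp c W v)
    (hv' : PB c v) : Cp c W fun i => (p i).nbrs (al i) (v i) :=
  sumRange hp.m.up hp.hm (bite ((bit ha.var var_a hp.hm.lt_a).band
    (bit₂ hp.T.up.var hv.var var_a hv'.var hp.hm.lt_a)) (natConst 1) zero)
    (PB.ite (PB.const 1) (PB.const 0) _)

theorem nbr (hp : ParCp c p) {al : I → List Bool} {v : I → ℕ} (ha : Cp c W al) (hv : Cp c W v)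
    (hv' : PB c v) : Cp c W fun i => (p i).nbr (al i) (v i) := by
  refine foldRange (fun _ _ => True) hp.m.up hp.m.up hp.hm (fun _ => trivial)
    (fun _ _ _ _ _ => trivial) ?_
  have h1 : PB (c.ext fun i (_ : ℕ) a => a < (p i).m ∧ True) fun j => j.a :=
    hp.hm.ext.mono fun j => j.h.1.le
  exact bite ((bit ha.ext ext_a h1).band (bit₂ hp.T.up.ext hv.ext ext_a hv'.ext h1)) ext_a ext_b

theorem leaf (hp : ParCp c p) {al : I → List Bool} (ha : Cp c W al) :
    Cp c W fun i => (p i).leaf (al i) := by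
  refine foldRange (fun _ _ => True) hp.m.up hp.m.up hp.hm (fun _ => trivial)
    (fun _ _ _ _ _ => trivial) ?_
  have h1 : PB (c.ext fun i (_ : ℕ) a => a < (p i).m ∧ True) fun j => j.a :=
    hp.hm.ext.mono fun j => j.h.1.le
  exact bite ((bit ha.ext ext_a h1).band (natLe (nbrs hp.ext ha.ext ext_a h1) (natConst 1)
    (PB.const 1))) ext_a ext_b

/-- The value of `f` is computed once and becomes part of the input of the continuation, where
reading it is cheap. Without this sharing, a message would be recomputed for every entry of the
table that it multiplies. -/
theorem letIn {f : I → α} {g : I → α → β} (hf : Cp c W f)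
    (hg : Cp (c.var fun i a => a = f i) (fun j => W j.i) fun j => g j.i j.a) :
    Cp c W fun i => g i (f i) :=
  hg.reindex (c' := c) (W' := W) (fun i => (⟨i, f i, rfl⟩ : VarIdx I α fun i a => a = f i))
    (inp.consData hf.data) (fun _ => le_rfl) (fun _ => le_rfl)

theorem elim (hp : ParCp c p) {st : I → Par.State} {u v : I → ℕ} {msg : I → BinData}
    (hst : Cp c (fun _ => 0) st) (hu : Cp c (fun _ => 0) u) (hv : Cp c (fun _ => 0) v)
    (hm : Cp c (fun _ => 0) msg) (hu' : PB c u) (hv' : PB c v) (K : I → ℕ) (hK : PW c W K)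
    (hok : ∀ i, (p i).StateOK (K i) (st i)) :
    Cp c W fun i => (p i).elim (st i) (u i) (v i) (msg i) := by
  have hl := hp.hm.lt_a
  refine (tabulate (g := fun i l => if l = u i then false else _root_.bit (st i).1 l) hp.m.up hp.hm
    (ite (natEq var_a hu.up.var hl hu'.var) bfalse (bit hst.fst.up.var var_a hl))).pair
    ((tabulate (g := fun i l => if l = v i then
      (p i).updTable ((p i).bags.getD (u i) []) (msg i) ((st i).2.1.getD l [])
      else (st i).2.1.getD l []) hp.m.up hp.hm ?_).pair hm.up)
  have h1 : Cp (c.lt fun i => (p i).m) (fun _ => 0) fun j => (st j.i).2.1.getD j.a [] :=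
    getD hst.snd.fst.var var_a nil hl
  exact ite (natEq var_a hv.up.var hl hv'.var)
    (updTable hp.var (getD hp.bags hu nil hu').var hm.var h1.up (fun j => K j.i) hK.var
      fun j => hok j.i j.a) h1.up

theorem step (hp : ParCp c p) {st : I → Par.State} (hst : Cp c (fun _ => 0) st) (K : I → ℕ)
    (hK : PW c W K) (hok : ∀ i, (p i).StateOK (K i) (st i)) :
    Cp c W fun i => (p i).step (st i) := by
  have h1 : Cp c (fun _ => 0) fun i => (p i).leaf (st i).1 := leaf hp hst.fst
  have h2 : PB c fun i => (p i).leaf (st i).1 := hp.hm.mono fun i => (p i).leaf_le _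
  have h3 : Cp c (fun _ => 0) fun i => (p i).nbr (st i).1 ((p i).leaf (st i).1) :=
    nbr hp hst.fst h1 h2
  have h4 : PB c fun i => (p i).nbr (st i).1 ((p i).leaf (st i).1) :=
    hp.hm.mono fun i => (p i).nbr_le _ _
  refine letIn (f := fun i => (p i).nextMsg (st i) ((p i).leaf (st i).1)
    ((p i).nbr (st i).1 ((p i).leaf (st i).1))) (g := fun i msg => (p i).elim (st i) ((p i).leaf (st i).1)
    ((p i).nbr (st i).1 ((p i).leaf (st i).1)) msg) ?_ ?_
  · exact msgOf hp (getD hp.bags h1 nil h2) (getD hp.bags h3 nil h4) (getD hst.snd.fst h1 nil h2).up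
      K hK fun i => hok i _
  · exact elim hp.var hst.var h1.var h3.var var_a h2.var h4.var (fun j => K j.i) hK.var
      fun j => hok j.i

theorem state₀ (hp : ParCp c p) (K : I → ℕ) (hK : PW c W K)
    (hok : ∀ i l, (p i).keyCount ((p i).bags.getD l []) ≤ K i) : Cp c W fun i => (p i).state₀ :=
  (replicate hp.m.up btrue hp.hm).pair ((tabulate
    (g := fun i l => (p i).table₀ ((p i).bags.getD l [])) hp.m.up hp.hm
    (table₀ hp.var (getD hp.bags.var var_a nil hp.hm.lt_a) (hK.var.mono fun j => hok j.i _))).pair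
      nilData)

theorem total (hp : ParCp c p) (K : I → ℕ) (hK : PW c W K)
    (hok : ∀ i l, (p i).keyCount ((p i).bags.getD l []) ≤ K i) : Cp c W fun i => (p i).total := by
  have h1 : Cp c W fun i => (List.range (p i).m).foldl (fun st _ => (p i).step st) (p i).state₀ :=
    foldRange (fun i st => (p i).StateOK (K i) st) hp.m.up (state₀ hp K hK hok) hp.hm
      (fun i => (p i).state₀_ok (hp.hd i) (hok i)) (fun i st _ _ h => (p i).elim_ok h _ _ _)
      (step hp.ext ext_b (fun j => K j.i) hK.ext fun j => j.h.2)
  obtain ⟨h2, h3⟩ := restrictPath (W := W) hp (b := fun _ => []) (x := fun _ => []) nil nil (by simp)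
  exact bnormD hp.M.up (lk h1.snd.snd h2 h3) hp.hM

end Cp

/-! ## Preprocessing -/

namespace Raw

theorem deg_le (r : Raw) (v : ℕ) : r.deg v ≤ r.n := sum_ite_le _ _

theorem blue_le (r : Raw) (v : ℕ) : r.blue v ≤ r.n := sum_ite_le _ fun u => bit₂ r.1 v u && !bit r.2.1 u

theorem need_le (r : Raw) (v : ℕ) : r.need v ≤ r.n := (sum_ite_le _ _).trans (r.deg_le v)

theorem defic_le (r : Raw) (v : ℕ) : r.defic v ≤ r.n := (Nat.sub_le _ _).trans (r.need_le v)

theorem budget_le (r : Raw) : r.budget ≤ r.X := sum_ite_le _ _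

theorem length_coStep (w n j : ℕ) (c : List (List Bool)) : (coStep w n j c).length = n + 1 := by
  simp [coStep]

theorem coStep_ok (w n j : ℕ) (c : List (List Bool)) : ∀ x ∈ coStep w n j c, x.length ≤ w := by
  intro x hx
  simp only [coStep, List.mem_map] at hx
  obtain ⟨i, _, rfl⟩ := hx
  simp [negPow]

theorem length_getD_le {l : List (List Bool)} {w : ℕ} (h : ∀ x ∈ l, x.length ≤ w) (i : ℕ) :
    (l.getD i []).length ≤ w := by
  rw [List.getD_eq_getElem?_getD]
  cases hx : l[i]? with
  | none => simp
  | some x => exact h x (List.mem_of_getElem? hx)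

theorem coeffs_ok (w n d : ℕ) : ∀ x ∈ coeffs w n d, x.length ≤ w := by
  induction d with
  | zero =>
    intro x hx
    simp only [coeffs, List.range_zero, List.foldl_nil, List.mem_map] at hx
    obtain ⟨i, _, rfl⟩ := hx
    split <;> simp [bone]
  | succ d ih =>
    rw [coeffs, List.range_succ (n := d), List.foldl_append]
    exact coStep_ok _ _ _ _

end Raw

namespace Cp

variable {c : Ctx I} {W : I → ℕ}

theorem negPow {w j : I → ℕ} (hw : Cp c W w) (hj : Cp c W j) (hw' : PB c w) (hj' : PB c j) :
    Cp c W fun i => Raw.negPow (w i) (j i) :=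
  bmul (replicate hw btrue hw') (pow2 hj hj') (by simpa using hw')
    (by simpa [_root_.pow2] using hj'.add (PB.const 1))

theorem coStep {w n j : I → ℕ} {l : I → List (List Bool)} (hw : Cp c W w) (hn : Cp c W n)
    (hj : Cp c W j) (hl : Cp c W l) (hw' : PB c w) (hn' : PB c n) (hj' : PB c j)
    (hl' : ∀ i, ∀ x ∈ l i, x.length ≤ w i) :
    Cp c W fun i => Raw.coStep (w i) (n i) (j i) (l i) := by
  have h1 := hn'.add (PB.const 1)
  refine tabulate hn.succ h1 (badd (bmul (negPow hw.var hj.var hw'.var hj'.var)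
    (getD hl.var var_a nil h1.lt_a) ?_ ?_) (ite var_a.isZero nil
    (getD hl.var var_a.pred nil (h1.lt_a.mono fun j => Nat.sub_le _ _))) ?_)
  · simpa [Raw.negPow] using hw'.var
  · exact hw'.var.mono fun j => Raw.length_getD_le (hl' j.i) _
  · simpa [Raw.negPow] using hw'.var

theorem coeffs {w n d : I → ℕ} (hw : Cp c W w) (hn : Cp c W n) (hd : Cp c W d) (hw' : PB c w)
    (hn' : PB c n) (hd' : PB c d) : Cp c W fun i => Raw.coeffs (w i) (n i) (d i) := by
  have h1 := hn'.add (PB.const 1)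
  refine foldRange (fun i l => ∀ x ∈ l, x.length ≤ w i) hd (tabulate hn.succ h1
    (ite var_a.isZero (bone hw.var hw'.var) nil)) hd' ?_ (fun i l j _ _ => Raw.coStep_ok _ _ _ _)
    (coStep hw.ext hn.ext ext_a ext_b hw'.ext hn'.ext (hd'.ext.mono fun j => j.h.1.le) fun j => j.h.2)
  intro i
  exact Raw.coeffs_ok (w i) (n i) 0

end Cp

namespace Raw

theorem n_le (r : Raw) : r.n ≤ r.X := by rw [X, n]; omega

theorem le_B (r : Raw) : r.X ≤ r.B := by
  have h : 1 ≤ r.X := by rw [X]; omega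
  calc r.X = r.X * 1 * (1 * 1) := by ring
    _ ≤ r.X * r.X * (r.X * r.X) := by gcongr

theorem le_M (r : Raw) : r.X ≤ r.M := r.le_B.trans (Nat.le_mul_of_pos_right _ (by omega))

theorem par_d (r : Raw) (v : ℕ) : r.par.d.getD v 0 = if v < r.n then r.defic v else 0 :=
  Par.getD_map_range _ _ _ _

theorem par_cf (r : Raw) (v : ℕ) :
    r.par.cf.getD v [] = if v < r.n then coeffs r.M r.n (r.defic v) else [] :=
  Par.getD_map_range _ _ _ _

end Raw

section Preprocessing

variable {c : Ctx I} {W : I → ℕ} {r : I → Raw}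

/-- An input of polynomially bounded size. -/
structure RawCp (c : Ctx I) (r : I → Raw) : Prop where
  raw : Cp c (fun _ => 0) r
  hX : PB c fun i => (r i).X
  hm : PB c fun i => (r i).2.2.2.2.2.length

theorem RawCp.var (h : RawCp c r) {R : I → α → Prop} : RawCp (c.var R) fun j => r j.i :=
  ⟨h.raw.var, h.hX.var, h.hm.var⟩

namespace RawCp

theorem hn (h : RawCp c r) : PB c fun i => (r i).n := h.hX.mono fun i => (r i).n_le
theorem hB (h : RawCp c r) : PB c fun i => (r i).B := (h.hX.mul h.hX).mul (h.hX.mul h.hX)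
theorem hM (h : RawCp c r) : PB c fun i => (r i).M := h.hB.mul (h.hX.add (PB.const 1))

theorem n (h : RawCp c r) : Cp c (fun _ => 0) fun i => (r i).n := h.raw.fst.length h.hn

theorem X (h : RawCp c r) : Cp c (fun _ => 0) fun i => (r i).X := by
  have h1 : PB c fun i => (r i).2.2.1.length := h.hX.mono fun i => by rw [Raw.X]; omega
  have h2 : PB c fun i => (r i).2.2.2.1.1.length := h.hX.mono fun i => by rw [Raw.X]; omega
  have h3 : PB c fun i => (r i).2.2.2.1.2.length := h.hX.mono fun i => by rw [Raw.X]; omega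
  exact (Cp.natAdd (Cp.natAdd (Cp.natAdd h.n (h.raw.snd.snd.fst.length h1) h1)
    (h.raw.snd.snd.snd.fst.fst.length h2) h2) (h.raw.snd.snd.snd.fst.snd.length h3) h3).succ

theorem B (h : RawCp c r) : Cp c (fun _ => 0) fun i => (r i).B :=
  Cp.natMul (Cp.natMul h.X h.X h.hX h.hX) (Cp.natMul h.X h.X h.hX h.hX) (h.hX.mul h.hX) (h.hX.mul h.hX)

theorem M (h : RawCp c r) : Cp c (fun _ => 0) fun i => (r i).M :=
  Cp.natMul h.B h.X.succ h.hB (h.hX.add (PB.const 1))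

variable {v : I → ℕ}

theorem deg (h : RawCp c r) (hv : Cp c (fun _ => 0) v) (hv' : PB c v) :
    Cp c (fun _ => 0) fun i => (r i).deg (v i) :=
  Cp.sumRange h.n h.hn (Cp.bite (Cp.bit₂ h.raw.fst.var hv.var Cp.var_a hv'.var h.hn.lt_a)
    (Cp.natConst 1) Cp.zero) (PB.ite (PB.const 1) (PB.const 0) _)

theorem blue (h : RawCp c r) (hv : Cp c (fun _ => 0) v) (hv' : PB c v) :
    Cp c (fun _ => 0) fun i => (r i).blue (v i) :=
  Cp.sumRange h.n h.hn (Cp.bite ((Cp.bit₂ h.raw.fst.var hv.var Cp.var_a hv'.var h.hn.lt_a).band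
    (Cp.bit h.raw.snd.fst.var Cp.var_a h.hn.lt_a).bnot)
    (Cp.natConst 1) Cp.zero) (PB.ite (PB.const 1) (PB.const 0) _)

theorem need (h : RawCp c r) (hv : Cp c (fun _ => 0) v) (hv' : PB c v) :
    Cp c (fun _ => 0) fun i => (r i).need (v i) := by
  have hd : PB c fun i => (r i).deg (v i) := h.hn.mono fun i => (r i).deg_le _
  refine Cp.sumRange (h.deg hv hv') hd (Cp.bite (Cp.ltb
    (Cp.bsmul h.M.var Cp.var_a h.raw.snd.snd.snd.fst.snd.var h.hM.var hd.lt_a)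
    (Cp.bsmul h.M.var (h.deg hv hv').var h.raw.snd.snd.snd.fst.fst.var h.hM.var hd.var) ?_)
    (Cp.natConst 1) Cp.zero) (PB.ite (PB.const 1) (PB.const 0) _)
  simpa using h.hM.var

theorem hdefic (h : RawCp c r) : PB c fun i => (r i).defic (v i) := h.hn.mono fun i => (r i).defic_le _

theorem defic (h : RawCp c r) (hv : Cp c (fun _ => 0) v) (hv' : PB c v) :
    Cp c (fun _ => 0) fun i => (r i).defic (v i) :=
  Cp.natSub (h.need hv hv') (h.blue hv hv') (h.hn.mono fun i => (r i).blue_le _)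

theorem parCp (h : RawCp c r) : ParCp c fun i => (r i).par where
  n := h.n
  m := h.raw.snd.snd.snd.snd.snd.length h.hm
  M := h.M
  B := h.B
  A := h.raw.fst
  red := h.raw.snd.fst
  d := Cp.tabulate h.n h.hn (h.var.defic Cp.var_a h.hn.lt_a)
  cf := Cp.tabulate h.n h.hn (Cp.coeffs h.M.var h.n.var (h.var.defic Cp.var_a h.hn.lt_a) h.hM.var
    h.hn.var h.var.hdefic)
  T := h.raw.snd.snd.snd.snd.fst
  bags := h.raw.snd.snd.snd.snd.snd
  hn := h.hn
  hm := h.hm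
  hM := h.hM
  hB := h.hB
  hd i v := by
    rw [Raw.par_d]
    split
    · exact (r i).defic_le v
    · exact Nat.zero_le _
  hcf i v a := by
    rw [Raw.par_cf]
    split
    · exact Raw.length_getD_le (Raw.coeffs_ok _ _ _) a
    · simp

theorem budget (h : RawCp c r) : Cp c (fun _ => 0) fun i => (r i).budget := by
  refine Cp.sumRange h.X h.hX (Cp.bite (Cp.ltb
    (Cp.bsmul h.M.var Cp.var_a (Cp.btrue.cons Cp.nil) h.hM.var h.hX.lt_a)
    (Cp.bnorm h.M.var h.raw.snd.snd.fst.var h.hM.var) ?_)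
    (Cp.natConst 1) Cp.zero) (PB.ite (PB.const 1) (PB.const 0) _)
  simpa using h.hM.var

theorem answer (h : RawCp c r) (K : I → ℕ) (hK : PW c W K)
    (hok : ∀ i l, (r i).par.keyCount ((r i).par.bags.getD l []) ≤ K i) :
    Cp c W fun i => (r i).answer := by
  have h1 : PB c fun i => (r i).budget + 1 := (h.hX.mono fun i => (r i).budget_le).add (PB.const 1)
  have h2 := h.hB.mul h1
  have h3 : Cp c W fun i => ∑ k ∈ Finset.range ((r i).B * ((r i).budget + 1)),
      if bit (r i).par.total k then 1 else 0 :=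
    Cp.letIn (f := fun i => (r i).par.total) (g := fun i t =>
      ∑ k ∈ Finset.range ((r i).B * ((r i).budget + 1)), if bit t k then 1 else 0)
      (Cp.total h.parCp K hK hok)
      (Cp.sumRange (Cp.natMul h.B.up.var h.budget.up.var.succ h.hB.var h1.var) h2.var
        (Cp.bite (Cp.bit (Cp.var_a (W := fun j => W j.i)).var Cp.var_a h2.var.lt_a) (Cp.natConst 1) Cp.zero)
        (PB.ite (PB.const 1) (PB.const 0) _))
  refine h3.isZero.bnot.of_eq fun i => ?_
  rw [Raw.answer, ← decide_not]
  exact decide_eq_decide.2 Nat.pos_iff_ne_zero.symm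

end RawCp

end Preprocessing

/-! ## Correctness -/

/-- The value of a bit string modulo `2 ^ w`. -/
def mv (w : ℕ) (l : List Bool) : ZMod (2 ^ w) := (bv l : ℕ)

theorem mv_eq_of_modEq {w : ℕ} {l : List Bool} {k : ℕ} (h : bv l ≡ k [MOD 2 ^ w]) :
    mv w l = (k : ZMod (2 ^ w)) := (ZMod.natCast_eq_natCast_iff _ _ _).2 h

theorem mv_badd {w : ℕ} {x : List Bool} (h : x.length = w) (y : List Bool) :
    mv w (badd x y) = mv w x + mv w y := by
  rw [mv_eq_of_modEq (h ▸ bv_badd x y), Nat.cast_add, mv, mv]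

theorem mv_bmul {w : ℕ} {x : List Bool} (h : x.length = w) (y : List Bool) :
    mv w (bmul x y) = mv w x * mv w y := by
  rw [mv_eq_of_modEq (h ▸ bv_bmul x y), Nat.cast_mul, mv, mv]

theorem mv_bnorm (w : ℕ) (y : List Bool) : mv w (bnorm w y) = mv w y :=
  mv_eq_of_modEq (bv_bnorm w y)

@[simp] theorem mv_nil (w : ℕ) : mv w [] = 0 := by simp [mv, bv]

@[simp] theorem mv_bone (w : ℕ) : mv w (bone w) = 1 := by rw [bone, mv_bnorm]; simp [mv, bv]

@[simp] theorem length_bone (w : ℕ) : (bone w).length = w := by simp [bone]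

@[simp] theorem mv_pow2 (w e : ℕ) : mv w (pow2 e) = 2 ^ e := by
  simp [mv, pow2, bv_replicate_append, bv]

theorem lk_nil (q : List Bool) : lk .nil q = .nil := by
  induction q with
  | nil => rfl
  | cons a q ih => cases a <;> exact ih

theorem Key.at_ofFn {n : ℕ} (z : Fin n → Bool × ℕ) (v : Fin n) : Key.at (List.ofFn z) v = z v := by
  rw [Key.at, List.getD_eq_getElem _ _ (by simp)]
  simp

theorem Key.ofFn_at {n : ℕ} {x : Key} (h : x.length = n) : List.ofFn (fun v : Fin n => x.at v) = x := by
  subst h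
  refine List.ext_getElem (by simp) fun i h1 h2 => ?_
  simp [Key.at]

theorem replicate_true_prefix {a b : ℕ} {l l' : List Bool}
    (h : List.replicate a true ++ false :: l <+: List.replicate b true ++ false :: l') :
    a = b ∧ l <+: l' := by
  induction a generalizing b with
  | zero =>
    cases b with
    | zero => simpa using h
    | succ b => simp [List.replicate_succ] at h
  | succ a ih =>
    cases b with
    | zero => simp [List.replicate_succ] at h
    | succ b =>
      simp only [List.replicate_succ, List.cons_append, List.cons_prefix_cons, true_and] at h
      have := ih h
      exact ⟨by omega, this.2⟩

/-- Each state is written in a prefix-free code (a bit, then a unary number closed by `false`),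
hence so are keys of equal length. Distinct keys therefore occupy disjoint places in a search tree.
-/
theorem Key.eq_of_path_prefix {x y : Key} (h : x.length = y.length) (hp : x.path <+: y.path) : x = y := by
  induction x generalizing y with
  | nil => exact (List.length_eq_zero_iff.1 h.symm).symm
  | cons q x ih =>
    obtain _ | ⟨q', y⟩ := y
    · simp at h
    · simp only [Key.path, List.flatMap_cons, List.cons_append, List.append_assoc, List.nil_append,
        List.cons_prefix_cons] at hp
      obtain ⟨h1, h2⟩ := hp
      obtain ⟨h3, h4⟩ := replicate_true_prefix h2
      rw [ih (by simpa using h) h4, Prod.ext h1 h3]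

/-! ### The lists and search trees of the algorithm represent tables and messages -/

namespace Par

/-- `p` describes the digraph `adj`, with red vertices `red`, deficiencies `d`, and the tree `T` with bags `bag`. -/
structure Spec (p : Par) {n m : ℕ} (adj : Fin n → Fin n → Bool) (red : Fin n → Bool) (d : Fin n → ℕ)
    (T : SimpleGraph (Fin m)) (bag : Fin m → Finset (Fin n)) : Prop where
  hn : p.n = n
  hm : p.m = m
  A : ∀ v u : Fin n, bit₂ p.A v u = adj v u
  red : ∀ v : Fin n, bit p.red v = red v
  d : ∀ v : Fin n, p.d.getD v 0 = d v
  T : ∀ i j : Fin m, bit₂ p.T i j = true ↔ T.Adj i j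
  bags : ∀ (i : Fin m) (v : Fin n), bit (p.bags.getD i []) v = true ↔ v ∈ bag i
  bags_m : p.bags.getD m [] = []

variable {p : Par} {n m : ℕ} {adj : Fin n → Fin n → Bool} {red : Fin n → Bool} {d : Fin n → ℕ}
variable {T : SimpleGraph (Fin m)} {bag : Fin m → Finset (Fin n)}

/-- `b` is the characteristic bit string of `s`. -/
def Chars (b : List Bool) (s : Finset (Fin n)) : Prop := ∀ v : Fin n, bit b v = true ↔ v ∈ s

theorem chars_nil : Chars [] (∅ : Finset (Fin n)) := fun v => by simp [bit]

theorem mem_choices (h : p.Spec adj red d T bag) {b : List Bool} {s : Finset (Fin n)} (hb : Chars b s)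
    (v : Fin n) (q : Bool × ℕ) :
    q ∈ p.choices b v ↔ if v ∈ s then q ∈ dom red d v else q = (false, 0) := by
  rw [choices]
  by_cases hv : v ∈ s
  · rw [if_pos ((hb v).2 hv), if_pos hv, digits, h.d, h.red, dom]
    obtain ⟨q1, q2⟩ := q
    cases red v <;> cases q1 <;> simp
  · rw [if_neg fun h => hv ((hb v).1 h), if_neg hv, List.mem_singleton]

theorem nodup_choices (b : List Bool) (v : ℕ) : (p.choices b v).Nodup := by
  rw [choices]
  split
  · rw [digits, List.nodup_flatMap]
    refine ⟨fun a _ => by split <;> simp, ?_⟩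
    refine List.nodup_range.imp fun {a a'} hne => ?_
    rw [Function.onFun, List.disjoint_left]
    intro q hq hq'
    have h1 : q.2 = a := by split at hq <;> simp at hq <;> aesop
    have h2 : q.2 = a' := by split at hq' <;> simp at hq' <;> aesop
    exact hne (h1.symm.trans h2)
  · simp

theorem nodup_keysBelow (b : List Bool) (k : ℕ) : (p.keysBelow b k).Nodup := by
  induction k with
  | zero => simp [keysBelow]
  | succ k ih =>
    rw [keysBelow_succ, List.nodup_flatMap]
    refine ⟨fun x _ => (p.nodup_choices b k).map fun q q' hq => by simpa using hq, ?_⟩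
    refine ih.imp fun {x x'} hne => ?_
    rw [Function.onFun, List.disjoint_left]
    intro y hy hy'
    obtain ⟨q, _, rfl⟩ := List.mem_map.1 hy
    obtain ⟨q', _, hq'⟩ := List.mem_map.1 hy'
    exact hne (List.append_inj_left' hq' rfl).symm

theorem mem_keysBelow (b : List Bool) (k : ℕ) (x : Key) :
    x ∈ p.keysBelow b k ↔ x.length = k ∧ ∀ v < k, x.at v ∈ p.choices b v := by
  induction k generalizing x with
  | zero => simp [keysBelow]
  | succ k ih =>
    simp only [keysBelow_succ, List.mem_flatMap, List.mem_map, ih]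
    constructor
    · rintro ⟨y, ⟨hy, hy'⟩, q, hq, rfl⟩
      refine ⟨by simp [hy], fun v hv => ?_⟩
      rcases Nat.lt_succ_iff_lt_or_eq.1 hv with hv | rfl
      · have : Key.at (y ++ [q]) v = Key.at y v := by
          rw [Key.at, Key.at, List.getD_append _ _ _ _ (by omega)]
        rw [this]
        exact hy' v hv
      · have : Key.at (y ++ [q]) v = q := by
          rw [Key.at, List.getD_append_right _ _ _ _ (by omega)]
          simp [hy]
        rwa [this]
    · rintro ⟨hx, hx'⟩
      refine ⟨x.take k, ⟨by simp [hx], fun v hv => ?_⟩, x.at k, hx' k (by omega), ?_⟩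
      · have : Key.at (x.take k) v = x.at v := by
          simp [Key.at, List.getD_eq_getElem?_getD, hv]
        rw [this]
        exact hx' v (by omega)
      · rw [Key.at, List.getD_eq_getElem _ _ (by omega)]
        conv_rhs => rw [← List.take_append_drop k x, List.drop_eq_getElem_cons (by omega),
          List.drop_eq_nil_of_le (by omega)]

/-- The enumeration lists each assignment of the bag exactly once, so loops over tables are sums
over assignments. -/
theorem sum_keys (h : p.Spec adj red d T bag) {R : Type*} [AddCommMonoid R] {b : List Bool}
    {s : Finset (Fin n)} (hb : Chars b s) (g : Key → R) :
    ((p.keysBelow b p.n).map g).sum = ∑ z ∈ asg (dom red d) (false, 0) s, g (List.ofFn z) := by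
  rw [← List.sum_toFinset _ (p.nodup_keysBelow b p.n)]
  refine Finset.sum_bij' (fun x _ => fun v : Fin n => x.at v) (fun z _ => List.ofFn z) ?_ ?_ ?_ ?_ ?_
  · intro x hx
    rw [List.mem_toFinset, mem_keysBelow] at hx
    rw [mem_asg]
    exact fun v => (mem_choices h hb v _).1 (hx.2 v (by rw [h.hn]; exact v.2))
  · intro z hz
    rw [List.mem_toFinset, mem_keysBelow]
    refine ⟨by simp [h.hn], fun v hv => ?_⟩
    rw [h.hn] at hv
    have := (mem_choices h hb ⟨v, hv⟩ _).2 (mem_asg.1 hz ⟨v, hv⟩)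
    rwa [← Key.at_ofFn z ⟨v, hv⟩] at this
  · intro x hx
    rw [List.mem_toFinset, mem_keysBelow, h.hn] at hx
    exact Key.ofFn_at hx.1
  · intro z _
    funext v
    exact Key.at_ofFn z v
  · intro x hx
    rw [List.mem_toFinset, mem_keysBelow, h.hn] at hx
    rw [Key.ofFn_at hx.1]

theorem restrict_ofFn (h : p.Spec adj red d T bag) {b : List Bool} {s : Finset (Fin n)}
    (hb : Chars b s) (z : Fin n → Bool × ℕ) :
    p.restrict b (List.ofFn z) = List.ofFn (mask (false, 0) s z) := by
  refine List.ext_getElem (by simp [h.hn]) fun i h1 h2 => ?_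
  have hi : i < n := by simpa using h2
  have hz := Key.at_ofFn z ⟨i, hi⟩
  dsimp only at hz
  simp only [restrict, List.getElem_map, List.getElem_range, hz, List.getElem_ofFn, mask]
  by_cases hv : (⟨i, hi⟩ : Fin n) ∈ s
  · rw [if_pos ((hb ⟨i, hi⟩).2 hv), if_pos hv]
  · rw [if_neg fun h => hv ((hb ⟨i, hi⟩).1 h), if_neg hv]

/-- The coefficients of the weights. -/
def co (p : Par) (v : Fin n) (a : ℕ) : ZMod (2 ^ p.M) := mv p.M ((p.cf.getD v []).getD a [])

/-- The factor of a vertex. -/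
def vf (p : Par) (v : Fin n) (q : Bool × ℕ) : ZMod (2 ^ p.M) := p.co v q.2 * if q.1 then 2 ^ p.B else 1

/-- The factor of a pair of vertices. -/
def ef (p : Par) (adj : Fin n → Fin n → Bool) (v u : Fin n) (q q' : Bool × ℕ) : ZMod (2 ^ p.M) :=
  if adj v u && q'.1 then 2 ^ q.2 else 1

theorem mv_wCo (h : p.Spec adj red d T bag) {b b' : List Bool} {s s' : Finset (Fin n)}
    (hb : Chars b s) (hb' : Chars b' s') (z : Fin n → Bool × ℕ) :
    mv p.M (p.wCo b b' (List.ofFn z)) = ∏ v, if v ∈ s ∧ v ∉ s' then p.co v (z v).2 else 1 := by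
  have key : ∀ k, ((List.range k).foldl (fun acc v => if bit b v && !bit b' v then
        bmul acc ((p.cf.getD v []).getD (Key.at (List.ofFn z) v).2 []) else acc) (bone p.M)).length = p.M ∧
      mv p.M ((List.range k).foldl (fun acc v => if bit b v && !bit b' v then
        bmul acc ((p.cf.getD v []).getD (Key.at (List.ofFn z) v).2 []) else acc) (bone p.M)) =
      ∏ v ∈ Finset.range k, if bit b v && !bit b' v then
        mv p.M ((p.cf.getD v []).getD (Key.at (List.ofFn z) v).2 []) else 1 := by
    intro k
    induction k with
    | zero => simp
    | succ k ih =>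
      rw [List.range_succ, List.foldl_append, Finset.prod_range_succ, ← ih.2, List.foldl_cons,
        List.foldl_nil]
      split
      · exact ⟨by rw [length_bmul, ih.1], mv_bmul ih.1 _⟩
      · exact ⟨ih.1, (mul_one _).symm⟩
  rw [wCo, h.hn, (key n).2, Finset.prod_range]
  refine Finset.prod_congr rfl fun v _ => ?_
  rw [Key.at_ofFn]
  simp only [Bool.and_eq_true, Bool.not_eq_true', ← Bool.not_eq_true, hb v, hb' v, co]

theorem pow_wExp (h : p.Spec adj red d T bag) {b b' : List Bool} {s s' : Finset (Fin n)}
    (hb : Chars b s) (hb' : Chars b' s') (z : Fin n → Bool × ℕ) :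
    (2 ^ p.wExp b b' (List.ofFn z) : ZMod (2 ^ p.M)) =
      (∏ v, if v ∈ s ∧ v ∉ s' then if (z v).1 then 2 ^ p.B else 1 else 1) *
      ∏ v, ∏ u, if (v ∈ s ∧ u ∈ s) ∧ ¬ (v ∈ s' ∧ u ∈ s') then ef p adj v u (z v) (z u) else 1 := by
  rw [wExp, h.hn, ← Finset.prod_pow_eq_pow_sum, Finset.prod_range, ← Finset.prod_mul_distrib]
  refine Finset.prod_congr rfl fun v _ => ?_
  rw [pow_add, ← Finset.prod_pow_eq_pow_sum, Finset.prod_range]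
  simp only [Key.at_ofFn, h.A]
  congr 1
  · by_cases h1 : v ∈ s <;> by_cases h2 : v ∈ s' <;> by_cases h3 : (z v).1 = true <;>
      simp [h1, h2, h3, (hb v).2, (hb' v).2, ← Bool.not_eq_true, hb v, hb' v]
  · refine Finset.prod_congr rfl fun u _ => ?_
    have e1 : (bit b v && bit b u) = decide (v ∈ s ∧ u ∈ s) := by
      rw [Bool.eq_iff_iff]; simp [hb v, hb u]
    have e2 : (bit b' v && bit b' u) = decide (v ∈ s' ∧ u ∈ s') := by
      rw [Bool.eq_iff_iff]; simp [hb' v, hb' u]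
    rw [e1, e2, ef]
    by_cases h1 : v ∈ s ∧ u ∈ s <;> by_cases h2 : v ∈ s' ∧ u ∈ s' <;>
      by_cases h3 : (adj v u && (z u).1) = true <;>
      simp only [h1, h2, h3, decide_true, decide_false, Bool.and_true, Bool.and_false, Bool.not_true,
        Bool.not_false, not_true_eq_false, not_false_eq_true, and_true, and_false, if_true, if_false,
        Bool.false_eq_true, pow_zero]

theorem mv_weight (h : p.Spec adj red d T bag) {b b' : List Bool} {s s' : Finset (Fin n)}
    (hb : Chars b s) (hb' : Chars b' s') (z : Fin n → Bool × ℕ) :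
    mv p.M (p.weight b b' (List.ofFn z)) = leafWeight p.vf (p.ef adj) s s' z := by
  rw [weight, mv_bmul (by simp), mv_wCo h hb hb', mv_pow2, pow_wExp h hb hb', ← mul_assoc,
    ← Finset.prod_mul_distrib, leafWeight]
  congr 1
  refine Finset.prod_congr rfl fun v _ => ?_
  rw [vf]
  split
  · rfl
  · rw [one_mul]

/-- `tab` is the table of `F` for the bag `b`. -/
def IsTable (p : Par) (b : List Bool) (F : (Fin n → Bool × ℕ) → ZMod (2 ^ p.M)) (tab : Table) : Prop :=
  ∃ N : Key → List Bool, tab = (p.keysBelow b p.n).map (fun x => (x, N x)) ∧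
    (∀ x, (N x).length = p.M) ∧ ∀ z, mv p.M (N (List.ofFn z)) = F z

theorem isTable_table₀ (b : List Bool) : IsTable (n := n) p b (fun _ => 1) (p.table₀ b) :=
  ⟨fun _ => bone p.M, rfl, fun _ => by simp, fun _ => by simp⟩

/-- An update at one key leaves all other keys untouched, since their paths are not prefixes of each
other. So the slot at q accumulates exactly the entries that restrict to q. -/
theorem mv_msgOf_aux (b b' : List Bool) (tab : Table) (htab : ∀ e ∈ tab, e.2.length = p.M) {q : Key}
    (hq : q.length = p.n) (tr : BinData) :
    mv p.M (lk (tab.foldl (fun tr e => upd tr (p.restrict b' e.1).path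
      (enc (badd (bmul e.2 (p.weight b b' e.1)) (lk tr (p.restrict b' e.1).path).bits))) tr) q.path).bits =
    mv p.M (lk tr q.path).bits + (tab.map fun e => if p.restrict b' e.1 = q then
      mv p.M e.2 * mv p.M (p.weight b b' e.1) else 0).sum := by
  induction tab generalizing tr with
  | nil => simp
  | cons e tab ih =>
    have he := htab e (by simp)
    rw [List.foldl_cons, ih (fun e he => htab e (by simp [he])), List.map_cons, List.sum_cons,
      ← add_assoc]
    congr 1
    by_cases hr : p.restrict b' e.1 = q
    · rw [if_pos hr, hr, lk_upd_self, BinData.bits_enc, mv_badd (by simpa using he), mv_bmul he,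
        add_comm]
    · rw [if_neg hr, add_zero, lk_upd_of_not_prefix]
      · exact fun hp => hr (Key.eq_of_path_prefix (by simp [hq]) hp)
      · exact fun hp => hr (Key.eq_of_path_prefix (by simp [hq]) hp).symm

theorem mv_msgOf (h : p.Spec adj red d T bag) {b b' : List Bool} {s s' : Finset (Fin n)}
    (hb : Chars b s) (hb' : Chars b' s') {F : (Fin n → Bool × ℕ) → ZMod (2 ^ p.M)} {tab : Table}
    (htab : IsTable p b F tab) (y : Fin n → Bool × ℕ) :
    mv p.M (lk (p.msgOf b b' tab) (Key.path (List.ofFn y))).bits =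
      message (dom red d) (false, 0) p.vf (p.ef adj) s s' F y := by
  obtain ⟨N, rfl, hN, hF⟩ := htab
  rw [msgOf, mv_msgOf_aux b b' _ (by simp [hN]) (by simp [h.hn])]
  -- An absent slot reads as the empty bit string, that is, as zero.
  have h0 : (lk .nil (Key.path (List.ofFn y))).bits = [] := by
    rw [lk_nil]
    rfl
  rw [h0, mv_nil, zero_add, List.map_map, sum_keys h hb, message, Finset.sum_filter]
  refine Finset.sum_congr rfl fun z _ => ?_
  simp only [Function.comp_apply, restrict_ofFn h hb', hF, mv_weight h hb hb', List.ofFn_inj]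

theorem isTable_updTable (h : p.Spec adj red d T bag) {b b' : List Bool} {s : Finset (Fin n)}
    (hb : Chars b s) {F : (Fin n → Bool × ℕ) → ZMod (2 ^ p.M)} {tab : Table}
    (htab : IsTable p b' F tab) {msg : BinData} {G : (Fin n → Bool × ℕ) → ZMod (2 ^ p.M)}
    (hG : ∀ y, mv p.M (lk msg (Key.path (List.ofFn y))).bits = G y) :
    IsTable p b' (fun y => F y * G (mask (false, 0) s y)) (p.updTable b msg tab) := by
  obtain ⟨N, rfl, hN, hF⟩ := htab
  refine ⟨fun x => bmul (N x) (bnorm p.M (lk msg (p.restrict b x).path).bits), ?_, ?_, ?_⟩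
  · simp [updTable]
  · simp [hN]
  · intro z
    rw [mv_bmul (hN _), mv_bnorm, restrict_ofFn h hb, hF, hG]

end Par

theorem foldl_select (q : ℕ → Bool) (m k : ℕ) :
    ((List.range k).foldl (fun acc i => if q i then i else acc) m = m ∧ ∀ i < k, q i = false) ∨
    ((List.range k).foldl (fun acc i => if q i then i else acc) m < k ∧
      q ((List.range k).foldl (fun acc i => if q i then i else acc) m) = true) := by
  induction k with
  | zero => simp
  | succ k ih =>
    rw [List.range_succ, List.foldl_append, List.foldl_cons, List.foldl_nil]
    by_cases hk : q k = true
    · rw [if_pos hk]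
      exact Or.inr ⟨k.lt_succ_self, hk⟩
    · rw [if_neg hk]
      rcases ih with ih | ih
      · exact Or.inl ⟨ih.1, fun i hi => (Nat.lt_succ_iff_lt_or_eq.1 hi).elim (ih.2 i)
          fun h => h ▸ Bool.eq_false_iff.2 hk⟩
      · exact Or.inr ⟨ih.1.trans k.lt_succ_self, ih.2⟩

/-! ### Correctness of the elimination loop -/

namespace Par

variable {p : Par} {n m : ℕ} {adj : Fin n → Fin n → Bool} {red : Fin n → Bool} {d : Fin n → ℕ}
variable {T : SimpleGraph (Fin m)} {bag : Fin m → Finset (Fin n)} {A : Finset (Fin m)}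
variable {alive : List Bool}

theorem nbrs_le_one_iff (h : p.Spec adj red d T bag) (ha : Chars alive A) (i : Fin m) :
    p.nbrs alive i ≤ 1 ↔ ∀ j ∈ A, ∀ j' ∈ A, T.Adj i j → T.Adj i j' → j = j' := by
  classical
  have : p.nbrs alive i = (A.filter fun j => T.Adj i j).card := by
    rw [nbrs, h.hm, Finset.sum_range, ← Finset.sum_filter, Finset.sum_const, smul_eq_mul, mul_one]
    congr 1
    ext j
    simp only [Finset.mem_filter, Finset.mem_univ, true_and, Bool.and_eq_true, ha j, h.T i j]
  rw [this, Finset.card_le_one]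
  simp only [Finset.mem_filter]
  exact ⟨fun H j hj j' hj' h h' => H j ⟨hj, h⟩ j' ⟨hj', h'⟩, fun H j hj j' hj' => H j hj.1 j' hj'.1 hj.2 hj'.2⟩

theorem exists_leaf_eq (h : p.Spec adj red d T bag) (hT : T.IsTree) (ha : Chars alive A)
    (hA : A.Nonempty) : ∃ i ∈ A, p.leaf alive = i ∧
      ∀ j ∈ A, ∀ j' ∈ A, T.Adj i j → T.Adj i j' → j = j' := by
  rcases foldl_select (fun i => bit alive i && decide (p.nbrs alive i ≤ 1)) p.m p.m with hl | hl
  · obtain ⟨i, hi, hleaf⟩ := hT.exists_leaf A hA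
    have h1 := hl.2 i (by rw [h.hm]; exact i.2)
    rw [(ha i).2 hi, Bool.true_and, decide_eq_false_iff_not, nbrs_le_one_iff h ha] at h1
    exact absurd hleaf h1
  · rw [← leaf] at hl
    obtain ⟨i, hi⟩ : ∃ i : Fin m, p.leaf alive = i := ⟨⟨p.leaf alive, h.hm ▸ hl.1⟩, rfl⟩
    rw [hi, Bool.and_eq_true, decide_eq_true_iff, nbrs_le_one_iff h ha] at hl
    exact ⟨i, (ha i).1 hl.2.1, hi, hl.2.2⟩

theorem nbr_cases (h : p.Spec adj red d T bag) (ha : Chars alive A) (i : Fin m) :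
    (∃ j ∈ A, p.nbr alive i = j ∧ T.Adj i j) ∨ (p.nbr alive i = m ∧ ∀ j ∈ A, ¬ T.Adj i j) := by
  rcases foldl_select (fun j => bit alive j && bit₂ p.T i j) p.m p.m with hl | hl
  · refine Or.inr ⟨hl.1.trans h.hm, fun j hj hij => ?_⟩
    have := hl.2 j (by rw [h.hm]; exact j.2)
    rw [(ha j).2 hj, (h.T i j).2 hij] at this
    cases this
  · rw [← nbr] at hl
    obtain ⟨j, hj⟩ : ∃ j : Fin m, p.nbr alive i = j := ⟨⟨p.nbr alive i, h.hm ▸ hl.1⟩, rfl⟩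
    rw [hj, Bool.and_eq_true, h.T] at hl
    exact Or.inl ⟨j, (ha j).1 hl.2.1, hj, hl.2.2⟩

/-- The state `st` has remaining nodes `A` and partition function `Z`. -/
structure Inv (p : Par) (adj : Fin n → Fin n → Bool) (red : Fin n → Bool) (d : Fin n → ℕ)
    (T : SimpleGraph (Fin m)) (bag : Fin m → Finset (Fin n)) (Z : ZMod (2 ^ p.M)) (st : State)
    (A : Finset (Fin m)) : Prop where
  alive : Chars st.1 A
  rem : Remaining T bag (p.ef adj) A
  tables : ∃ F : Fin m → (Fin n → Bool × ℕ) → ZMod (2 ^ p.M),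
    (∀ l ∈ A, IsTable p (p.bags.getD l []) (F l) (st.2.1.getD l [])) ∧
    partition (dom red d) (false, 0) p.vf (p.ef adj) bag A F = Z

variable {Z : ZMod (2 ^ p.M)} {st : State}

/-- The chosen node has at most one remaining neighbour. With one, the partition function passes to
the smaller set of nodes; with none, the node is the last one and its message is the whole partition
function. -/
theorem Inv.step (h : p.Spec adj red d T bag) (hT : T.IsTree) (hI : Inv p adj red d T bag Z st A)
    (hA : A.Nonempty) : (1 < A.card ∧ ∃ i ∈ A, Inv p adj red d T bag Z (p.step st) (A.erase i)) ∨
      (A.card = 1 ∧ mv p.M (lk (p.step st).2.2 (Key.path (List.ofFn fun _ : Fin n => (false, 0)))).bits = Z) := by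
  obtain ⟨ha, hrem, F, hF, hZ⟩ := hI
  obtain ⟨i, hi, hil, hleaf⟩ := exists_leaf_eq h hT ha hA
  have hb (l : Fin m) : Chars (p.bags.getD l []) (bag l) := h.bags l
  rcases nbr_cases h ha i with ⟨j, hj, hjn, hij⟩ | ⟨hn, hno⟩
  · left
    have hmsg := mv_msgOf h (hb i) (hb j) (hF i hi)
    refine ⟨Finset.one_lt_card.2 ⟨i, hi, j, hj, hij.ne⟩, i, hi, ?_, hrem.erase hi hleaf, fun l => if l = j then
      fun y => F j y * message (dom red d) (false, 0) p.vf (p.ef adj) (bag i) (bag j) (F i)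
        (mask (false, 0) (bag i) y) else F l, ?_, ?_⟩
    · intro l
      rw [Par.step, hil, hjn, elim, bit, getD_map_range, if_pos (by rw [h.hm]; exact l.2), Finset.mem_erase]
      by_cases hl : l = i
      · simp [hl]
      · rw [if_neg fun e => hl (Fin.ext e), ha l]
        simp [hl]
    · intro l hl
      rw [Par.step, hil, hjn, elim]
      have hlm : (l : ℕ) < p.m := by rw [h.hm]; exact l.2
      simp only [getD_map_range, hlm, if_true]
      by_cases hlj : l = j
      · subst hlj
        rw [if_pos rfl, if_pos rfl]
        exact isTable_updTable h (hb i) (hF l hj) hmsg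
      · rw [if_neg fun e => hlj (Fin.ext e), if_neg hlj]
        exact hF l (Finset.mem_of_mem_erase hl)
    · rw [← hZ]
      refine hrem.partition_leaf hi hj hij (fun j' hj' hij' => hleaf j' hj' j hj hij' hij) F _ ?_ ?_
      · intro l _ _ hlj y _
        rw [if_neg hlj]
      · intro y _
        rw [if_pos rfl]
  · right
    obtain ⟨hA1, hlast⟩ := hrem.partition_last (D := dom red d) (q₀ := (false, 0)) (φ := p.vf) hi hno F
    refine ⟨by rw [hA1, Finset.card_singleton], ?_⟩
    -- Without a neighbour, the search returns the out-of-range index m, whose default bag is empty,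
    -- so the message sums over everything.
    have hbm : Chars (p.bags.getD m []) (∅ : Finset (Fin n)) := by rw [h.bags_m]; exact chars_nil
    rw [Par.step, hil, hn, elim, nextMsg]
    dsimp only
    rw [mv_msgOf h (hb i) hbm (hF i hi), hlast, hZ]

theorem inv_state₀ (h : p.Spec adj red d T bag) (hT : T.IsTree)
    (hbag : ∀ v, (T.induce {l | v ∈ bag l}).Connected)
    (hadj : ∀ v u, adj v u = true → ∃ l, v ∈ bag l ∧ u ∈ bag l) :
    Inv p adj red d T bag (∑ x ∈ Fintype.piFinset (dom red d), asgWeight adj p.B p.co x) p.state₀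
      Finset.univ where
  alive l := by simp [state₀, bit, h.hm]
  rem := Remaining.of_isTree hT hbag fun v u ⟨q, q', hne⟩ => hadj v u (by
    by_contra hf
    exact hne (by simp [ef, hf]))
  tables := by
    refine ⟨fun _ _ => 1, fun l _ => ?_, ?_⟩
    · rw [state₀]
      dsimp only
      rw [getD_map_range, if_pos (by rw [h.hm]; exact l.2)]
      exact isTable_table₀ _
    · have hu : Finset.univ.biUnion bag = Finset.univ := by
        refine Finset.eq_univ_of_forall fun v => ?_
        obtain ⟨l, hl⟩ := (hbag v).nonempty
        exact Finset.mem_biUnion.2 ⟨l, Finset.mem_univ l, hl⟩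
      rw [partition, hu]
      refine Finset.sum_congr (by simp [asg]) fun x _ => ?_
      simp [locals, asgWeight, vf, ef]

theorem mv_total (h : p.Spec adj red d T bag) (hT : T.IsTree)
    (hbag : ∀ v, (T.induce {l | v ∈ bag l}).Connected)
    (hadj : ∀ v u, adj v u = true → ∃ l, v ∈ bag l ∧ u ∈ bag l) :
    mv p.M p.total = ∑ x ∈ Fintype.piFinset (dom red d), asgWeight adj p.B p.co x := by
  -- The invariant covers only the first m - 1 steps; the last step leaves no nodes and is treated
  -- separately.
  have key : ∀ k < m, ∃ A : Finset (Fin m), A.card = m - k ∧ Inv p adj red d T bag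
      (∑ x ∈ Fintype.piFinset (dom red d), asgWeight adj p.B p.co x)
      ((List.range k).foldl (fun st _ => p.step st) p.state₀) A := by
    intro k
    induction k with
    | zero => exact fun _ => ⟨Finset.univ, by simp, inv_state₀ h hT hbag hadj⟩
    | succ k ih =>
      intro hk
      obtain ⟨A, hA, hI⟩ := ih (by omega)
      rw [List.range_succ, List.foldl_append, List.foldl_cons, List.foldl_nil]
      rcases hI.step h hT (Finset.card_pos.1 (by omega)) with ⟨_, i, hi, hI'⟩ | ⟨h1, _⟩
      · exact ⟨A.erase i, by rw [Finset.card_erase_of_mem hi]; omega, hI'⟩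
      · omega
  obtain ⟨i⟩ := hT.connected.nonempty
  obtain ⟨k, rfl⟩ : ∃ k, m = k + 1 := ⟨m - 1, by have := i.2; omega⟩
  obtain ⟨A, hA, hI⟩ := key k (by omega)
  have hq : p.restrict [] [] = List.ofFn fun _ : Fin n => ((false, 0) : Bool × ℕ) := by
    refine List.ext_getElem (by simp [h.hn]) fun i _ _ => ?_
    simp [restrict, bit]
  rw [total, mv_bnorm, hq, h.hm, List.range_succ, List.foldl_append, List.foldl_cons, List.foldl_nil]
  rcases hI.step h hT (Finset.card_pos.1 (by omega)) with ⟨h1, _⟩ | ⟨_, hfin⟩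
  · omega
  · exact hfin

end Par

theorem bv_replicate_true (w : ℕ) : bv (List.replicate w true) + 1 = 2 ^ w := by
  induction w with
  | zero => rfl
  | succ w ih => rw [List.replicate_succ, bv, pow_succ, ← ih]; simp; ring

theorem bv_eq_of_modEq {w k : ℕ} {l : List Bool} (hl : l.length = w) (hk : k < 2 ^ w)
    (h : bv l ≡ k [MOD 2 ^ w]) : bv l = k :=
  Nat.ModEq.eq_of_lt_of_lt h (hl ▸ bv_lt l) hk

theorem sum_ite_lt (N a : ℕ) : (∑ k ∈ Finset.range N, if k < a then 1 else 0) = min a N := by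
  rw [← Finset.sum_filter, Finset.sum_const, smul_eq_mul, mul_one]
  have : (Finset.range N).filter (fun k => k < a) = Finset.range (min a N) := by
    ext k
    simp only [Finset.mem_filter, Finset.mem_range, lt_min_iff]
    tauto
  rw [this, Finset.card_range]

theorem getD_ofFn {δ : Type*} {n : ℕ} (f : Fin n → δ) (v : Fin n) (a : δ) : (List.ofFn f).getD v a = f v := by
  rw [List.getD_eq_getElem _ _ (by simp)]
  simp

/-! ### Coefficients of the weight polynomials modulo a power of two -/

namespace Raw

theorem length_negPow (w j : ℕ) : (negPow w j).length = w := by simp [negPow]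

theorem mv_negPow (w j : ℕ) : mv w (negPow w j) = -2 ^ j := by
  have h : mv w (List.replicate w true) = -1 := by
    have := congrArg (Nat.cast : ℕ → ZMod (2 ^ w)) (bv_replicate_true w)
    rw [ZMod.natCast_self, Nat.cast_add, Nat.cast_one] at this
    exact eq_neg_of_add_eq_zero_left this
  rw [negPow, mv_bmul (by simp), h, mv_pow2, neg_one_mul]

theorem coeffs_succ (w n d : ℕ) : coeffs w n (d + 1) = coStep w n d (coeffs w n d) := by
  rw [coeffs, coeffs, List.range_succ (n := d), List.foldl_append, List.foldl_cons, List.foldl_nil]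

theorem mv_coStep (w n j : ℕ) (c : List (List Bool)) (i : ℕ) (hi : i ≤ n) :
    mv w ((coStep w n j c).getD i []) =
      -2 ^ j * mv w (c.getD i []) + if i = 0 then 0 else mv w (c.getD (i - 1) []) := by
  rw [coStep, Par.getD_map_range, if_pos (by omega), mv_badd (by simp [length_negPow]),
    mv_bmul (length_negPow w j), mv_negPow]
  congr 1
  split <;> simp

/-- The lists hold n + 1 coefficients, so d ≤ n keeps the product from being cut off. Vanishing
above degree d is carried along because it removes the top term in the induction step. -/
theorem mv_coeffs (w n d : ℕ) (hd : d ≤ n) : (∀ i > d, mv w ((coeffs w n d).getD i []) = 0) ∧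
    ∀ y : ZMod (2 ^ w), ∑ a ∈ Finset.range (d + 1), mv w ((coeffs w n d).getD a []) * y ^ a =
      ∏ j ∈ Finset.range d, (y - 2 ^ j) := by
  induction d with
  | zero =>
    have h : ∀ i, mv w ((coeffs w n 0).getD i []) = if i = 0 then 1 else 0 := by
      intro i
      rw [coeffs, List.range_zero, List.foldl_nil, Par.getD_map_range]
      by_cases hi : i = 0
      · simp [hi]
      · by_cases hi' : i < n + 1 <;> simp [hi, hi']
    simp only [h]
    exact ⟨fun i hi => if_neg (by omega), fun y => by simp⟩
  | succ d ih =>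
    obtain ⟨h0, hs⟩ := ih (by omega)
    refine ⟨fun i hi => ?_, fun y => ?_⟩
    · rw [coeffs_succ]
      by_cases hin : i ≤ n
      · rw [mv_coStep _ _ _ _ _ hin, h0 i (by omega), if_neg (by omega), h0 (i - 1) (by omega)]
        simp
      · rw [List.getD_eq_default _ _ (by rw [length_coStep]; omega), mv_nil]
    · rw [Finset.prod_range_succ, ← hs y, coeffs_succ]
      have h1 : ∀ a ∈ Finset.range (d + 1 + 1), mv w ((coStep w n d (coeffs w n d)).getD a []) * y ^ a =
          -2 ^ d * (mv w ((coeffs w n d).getD a []) * y ^ a) +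
            (if a = 0 then 0 else mv w ((coeffs w n d).getD (a - 1) [])) * y ^ a := by
        intro a ha
        rw [mv_coStep _ _ _ _ _ (by rw [Finset.mem_range] at ha; omega)]
        ring
      rw [Finset.sum_congr rfl h1, Finset.sum_add_distrib, ← Finset.mul_sum, Finset.sum_range_succ,
        h0 (d + 1) (by omega), Finset.sum_range_succ' _ (d + 1)]
      simp only [Nat.add_sub_cancel, Nat.succ_ne_zero, if_false, if_true, zero_mul, add_zero, pow_succ]
      simp only [← mul_assoc, ← Finset.sum_mul]
      ring

end Raw

/-! ### The encoded instance and the answer -/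

section Input

variable {n m : ℕ}

open Classical in
/-- The matrix of a relation. -/
noncomputable def relMatrix {k : ℕ} (R : Fin n → Fin k → Prop) : List (List Bool) :=
  List.ofFn fun i => List.ofFn fun j => decide (R i j)

open Classical in
theorem bit₂_relMatrix {k : ℕ} (R : Fin n → Fin k → Prop) (i : Fin n) (j : Fin k) :
    bit₂ (relMatrix R) i j = decide (R i j) := by
  rw [bit₂, relMatrix, getD_ofFn, bit, getD_ofFn]

theorem bit₂_relMatrix_iff {k : ℕ} (R : Fin n → Fin k → Prop) (i : Fin n) (j : Fin k) :
    bit₂ (relMatrix R) i j = true ↔ R i j := by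
  classical
  rw [bit₂_relMatrix]
  exact decide_eq_true_iff

open Classical in
/-- The input as a tuple of lists. -/
noncomputable def PDifr.raw (I : PDifr n) (T : SimpleGraph (Fin m)) (bag : Fin m → Finset (Fin n)) : Raw :=
  (relMatrix I.graph.Adj, List.ofFn fun v => decide (I.color v = VColor.red), I.k.bits,
    (I.p.num.natAbs.bits, I.p.den.bits), relMatrix T.Adj, relMatrix fun i v => v ∈ bag i)

theorem enc_list {α : Type} [Enc α] (l : List α) : enc l = BinData.ofList (l.map enc) := by
  induction l with
  | nil => rfl
  | cons a l ih => rw [List.map_cons, BinData.ofList, ← ih]; rfl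

theorem enc_bits (l : List Bool) : enc l = BinData.ofBits l := by
  rw [enc_list, BinData.ofBits]
  rfl

theorem enc_relMatrix {k : ℕ} (R : Fin n → Fin k → Prop) :
    enc (relMatrix R) = BinData.ofList (List.ofFn fun i => BinData.ofPred (R i)) := by
  rw [enc_list, relMatrix, List.map_ofFn]
  exact congrArg _ (congrArg _ (funext fun i => enc_bits _))

theorem PDifr.enc_raw (I : PDifr n) (T : SimpleGraph (Fin m)) (bag : Fin m → Finset (Fin n)) :
    enc (I.raw T bag) = I.encode T bag := by
  have h : enc (I.raw T bag) = .cons (enc (relMatrix I.graph.Adj)) (.cons (enc (I.raw T bag).2.1)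
      (.cons (enc I.k.bits) (.cons (.cons (enc I.p.num.natAbs.bits) (enc I.p.den.bits))
      (.cons (enc (relMatrix T.Adj)) (enc (relMatrix fun i v => v ∈ bag i)))))) := rfl
  rw [h]
  simp only [enc_relMatrix, enc_bits]
  rfl

variable (I : PDifr n) (T : SimpleGraph (Fin m)) (bag : Fin m → Finset (Fin n))

theorem PDifr.raw_n : (I.raw T bag).n = n := by simp [Raw.n, raw, relMatrix]

theorem PDifr.raw_X : (I.raw T bag).X = n + I.k.size + I.p.num.natAbs.size + I.p.den.size + 1 := by
  simp [Raw.X, raw, relMatrix, Nat.size_eq_bits_len]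

theorem PDifr.lt_pow_raw_M {k : ℕ} (hk : k < 2 ^ (I.raw T bag).X) : k < 2 ^ (I.raw T bag).M :=
  hk.trans_le (Nat.pow_le_pow_right two_pos (Raw.le_M _))

open Classical in
theorem PDifr.raw_deg (v : Fin n) : (I.raw T bag).deg v = outDegree I.graph v := by
  rw [Raw.deg, raw_n, Finset.sum_range, ← Finset.sum_filter, Finset.sum_const, smul_eq_mul, mul_one,
    outDegree, Set.ncard_eq_toFinset_card']
  congr 1
  ext u
  simp only [raw, bit₂_relMatrix]
  simp

open Classical in
theorem PDifr.raw_blue (v : Fin n) : (I.raw T bag).blue v = blueOutDegree I.graph I.color v := by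
  rw [Raw.blue, raw_n, Finset.sum_range, ← Finset.sum_filter, Finset.sum_const, smul_eq_mul, mul_one,
    blueOutDegree_eq]
  congr 1
  ext u
  simp only [raw, bit₂_relMatrix, bit, getD_ofFn]
  cases hu : I.color u <;> simp [hu]

/-- The ceiling of a nonnegative x is the number of naturals below x. Here x is at most the
out-degree because p ≤ 1, so counting below the out-degree suffices; clearing the denominator makes
each comparison one of integers. -/
theorem PDifr.raw_need (v : Fin n) : (I.raw T bag).need v = ⌈I.p * (outDegree I.graph v : ℚ)⌉₊ := by
  set k := outDegree I.graph v with hk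
  have hkn : k ≤ n := by
    rw [hk, ← raw_deg I T bag]
    exact (Raw.deg_le _ _).trans_eq (raw_n I T bag)
  have hX := I.raw_X T bag
  -- These products stay below 2^M, so the modular arithmetic computes them exactly.
  have hb : ∀ a ≤ n, ∀ c, c.size ≤ I.p.num.natAbs.size + I.p.den.size →
      a * c < 2 ^ (I.raw T bag).M := by
    intro a ha c hc
    refine lt_pow_raw_M _ _ _ ?_
    calc a * c < 2 ^ n * 2 ^ c.size :=
          Nat.mul_lt_mul'' (ha.trans_lt Nat.lt_two_pow_self) (Nat.lt_size_self c)
      _ = 2 ^ (n + c.size) := (pow_add _ _ _).symm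
      _ ≤ 2 ^ (I.raw T bag).X := Nat.pow_le_pow_right two_pos (by omega)
  have hs : ∀ a ≤ n, ∀ c : ℕ, c.size ≤ I.p.num.natAbs.size + I.p.den.size →
      bv (bsmul (I.raw T bag).M a c.bits) = a * c := by
    intro a ha c hc
    refine bv_eq_of_modEq (length_bsmul _ _ _) (hb a ha c hc) ?_
    have := bv_bsmul (I.raw T bag).M a c.bits
    rwa [bv_bits] at this
  have key : ∀ a ∈ Finset.range k, (if ltb false (bsmul (I.raw T bag).M a I.p.den.bits)
      (bsmul (I.raw T bag).M k I.p.num.natAbs.bits) = true then 1 else 0) =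
      if a < ⌈I.p * (k : ℚ)⌉₊ then 1 else 0 := by
    intro a ha
    have ha := Finset.mem_range.1 ha
    refine if_congr ?_ rfl rfl
    rw [ltb_iff _ _ _ (by simp), hs a (by omega) _ (by omega), hs k hkn _ (by omega), Nat.lt_ceil]
    have hden : (0 : ℚ) < I.p.den := by exact_mod_cast I.p.den_pos
    have hnum : ((I.p.num.natAbs : ℕ) : ℚ) = I.p * I.p.den := by
      rw [Rat.mul_den_eq_num, Nat.cast_natAbs, abs_of_nonneg (Rat.num_nonneg.2 I.p_nonneg)]
    rw [Bool.toNat_false, add_zero, ← Nat.cast_lt (α := ℚ), Nat.cast_mul, Nat.cast_mul, hnum,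
      show (k : ℚ) * (I.p * I.p.den) = I.p * k * I.p.den by ring, mul_lt_mul_iff_left₀ hden]
  rw [Raw.need, raw_deg, ← hk]
  refine (Finset.sum_congr rfl key).trans ?_
  rw [sum_ite_lt, min_eq_left]
  rw [Nat.ceil_le]
  exact mul_le_of_le_one_left (Nat.cast_nonneg k) I.p_le_one

theorem PDifr.raw_defic (v : Fin n) :
    (I.raw T bag).defic v = (pDeficiency I.p I.graph I.color v).toNat := by
  rw [Raw.defic, raw_need, raw_blue, pDeficiency,
    ← Int.natCast_ceil_eq_ceil (mul_nonneg I.p_nonneg (Nat.cast_nonneg _))]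
  omega

/-- The budget is given in binary and may be exponentially large, whereas the algorithm needs it in
unary. Capping it at X loses nothing, as X exceeds n and no set of vertices has more than n
elements. -/
theorem PDifr.raw_budget : (I.raw T bag).budget = min I.k (I.raw T bag).X := by
  rw [Raw.budget, ← sum_ite_lt]
  refine Finset.sum_congr rfl fun a ha => if_congr ?_ rfl rfl
  have ha := Finset.mem_range.1 ha
  have hX := I.raw_X T bag
  rw [ltb_iff _ _ _ (by simp), bv_eq_of_modEq (length_bsmul _ _ _)
    (I.lt_pow_raw_M T bag (ha.trans Nat.lt_two_pow_self)) (by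
      have := bv_bsmul (I.raw T bag).M a [true]
      simpa [bv] using this), bv_eq_of_modEq (k := I.k) (length_bnorm _ _)
    (I.lt_pow_raw_M T bag ((Nat.lt_size_self _).trans_le (Nat.pow_le_pow_right two_pos (by omega)))) (by
      have := bv_bnorm (I.raw T bag).M I.k.bits
      rwa [bv_bits] at this)]
  simp

open Classical in
theorem PDifr.raw_spec : (I.raw T bag).par.Spec (fun v u => decide (I.graph.Adj v u))
    (fun v => decide (I.color v = VColor.red))
    (fun v => (pDeficiency I.p I.graph I.color v).toNat) T bag where
  hn := I.raw_n T bag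
  hm := by simp [Raw.par, raw, relMatrix]
  A := bit₂_relMatrix _
  red v := getD_ofFn _ v _
  d v := by rw [Raw.par_d, raw_n, if_pos v.2, raw_defic]
  T i j := bit₂_relMatrix_iff _ i j
  bags i v :=
     bit₂_relMatrix_iff (fun (i : Fin m) v => v ∈ bag i) i v
  bags_m := List.getD_eq_default _ _ (by simp [Raw.par, raw, relMatrix])

theorem PDifr.raw_answer_iff (h : IsTreeDecomposition I.graph.toSimpleGraphInclusive T bag) :
    (I.raw T bag).answer = true ↔ I.IsYes := by
  classical
  have hle : ∀ v : Fin n, (pDeficiency I.p I.graph I.color v).toNat ≤ n := fun v => by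
    rw [← raw_defic I T bag]
    exact ((I.raw T bag).defic_le v).trans_eq (I.raw_n T bag)
  have hX := I.raw_X T bag
  have htot := Par.mv_total (I.raw_spec T bag) h.isTree h.connected (fun v u hvu => by
    -- Loops of the digraph are not edges of the underlying simple graph; they are covered because
    -- every vertex lies in some bag.
    by_cases hne : v = u
    · subst hne
      obtain ⟨l, hl⟩ := (h.connected v).nonempty
      exact ⟨l, hl, hl⟩
    · exact h.edge_mem_bag v u ⟨hne, Or.inl (of_decide_eq_true hvu)⟩)
  rw [sum_asgWeight _ _ _ _ _ (fun v y => by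
    have := (Raw.mv_coeffs (I.raw T bag).M n _ (hle v)).2 y
    refine Eq.trans (Finset.sum_congr rfl fun a _ => ?_) this
    rw [Par.co, Raw.par_cf, raw_n, if_pos v.2, raw_defic]
    rfl)] at htot
  have hmod := (ZMod.natCast_eq_natCast_iff _ _ _).1 htot
  rw [Raw.answer, decide_eq_true_iff, raw_budget]
  set k := min I.k (I.raw T bag).X with hk
  have h1 : (0 < ∑ i ∈ Finset.range ((I.raw T bag).B * (k + 1)),
      if bit (I.raw T bag).par.total i then 1 else 0) ↔
      ∃ i < (I.raw T bag).B * (k + 1), (I.raw T bag).par.total.getD i false = true := by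
    rw [Nat.pos_iff_ne_zero, Ne, Finset.sum_eq_zero_iff]
    simp [bit]
  have hB : n + n * (n * n) < (I.raw T bag).B := by
    have h2 : n + 1 ≤ (I.raw T bag).X := by omega
    calc n + n * (n * n) < (n + 1) * (n + 1) * ((n + 1) * (n + 1)) := by nlinarith [sq_nonneg n]
      _ ≤ _ := by rw [Raw.B]; gcongr
  -- Since k ≤ X, the tested power 2^(B(k+1)) divides the modulus 2^M, so knowing the total modulo
  -- 2^M is enough.
  rw [h1, exists_bit_iff, hmod.dvd_iff (pow_dvd_pow 2 (Nat.mul_le_mul_left _ (by omega)))]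
  refine (not_congr (zsum_dvd_iff _ _ _ _ hle hB k)).trans ?_
  rw [not_not, I.isYes_iff]
  refine exists_congr fun S => ?_
  have hS : S.card ≤ n := by simpa using S.card_le_univ
  have : S.card ≤ k ↔ S.card ≤ I.k := by
    rw [hk, le_min_iff]
    exact and_iff_left (by omega)
  simp only [decide_eq_true_iff, this]

end Input

/-! ## The theorem -/

/-- This is where the exponent drops from tw + 1 to tw: each vertex of the bag has at most 2(min D n
+ 1) states, and for one of the tw + 1 factors the bound by n is used instead of the bound by D. -/
theorem Par.keyCount_le {p : Par} {n m : ℕ} {adj : Fin n → Fin n → Bool} {red : Fin n → Bool} {d : Fin n → ℕ}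
    {T : SimpleGraph (Fin m)} {bag : Fin m → Finset (Fin n)} (h : p.Spec adj red d T bag) {b : List Bool}
    {s : Finset (Fin n)} (hb : Chars b s) {D tw : ℕ} (hd : ∀ v, d v ≤ D) (hdn : ∀ v, d v ≤ n)
    (hs : s.card ≤ tw + 1) : p.keyCount b ≤ (2 * (D + 1)) ^ tw * (2 * (n + 1)) := by
  rw [keyCount, length_keysBelow, h.hn, Finset.prod_range]
  calc ∏ v : Fin n, (p.choices b v).length
      ≤ ∏ v : Fin n, if v ∈ s then 2 * (min D n + 1) else 1 := by
        refine Finset.prod_le_prod' fun v _ => ?_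
        split
        · refine (p.length_choices_le b v).trans ?_
          rw [h.d]
          have := hd v
          have := hdn v
          gcongr
          omega
        · rename_i hv
          rw [choices, if_neg fun h => hv ((hb v).1 h), List.length_singleton]
    _ = (2 * (min D n + 1)) ^ s.card := by simp [Finset.prod_ite_mem]
    _ ≤ (2 * (min D n + 1)) ^ (tw + 1) := Nat.pow_le_pow_right (by omega) hs
    _ ≤ _ := by
        rw [pow_succ]
        gcongr <;> omega

/-- Inputs that satisfy the promises. -/
structure Input where
  n : ℕ
  m : ℕ
  I : PDifr n
  T : SimpleGraph (Fin m)
  bag : Fin m → Finset (Fin n)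
  D : ℕ
  tw : ℕ
  dec : IsTreeDecomposition I.graph.toSimpleGraphInclusive T bag
  width : BagWidthLE bag tw
  defic : ∀ v : Fin n, pDeficiency I.p I.graph I.color v ≤ (D : ℤ)

/-- The encoded inputs, with their sizes. -/
noncomputable def inputCtx : Ctx Input where
  s x := x.I.inputSize x.m
  inp x := x.I.encode x.T x.bag

theorem cp_answer : Cp inputCtx (fun x => (2 * (x.D + 1)) ^ x.tw) fun x => (x.I.raw x.T x.bag).answer := by
  have hX : PB inputCtx fun x => (x.I.raw x.T x.bag).X :=
    (PB.size.add (PB.const 1)).mono fun x => by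
      rw [PDifr.raw_X]
      show _ ≤ x.I.inputSize x.m + 1
      rw [PDifr.inputSize]
      omega
  refine RawCp.answer ⟨Cp.inp.congr fun x => (x.I.enc_raw x.T x.bag).symm, hX, ?_⟩
    (fun x => (2 * (x.D + 1)) ^ x.tw * (2 * (x.n + 1))) ?_ fun x l => ?_
  · refine PB.size.mono fun x => ?_
    show _ ≤ x.I.inputSize x.m
    simp only [PDifr.inputSize, PDifr.raw, relMatrix, List.length_ofFn]
    omega
  · refine PW.mul ⟨0, fun x => by simp⟩ (((PB.const 2).mul (hX.add (PB.const 1))).mono fun x => ?_)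
    have := (x.I.raw x.T x.bag).n_le
    rw [PDifr.raw_n] at this
    omega
  · classical
    have h := x.I.raw_spec x.T x.bag
    have hd (v : Fin x.n) : (pDeficiency x.I.p x.I.graph x.I.color v).toNat ≤ x.D := by
      have := x.defic v
      omega
    have hdn (v : Fin x.n) : (pDeficiency x.I.p x.I.graph x.I.color v).toNat ≤ x.n := by
      rw [← x.I.raw_defic x.T x.bag]
      exact ((x.I.raw x.T x.bag).defic_le v).trans_eq (x.I.raw_n x.T x.bag)
    by_cases hl : l < x.m
    · exact Par.keyCount_le h (h.bags ⟨l, hl⟩) hd hdn (x.width _)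
    -- An index outside the decomposition reads the empty bag, which has few keys as well.
    · rw [List.getD_eq_default _ _ (by rw [← h.hm] at hl; exact not_lt.1 hl)]
      exact Par.keyCount_le h Par.chars_nil hd hdn (by simp)

theorem mainTheorem3 :
    ∃ (P : Prog) (C c : ℕ), ∀ (n m : ℕ) (I : PDifr n) (T : SimpleGraph (Fin m))
      (bag : Fin m → Finset (Fin n)) (D tw : ℕ),
      IsTreeDecomposition I.graph.toSimpleGraphInclusive T bag →
      BagWidthLE bag tw →
      (∀ v : Fin n, pDeficiency I.p I.graph I.color v ≤ (D : ℤ)) →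
      ∃ (answer : Bool) (t : ℕ),
        Prog.Run P (I.encode T bag) (BinData.ofBool answer) t ∧
        (answer = true ↔ I.IsYes) ∧
        t ≤ C * (2 * (D + 1)) ^ tw * I.inputSize m ^ c := by
  obtain ⟨P, e, h⟩ := cp_answer
  -- With W = (2(D+1))^tw ≥ 1 and input size N ≥ 1 (the denominator is positive), W + 1 ≤ 2W and N +
  -- 2 ≤ 3N.
  refine ⟨P, 2 * 3 ^ e, e, fun n m I T bag D tw hdec hw hdef => ?_⟩
  obtain ⟨t, ht, hrun⟩ := h ⟨n, m, I, T, bag, D, tw, hdec, hw, hdef⟩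
  refine ⟨(I.raw T bag).answer, t, hrun, I.raw_answer_iff T bag hdec, ht.trans ?_⟩
  have h1 : 1 ≤ (2 * (D + 1)) ^ tw := Nat.one_le_pow _ _ (by omega)
  have h2 : 1 ≤ I.inputSize m := by
    have := Nat.size_pos.2 I.p.den_pos
    rw [PDifr.inputSize]
    omega
  calc ((2 * (D + 1)) ^ tw + 1) * (I.inputSize m + 2) ^ e
      ≤ (2 * (2 * (D + 1)) ^ tw) * (3 * I.inputSize m) ^ e := by gcongr <;> omega
    _ = _ := by rw [mul_pow]; ring
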